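/- Let $\mathbb T^d=(\mathbb R/\mathbb Z)^d$ and let $\|\cdot\|_s$ denote the norm of $H^s(\mathbb T^d)$. Let $T>0$, let $k\ge\lfloor d/2\rfloor+2$ and $0\le r\le k-1$ be integers, let $A_0,A_1,\dots,A_d$ be smooth functions on $\mathbb R^N$ with values in the real symmetric $N\times N$ matrices, with $A_0(y)$ positive definite for every $y$, and let $L=\sum_{i=1}^d B_i\partial_{x_i}+C$ be a first-order differential operator with constant real coefficients, mapping $\mathbb R^N$-valued to $\mathbb R^m$-valued functions, with $L^2$-adjoint $L^*$. Then for all constants $K,c_1,c_2$ there is a constant $c>0$, depending only on these data (and not on $\delta$ or on the functions below), such that the following holds for every $\delta>0$. Let $F\in C^0([0,T];H^{k-1})$, and let $u,U\in C^0([0,T];H^k)$ have the same initial value $u(0)=U(0)=u_0$ and solve, for $t\in[0,T]$, $$A_0(u)u_t+\sum_{i=1}^dA_i(u)u_{x_i}=F+L^*v+A_0(u)\partial_t\Xi_u+\xi_u,\qquad Lu=0,$$ $$A_0(U)U_t+\sum_{i=1}^dA_i(U)U_{x_i}=F+L^*V+A_0(U)\partial_t\Xi_U+\xi_U,\qquad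 LU=0,$$ where at each time $\xi_u,\xi_U\in L^2$ and $v,V\in L^2$ with $L^*v,L^*V\in L^2$ in the sense of distributions, and where $u,U,\Xi_u,\Xi_U$ are differentiable on $[0,T]$ as functions of $t$ with values in $L^2$. Assume that for all $t\in[0,T]$ $$\|F\|_{k-1}\le K,\qquad \|u\|_k\le K,\qquad \|U\|_k\le K,$$ $$\|\Xi_u\|_{k-r}+\|\Xi_U\|_{k-r}+\|\xi_u\|_{k-r-1}+\|\xi_U\|_{k-r-1}\le c_1\delta,$$ $$L\Xi_u=0=L\Xi_U,\qquad \|\partial_t\Xi_U\|_{k-r-1}\le c_2 .$$ Then $\max_{0\le t\le T}\|u-U\|_{k-r-1}\le c\,\delta$. -/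

import Mathlib

open MeasureTheory Filter Topology
open scoped ENNReal ContDiff Matrix

noncomputable section

namespace SymHyp

/-- The normalised Haar measure on the flat torus `(ℝ/ℤ)^d`. This is the measure with respect to
which `UnitAddTorus.mFourierCoeff` is defined. -/
def torusMeasure (d : ℕ) : Measure (UnitAddTorus (Fin d)) :=
  Measure.pi (fun _ => AddCircle.haarAddCircle)

/-- The Hilbert space `L²(𝕋^d; ℝ^N)`. -/
abbrev L2 (d N : ℕ) : Type :=
  Lp (EuclideanSpace ℝ (Fin N)) 2 (torusMeasure d)

/-- The vector of `n`-th Fourier coefficients `∫ e^{-2πi n·x} f_j(x) dx`, `j = 1, …, N`. -/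
def coeff {d N : ℕ} (f : L2 d N) (n : Fin d → ℤ) : Fin N → ℂ :=
  fun j => UnitAddTorus.mFourierCoeff (fun x => ((f x j : ℝ) : ℂ)) n

/-- The norm of the Sobolev space `H^s(𝕋^d; ℝ^N)`, with value `∞` outside of that space:
`‖f‖_s² = ∑_{n ∈ ℤ^d} (1 + |n|²)^s |f̂(n)|²`. -/
def sobolevNorm {d N : ℕ} (s : ℕ) (f : L2 d N) : ℝ≥0∞ :=
  (∑' n : Fin d → ℤ,
    ENNReal.ofReal ((1 + ∑ i, (n i : ℝ) ^ 2) ^ s * ∑ j, ‖coeff f n j‖ ^ 2)) ^ (1 / 2 : ℝ)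

/-- `f ∈ C⁰([0,T]; H^s)`. -/
def ContInSobolev {d N : ℕ} (T : ℝ) (s : ℕ) (f : ℝ → L2 d N) : Prop :=
  (∀ t ∈ Set.Icc 0 T, sobolevNorm s (f t) < (⊤ : ℝ≥0∞)) ∧
  ∀ t ∈ Set.Icc 0 T,
    Tendsto (fun t' => sobolevNorm s (f t' - f t)) (𝓝[Set.Icc 0 T] t) (𝓝 0)

/-- `g` is the weak derivative `∂f/∂x_i` (the defining identity, tested against the characters
`e^{-2πi n·x}`, whose span is dense in the smooth functions on the torus). -/
def IsWeakDeriv {d N : ℕ} (i : Fin d) (f g : L2 d N) : Prop :=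
  ∀ (n : Fin d → ℤ) (j : Fin N),
    coeff g n j = (2 * Real.pi * Complex.I * (n i : ℂ)) * coeff f n j

/-- A first-order differential operator `L = ∑ i, B i ∂/∂x_i + C` with constant (real matrix)
coefficients, mapping `ℝ^N`-valued functions to `ℝ^m`-valued functions. -/
structure FirstOrderOp (d N m : ℕ) where
  B : Fin d → Matrix (Fin m) (Fin N) ℝ
  C : Matrix (Fin m) (Fin N) ℝ

/-- The formal `L²`-adjoint `L^* = -∑ i, (B i)ᵀ ∂/∂x_i + Cᵀ`. -/
def FirstOrderOp.adjoint {d N m : ℕ} (L : FirstOrderOp d N m) : FirstOrderOp d m N where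
  B := fun i => -(L.B i)ᵀ
  C := L.Cᵀ

/-- The Fourier symbol `∑ i, 2πi n_i B i + C` of the operator. -/
def FirstOrderOp.symbol {d N m : ℕ} (L : FirstOrderOp d N m) (n : Fin d → ℤ) :
    Matrix (Fin m) (Fin N) ℂ :=
  ∑ i, (2 * Real.pi * Complex.I * (n i : ℂ)) • (L.B i).map (fun a : ℝ => (a : ℂ)) +
    L.C.map (fun a : ℝ => (a : ℂ))

/-- `L f = h` in the sense of distributions on the torus. -/
def FirstOrderOp.Maps {d N m : ℕ} (L : FirstOrderOp d N m) (f : L2 d N) (h : L2 d m) : Prop :=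
  ∀ n : Fin d → ℤ, coeff h n = L.symbol n *ᵥ coeff f n

/-- `u ∈ C⁰([0,T]; H^k)` solves, for `t ∈ [0,T]`, the system
`A₀(u) u_t + ∑ i, A_i(u) u_{x_i} = F + L^* v + A₀(u) ∂_t Ξ + ξ`, with constraint `L u = 0`.
Time derivatives are (one-sided at the end points) derivatives of `L²`-valued functions, space
derivatives are weak derivatives, `w = L^* v` is meant in the sense of distributions, and the
equation holds almost everywhere on the torus for each `t`. -/
structure IsSolution {d N m : ℕ} (T : ℝ) (k : ℕ)
    (A₀ : EuclideanSpace ℝ (Fin N) → Matrix (Fin N) (Fin N) ℝ)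
    (A : Fin d → EuclideanSpace ℝ (Fin N) → Matrix (Fin N) (Fin N) ℝ)
    (L : FirstOrderOp d N m) (F : ℝ → L2 d N)
    (u : ℝ → L2 d N) (v : ℝ → L2 d m) (Ξ ξ : ℝ → L2 d N) : Prop where
  continuous_sobolev : ContInSobolev T k u
  differentiable : DifferentiableOn ℝ u (Set.Icc 0 T)
  differentiable_err : DifferentiableOn ℝ Ξ (Set.Icc 0 T)
  constraint : ∀ t ∈ Set.Icc 0 T, L.Maps (u t) 0
  equation : ∀ t ∈ Set.Icc 0 T, ∃ (ux : Fin d → L2 d N) (w : L2 d N),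
    (∀ i, IsWeakDeriv i (u t) (ux i)) ∧ L.adjoint.Maps (v t) w ∧
    ∀ᵐ x ∂(torusMeasure d),
      A₀ (u t x) *ᵥ (derivWithin u (Set.Icc 0 T) t x).ofLp +
          ∑ i, A i (u t x) *ᵥ (ux i x).ofLp =
        (F t x).ofLp + (w x).ofLp +
          A₀ (u t x) *ᵥ (derivWithin Ξ (Set.Icc 0 T) t x).ofLp + (ξ t x).ofLp

end SymHyp

end

noncomputable section

namespace SymHyp

/-! ### Weighted `ℓ²` norms of sequences with values in `[0, ∞]` -/

section Sequences

variable {ι : Type*}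

/-! Put p = k - 1 > d/2 and s = k - 1 - r ≤ p. The proof is an energy estimate for u - U in H^s,
corrected so that neither the multipliers v, V nor the time derivatives of the errors Ξ have to be
estimated.

Elimination of v. Since Lu = LΞ_u = 0, the modified derivative y_u = ∂_t(u - Ξ_u) lies in ker L, and
the equation says that A₀(u)y_u - (F - ∑ A_i(u)∂_i u + ξ_u) = L^*v is orthogonal to ker L. So y_u
solves a coercive problem on ker L (`IsProjSol`) in which v no longer occurs. As L has constant
coefficients, scalar Fourier multipliers J preserve ker L; testing with J²y and commuting J past
A₀(u) gives regularity (`exists_elliptic_bound`). By linearity y_u = y₁ + O(δ) in H^s, where y₁, the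
solution without ξ_u, is bounded in H^p (`SymCoeffs.exists_split_le`).

The unknown. Let z = u - U - (Ξ_u - Ξ_U). Then z ∈ ker L, ∂_t z = y_u - y_U and z(0) = O(δ). Modulo
the orthogonal complement of ker L, A₀(U)∂_t z + ∑ A_i(U)∂_i z equals a remainder that is O(‖z‖_s +
δ) in H^s (`SymCoeffs.exists_sliceRem_le`); the splitting of y_u is what controls (A₀(u) - A₀(U))y_u
when s is small.

The weight. The natural energy weight A₀(U) would require a sup norm bound on ∂_t U, which is not at
hand for small s. It is replaced by A₀(Ũ) with Ũ = u₀ + ∫ y₁, for the y₁ belonging to U. This Ũ is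
Lipschitz in time with values in H^p ⊆ L^∞, and U - Ũ - Ξ_U has a time derivative of size O(δ) in
H^s, so U - Ũ = O(δ) in H^s and the exchange of weights costs O(δ)
(`SymCoeffs.exists_norm_mulOp_sub_le`).

Closing the estimate. Because z is differentiable in time only in L², the energy is ⟨A₀(Ũ)J_R z, J_R
z⟩ with the bounded multiplier J_R of symbol min(⟨n⟩, R)^s; all bounds are uniform in R
(`SymCoeffs.exists_energy_le`). Its growth is bounded by C(‖z‖_s + δ)², which contains the supremum
over R and not J_R z alone, so Gronwall's inequality is replaced by absorption in a supremum with
exponential weight in time (`le_of_improve`).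

The analysis on the torus takes place on Fourier coefficients: Sobolev norms are weighted ℓ² norms,
products are convolutions, and Young and Cauchy-Schwarz yield the product and commutator estimates.
Compositions with smooth functions are handled by induction on the order through the chain rule
`fc_chain`. -/

/-- The `ℓ²` norm of a sequence with values in `[0, ∞]`. -/
def l2 (c : ι → ℝ≥0∞) : ℝ≥0∞ := (∑' n, c n ^ 2) ^ (1 / 2 : ℝ)

lemma l2_sq (c : ι → ℝ≥0∞) : l2 c ^ 2 = ∑' n, c n ^ 2 := by
  rw [l2, ← ENNReal.rpow_natCast, ← ENNReal.rpow_mul]; norm_num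

lemma l2_le_iff {c : ι → ℝ≥0∞} {b : ℝ≥0∞} : l2 c ≤ b ↔ ∑' n, c n ^ 2 ≤ b ^ 2 := by
  rw [← l2_sq]
  exact (ENNReal.pow_le_pow_left_iff (two_ne_zero : (2 : ℕ) ≠ 0)).symm

lemma l2_mono {c c' : ι → ℝ≥0∞} (h : ∀ n, c n ≤ c' n) : l2 c ≤ l2 c' := by
  unfold l2
  gcongr with n
  exact h n

lemma l2_const_mul (a : ℝ≥0∞) (c : ι → ℝ≥0∞) : l2 (fun n => a * c n) = a * l2 c := by
  have : l2 (fun n => a * c n) ^ 2 = (a * l2 c) ^ 2 := by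
    rw [l2_sq, mul_pow, l2_sq, ← ENNReal.tsum_mul_left]
    simp_rw [mul_pow]
  exact (ENNReal.pow_right_strictMono two_ne_zero).injective this

lemma l2_zero : l2 (fun _ : ι => (0 : ℝ≥0∞)) = 0 := by
  simp [l2]

/-- Cauchy-Schwarz. -/
lemma tsum_mul_le_l2 (a b : ι → ℝ≥0∞) : ∑' n, a n * b n ≤ l2 a * l2 b := by
  -- Sums are integrals against counting measure; with the full σ-algebra measurability is free, and
  -- Hölder's inequality applies. The same device gives Minkowski below.
  let _ : MeasurableSpace ι := ⊤
  have := ENNReal.lintegral_mul_le_Lp_mul_Lq (Measure.count : Measure ι)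
    (Real.HolderConjugate.two_two) (f := a) (g := b)
    (measurable_from_top).aemeasurable (measurable_from_top).aemeasurable
  simpa [lintegral_count, l2] using this

lemma l2_add_le (a b : ι → ℝ≥0∞) : l2 (fun n => a n + b n) ≤ l2 a + l2 b := by
  let _ : MeasurableSpace ι := ⊤
  have := ENNReal.lintegral_Lp_add_le (μ := (Measure.count : Measure ι)) (f := a) (g := b)
    (measurable_from_top).aemeasurable (measurable_from_top).aemeasurable
    (p := 2) (by norm_num)
  simpa [lintegral_count, l2] using this

lemma l2_finsetSum_le {κ : Type*} (S : Finset κ) (c : κ → ι → ℝ≥0∞) :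
    l2 (fun n => ∑ i ∈ S, c i n) ≤ ∑ i ∈ S, l2 (c i) := by
  classical
  induction S using Finset.induction_on with
  | empty => simp [l2_zero]
  | insert i S hi ih =>
    simp only [Finset.sum_insert hi]
    exact (l2_add_le _ _).trans (by gcongr)

/-- Convolution of sequences on an additive group. -/
def conv [AddGroup ι] (α β : ι → ℝ≥0∞) (n : ι) : ℝ≥0∞ := ∑' m, α m * β (n - m)

lemma conv_comm [AddCommGroup ι] (α β : ι → ℝ≥0∞) : conv α β = conv β α := by
  funext n
  unfold conv
  rw [← (Equiv.subLeft n).tsum_eq]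
  refine tsum_congr fun m => ?_
  simp [mul_comm]

/-- Young's inequality `ℓ¹ * ℓ² ⊆ ℓ²`. -/
lemma l2_conv_le [AddCommGroup ι] (α β : ι → ℝ≥0∞) :
    l2 (conv α β) ≤ (∑' m, α m) * l2 β := by
  rw [l2_le_iff]
  -- Cauchy-Schwarz after writing α = α^{1/2} · α^{1/2}.
  have h1 : ∀ n, conv α β n ^ 2 ≤ (∑' m, α m) * ∑' m, α m * β (n - m) ^ 2 := by
    intro n
    have hsq : ∀ x : ℝ≥0∞, (x ^ (1 / 2 : ℝ)) ^ 2 = x := fun x => by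
      rw [← ENNReal.rpow_natCast, ← ENNReal.rpow_mul]; norm_num
    have h2 := tsum_mul_le_l2 (fun m => α m ^ (1 / 2 : ℝ))
      (fun m => α m ^ (1 / 2 : ℝ) * β (n - m))
    have h3 := pow_le_pow_left' h2 2
    rw [mul_pow, l2_sq, l2_sq] at h3
    simp_rw [mul_pow, hsq, ← mul_assoc, ← pow_two, hsq] at h3
    exact h3
  calc ∑' n, conv α β n ^ 2 ≤ ∑' n, (∑' m, α m) * ∑' m, α m * β (n - m) ^ 2 :=
        ENNReal.tsum_le_tsum h1
    _ = (∑' m, α m) * ∑' m, α m * ∑' n, β (n - m) ^ 2 := by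
        rw [ENNReal.tsum_mul_left, ENNReal.tsum_comm]
        simp_rw [ENNReal.tsum_mul_left]
    _ = ((∑' m, α m) * l2 β) ^ 2 := by
        have : ∀ m, ∑' n, β (n - m) ^ 2 = ∑' n, β n ^ 2 := fun m =>
          (Equiv.subRight m).tsum_eq (fun n => β n ^ 2)
        simp_rw [this, ENNReal.tsum_mul_right, mul_pow, l2_sq, pow_two, mul_assoc]

end Sequences

/-! ### The weights `⟨n⟩ = (1 + |n|²)^{1/2}` -/

section Weights

variable {d : ℕ}

/-- `⟨n⟩ = (1 + |n|²)^{1/2}`. -/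
def jap (n : Fin d → ℤ) : ℝ := √(1 + ∑ i, (n i : ℝ) ^ 2)

lemma jap_sq (n : Fin d → ℤ) : jap n ^ 2 = 1 + ∑ i, (n i : ℝ) ^ 2 :=
  Real.sq_sqrt (by positivity)

lemma one_le_jap (n : Fin d → ℤ) : 1 ≤ jap n := by
  rw [jap, Real.one_le_sqrt]
  exact le_add_of_nonneg_right (by positivity)

lemma jap_pos (n : Fin d → ℤ) : 0 < jap n := one_pos.trans_le (one_le_jap n)

lemma jap_neg (n : Fin d → ℤ) : jap (-n) = jap n := by simp [jap]

lemma abs_le_jap (n : Fin d → ℤ) (i : Fin d) : |(n i : ℝ)| ≤ jap n := by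
  apply Real.abs_le_sqrt
  have := Finset.single_le_sum (f := fun i => (n i : ℝ) ^ 2) (fun _ _ => sq_nonneg _)
    (Finset.mem_univ i)
  linarith

/-- ⟨n⟩ is the Euclidean norm of the vector (1, n), so this is the reverse triangle inequality; the
first coordinates cancel in the difference. -/
lemma abs_jap_sub_le (n m : Fin d → ℤ) : |jap n - jap (n - m)| ≤ jap m := by
  have key : ∀ n : Fin d → ℤ, jap n =
      ‖(WithLp.toLp 2 (fun i : Option (Fin d) => i.elim (1 : ℝ) (fun i => (n i : ℝ))) :
        EuclideanSpace ℝ (Option (Fin d)))‖ := by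
    intro n
    rw [EuclideanSpace.norm_eq]
    simp [jap, Fintype.sum_option]
  rw [key n, key (n - m)]
  refine (abs_norm_sub_norm_le _ _).trans ?_
  rw [EuclideanSpace.norm_eq]
  apply Real.sqrt_le_sqrt
  rw [Fintype.sum_option]
  simp

lemma jap_le_add (n m : Fin d → ℤ) : jap n ≤ jap m + jap (n - m) := by
  have := abs_jap_sub_le n m
  rw [abs_le] at this
  linarith

/-- `⟨n⟩` as an extended nonnegative real. -/
def ejap (n : Fin d → ℤ) : ℝ≥0∞ := ENNReal.ofReal (jap n)

lemma one_le_ejap (n : Fin d → ℤ) : 1 ≤ ejap n := by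
  rw [ejap, ← ENNReal.ofReal_one]
  exact ENNReal.ofReal_le_ofReal (one_le_jap n)

lemma ejap_ne_zero (n : Fin d → ℤ) : ejap n ≠ 0 := (one_pos.trans_le (one_le_ejap n)).ne'

lemma ejap_ne_top (n : Fin d → ℤ) : ejap n ≠ ⊤ := ENNReal.ofReal_ne_top

lemma ejap_le_add (n m : Fin d → ℤ) : ejap n ≤ ejap m + ejap (n - m) := by
  rw [ejap, ejap, ejap, ← ENNReal.ofReal_add (jap_pos _).le (jap_pos _).le]
  exact ENNReal.ofReal_le_ofReal (jap_le_add n m)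

/-- The weighted `ℓ²` norm with weight `⟨n⟩^s`. -/
def hs (s : ℕ) (c : (Fin d → ℤ) → ℝ≥0∞) : ℝ≥0∞ := l2 (fun n => ejap n ^ s * c n)

lemma hs_zero_exp (c : (Fin d → ℤ) → ℝ≥0∞) : hs 0 c = l2 c := by simp [hs]

lemma hs_mono {s : ℕ} {c c' : (Fin d → ℤ) → ℝ≥0∞} (h : ∀ n, c n ≤ c' n) : hs s c ≤ hs s c' :=
  l2_mono fun n => by gcongr; exact h n

lemma hs_mono_exp {s s' : ℕ} (h : s ≤ s') (c : (Fin d → ℤ) → ℝ≥0∞) : hs s c ≤ hs s' c :=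
  l2_mono fun n => by gcongr; exact one_le_ejap n

lemma hs_add_le (s : ℕ) (a b : (Fin d → ℤ) → ℝ≥0∞) :
    hs s (fun n => a n + b n) ≤ hs s a + hs s b := by
  unfold hs
  simp_rw [mul_add]
  exact l2_add_le _ _

lemma hs_finsetSum_le {κ : Type*} (s : ℕ) (S : Finset κ) (c : κ → (Fin d → ℤ) → ℝ≥0∞) :
    hs s (fun n => ∑ i ∈ S, c i n) ≤ ∑ i ∈ S, hs s (c i) := by
  unfold hs
  simp_rw [Finset.mul_sum]
  exact l2_finsetSum_le _ _

lemma hs_const_mul (s : ℕ) (a : ℝ≥0∞) (c : (Fin d → ℤ) → ℝ≥0∞) :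
    hs s (fun n => a * c n) = a * hs s c := by
  unfold hs
  rw [← l2_const_mul]
  congr 1; funext n; ring

lemma hs_ejap_mul (s q : ℕ) (c : (Fin d → ℤ) → ℝ≥0∞) :
    hs s (fun n => ejap n ^ q * c n) = hs (s + q) c := by
  unfold hs
  congr 1; funext n; ring

/-- Peeling off one derivative. -/
lemma hs_succ_le (s : ℕ) (c : (Fin d → ℤ) → ℝ≥0∞) :
    hs (s + 1) c ≤ hs s c + ∑ i, hs s (fun n => ENNReal.ofReal |(n i : ℝ)| * c n) := by
  refine le_trans ?_ (add_le_add le_rfl (hs_finsetSum_le _ _ _))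
  refine le_trans ?_ (hs_add_le _ _ _)
  refine l2_mono fun n => ?_
  have h : ejap n ≤ 1 + ∑ i, ENNReal.ofReal |(n i : ℝ)| := by
    rw [ejap, ← ENNReal.ofReal_one, ← ENNReal.ofReal_sum_of_nonneg (fun _ _ => abs_nonneg _),
      ← ENNReal.ofReal_add zero_le_one (by positivity)]
    refine ENNReal.ofReal_le_ofReal (Real.sqrt_le_iff.2 ⟨by positivity, ?_⟩)
    have h1 := Finset.sum_sq_le_sq_sum_of_nonneg (s := Finset.univ) (f := fun i => |(n i : ℝ)|)
      (fun _ _ => abs_nonneg _)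
    simp only [sq_abs] at h1
    have h2 : 0 ≤ ∑ i, |(n i : ℝ)| := by positivity
    nlinarith
  calc ejap n ^ (s + 1) * c n = ejap n ^ s * (ejap n * c n) := by ring
    _ ≤ ejap n ^ s * ((1 + ∑ i, ENNReal.ofReal |(n i : ℝ)|) * c n) := by gcongr
    _ = _ := by rw [add_mul, one_mul, Finset.sum_mul]

/-! ### Sobolev embedding and product estimates for weighted sequences. -/

/-- The `ℓ²` norm of `⟨n⟩^{-p}`. -/
def embConst (d p : ℕ) : ℝ≥0∞ := l2 (fun n : Fin d → ℤ => (ejap n ^ p)⁻¹)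

/-- Comparison with the sum of ‖n‖^{-2p} over the lattice ℤ^d, which converges because 2p exceeds
the rank; the sup norm of n is at most ⟨n⟩. -/
lemma embConst_lt_top {d p : ℕ} (h : d < 2 * p) : embConst d p < ⊤ := by
  let b := Pi.basisFun ℝ (Fin d)
  let Λ := Submodule.span ℤ (Set.range b)
  have hrank : Module.finrank ℤ Λ < 2 * p := by
    rw [ZLattice.rank ℝ Λ]; simpa using h
  have h1 := ZLattice.summable_norm_pow_inv Λ (2 * p) hrank
  let φ : (Fin d → ℤ) → Λ := fun n => ⟨fun i => (n i : ℝ), by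
    have : (fun i => (n i : ℝ)) = ∑ i, n i • b i := by
      funext j
      simp [b, Finset.sum_apply, Pi.single_apply]
    rw [this]
    exact Submodule.sum_mem _ fun i _ => Submodule.smul_mem _ _ (Submodule.subset_span ⟨i, rfl⟩)⟩
  have hφ : Function.Injective φ := by
    intro n m hnm
    funext i
    have := congrFun (congrArg Subtype.val hnm) i
    simpa [φ] using this
  have h2 := h1.comp_injective hφ
  have h3 : Summable (fun n : Fin d → ℤ => (jap n ^ p)⁻¹ ^ 2) := by
    -- At n = 0 the lattice term is 0⁻¹ = 0 and dominates nothing, so the indicator of the origin is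
    -- added.
    refine (h2.add (summable_of_hasFiniteSupport (f := fun n : Fin d → ℤ =>
      if n = 0 then (1 : ℝ) else 0) ?_)).of_nonneg_of_le (fun n => by positivity) fun n => ?_
    · refine (Set.finite_singleton (0 : Fin d → ℤ)).subset fun n hn => ?_
      by_contra hne
      exact hn (if_neg hne)
    · rcases eq_or_ne n 0 with rfl | hn
      · have : (jap (0 : Fin d → ℤ) ^ p)⁻¹ ^ 2 ≤ 1 := by simp [jap]
        simp only [Function.comp, if_true]
        exact this.trans (le_add_of_nonneg_left (by positivity))
      · simp only [Function.comp, if_neg hn, add_zero]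
        rw [← inv_pow, ← pow_mul, mul_comm p 2]
        have hpos : 0 < ‖φ n‖ := by
          rw [norm_pos_iff]
          intro h0
          apply hn
          funext i
          have := congrFun (congrArg Subtype.val h0) i
          simpa [φ] using this
        refine pow_le_pow_left₀ (inv_nonneg.2 (jap_pos n).le) (inv_anti₀ hpos ?_) _
        change ‖(fun i => (n i : ℝ))‖ ≤ _
        rw [pi_norm_le_iff_of_nonneg (jap_pos n).le]
        exact fun i => abs_le_jap n i
  have h4 : ∀ n : Fin d → ℤ, (ejap n ^ p)⁻¹ ^ 2 = ENNReal.ofReal ((jap n ^ p)⁻¹ ^ 2) := by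
    intro n
    rw [ENNReal.ofReal_pow (by have := jap_pos n; positivity),
      ENNReal.ofReal_inv_of_pos (pow_pos (jap_pos n) _), ENNReal.ofReal_pow (jap_pos n).le]
    rfl
  unfold embConst l2
  refine ENNReal.rpow_lt_top_of_nonneg (by norm_num) ?_
  simp_rw [h4]
  exact h3.tsum_ofReal_ne_top

/-- Cauchy-Schwarz against ⟨n⟩^{-p}. For p > d/2 the constant is finite and H^p lies in the Wiener
algebra; sup norm bounds and the convolution formula for products rest on this. -/
lemma tsum_le_embConst_mul_hs (p : ℕ) (c : (Fin d → ℤ) → ℝ≥0∞) :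
    ∑' n, c n ≤ embConst d p * hs p c := by
  refine le_trans (le_of_eq ?_) (tsum_mul_le_l2 _ _)
  refine tsum_congr fun n => ?_
  rw [← mul_assoc, ENNReal.inv_mul_cancel (pow_ne_zero _ (ejap_ne_zero n))
    (ENNReal.pow_ne_top (ejap_ne_top n)), one_mul]

/-- The product estimate `H^a · H^b ⊆ L²` for `a + b = p > d / 2`. -/
lemma l2_conv_le_hs_mul_hs {a b p : ℕ} (h : a + b = p) (α β : (Fin d → ℤ) → ℝ≥0∞) :
    l2 (conv α β) ≤ 2 * embConst d p * hs a α * hs b β := by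
  set A : (Fin d → ℤ) → ℝ≥0∞ := fun n => ejap n ^ a * α n with hA
  set B : (Fin d → ℤ) → ℝ≥0∞ := fun n => ejap n ^ b * β n with hB
  have hinv : ∀ n : Fin d → ℤ, (ejap n ^ p)⁻¹ * ejap n ^ p = 1 := fun n =>
    ENNReal.inv_mul_cancel (pow_ne_zero _ (ejap_ne_zero n)) (ENNReal.pow_ne_top (ejap_ne_top n))
  -- The lower of the two frequencies can give away the whole weight ⟨·⟩^{-p}: if ⟨m⟩ ≤ ⟨k⟩, then 1
  -- ≤ ⟨m⟩^{-p}⟨m⟩^a⟨k⟩^b. The sequence at that frequency becomes summable, and Young's inequality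
  -- applies to each of the two cases.
  have key : ∀ m k : Fin d → ℤ, α m * β k ≤
      ((ejap m ^ p)⁻¹ * A m) * B k + A m * ((ejap k ^ p)⁻¹ * B k) := by
    intro m k
    rcases le_total (ejap m) (ejap k) with hmk | hmk
    · refine le_trans ?_ le_self_add
      calc α m * β k = ((ejap m ^ p)⁻¹ * (ejap m ^ a * ejap m ^ b)) * (α m * β k) := by
            rw [← pow_add, h, hinv, one_mul]
        _ ≤ ((ejap m ^ p)⁻¹ * (ejap m ^ a * ejap k ^ b)) * (α m * β k) := by gcongr
        _ = _ := by simp only [hA, hB]; ring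
    · refine le_trans ?_ le_add_self
      calc α m * β k = ((ejap k ^ p)⁻¹ * (ejap k ^ a * ejap k ^ b)) * (α m * β k) := by
            rw [← pow_add, h, hinv, one_mul]
        _ ≤ ((ejap k ^ p)⁻¹ * (ejap m ^ a * ejap k ^ b)) * (α m * β k) := by gcongr
        _ = _ := by simp only [hA, hB]; ring
  set A' : (Fin d → ℤ) → ℝ≥0∞ := fun m => (ejap m ^ p)⁻¹ * A m
  set B' : (Fin d → ℤ) → ℝ≥0∞ := fun m => (ejap m ^ p)⁻¹ * B m
  have h1 : l2 (conv α β) ≤ l2 (conv A' B) + l2 (conv A B') := by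
    refine (l2_mono fun n => ?_).trans (l2_add_le _ _)
    unfold conv
    rw [← ENNReal.tsum_add]
    exact ENNReal.tsum_le_tsum fun m => key m (n - m)
  have h2 : l2 (conv A' B) ≤ embConst d p * hs a α * hs b β :=
    (l2_conv_le _ _).trans (by gcongr; exacts [tsum_mul_le_l2 _ _, le_rfl])
  have h3 : l2 (conv A B') ≤ embConst d p * hs a α * hs b β := by
    rw [conv_comm]
    refine (l2_conv_le _ _).trans ?_
    calc (∑' m, B' m) * l2 A ≤ (embConst d p * hs b β) * hs a α := by
          gcongr; exacts [tsum_mul_le_l2 _ _, le_rfl]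
      _ = _ := by ring
  calc l2 (conv α β) ≤ _ := h1.trans (add_le_add h2 h3)
    _ = _ := by ring

lemma add_pow_le_two_pow_mul (x y : ℝ≥0∞) (s : ℕ) :
    (x + y) ^ s ≤ 2 ^ s * (x ^ s + y ^ s) := by
  rcases le_total x y with h | h
  · calc (x + y) ^ s ≤ (2 * y) ^ s := by gcongr; rw [two_mul]; gcongr
      _ ≤ _ := by rw [mul_pow]; gcongr; exact le_add_self
  · calc (x + y) ^ s ≤ (2 * x) ^ s := by gcongr; rw [two_mul]; gcongr
      _ ≤ _ := by rw [mul_pow]; gcongr; exact le_self_add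

/-- The basic bilinear estimate behind the product and commutator estimates. -/
lemma l2_weighted_conv_le {σ p : ℕ} (h : σ ≤ p) (α β : (Fin d → ℤ) → ℝ≥0∞) :
    l2 (fun n => ∑' m, (ejap m ^ σ + ejap (n - m) ^ σ) * (α m * β (n - m))) ≤
      4 * embConst d p * hs p α * hs σ β := by
  have h1 : ∀ n, ∑' m, (ejap m ^ σ + ejap (n - m) ^ σ) * (α m * β (n - m)) =
      conv (fun m => ejap m ^ σ * α m) β n + conv α (fun m => ejap m ^ σ * β m) n := by
    intro n
    unfold conv
    rw [← ENNReal.tsum_add]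
    exact tsum_congr fun m => by ring
  simp_rw [h1]
  refine (l2_add_le _ _).trans ?_
  -- The exponents are split as (p - σ) + σ when the weight sits on α and as p + 0 when it sits on
  -- β; either way α is measured in H^p and β in H^σ.
  have h2 := l2_conv_le_hs_mul_hs (Nat.sub_add_cancel h) (fun m => ejap m ^ σ * α m) β
  have h3 := l2_conv_le_hs_mul_hs (add_zero p) α (fun m => ejap m ^ σ * β m)
  rw [hs_ejap_mul, Nat.sub_add_cancel h] at h2
  rw [hs_ejap_mul, zero_add] at h3
  calc _ ≤ _ := add_le_add h2 h3
    _ = _ := by ring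

/-- The product estimate `H^p · H^σ ⊆ H^σ` for `σ ≤ p`, `p > d / 2`. -/
lemma hs_conv_le {σ p : ℕ} (h : σ ≤ p) (α β : (Fin d → ℤ) → ℝ≥0∞) :
    hs σ (conv α β) ≤ 2 ^ σ * (4 * embConst d p) * hs p α * hs σ β := by
  have : ∀ n, ejap n ^ σ * conv α β n ≤
      2 ^ σ * ∑' m, (ejap m ^ σ + ejap (n - m) ^ σ) * (α m * β (n - m)) := by
    intro n
    rw [conv, ← ENNReal.tsum_mul_left, ← ENNReal.tsum_mul_left]
    refine ENNReal.tsum_le_tsum fun m => ?_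
    rw [← mul_assoc]
    calc _ ≤ (2 ^ σ * (ejap m ^ σ + ejap (n - m) ^ σ)) * α m * β (n - m) :=
          mul_le_mul_left (mul_le_mul_left ((pow_le_pow_left' (ejap_le_add n m) σ).trans
            (add_pow_le_two_pow_mul _ _ _)) _) _
      _ = _ := by ring
  calc hs σ (conv α β) ≤ _ := l2_mono this
    _ ≤ _ := by
      rw [l2_const_mul]
      calc _ ≤ 2 ^ σ * (4 * embConst d p * hs p α * hs σ β) := by
            gcongr; exact l2_weighted_conv_le h α β
        _ = _ := by ring

/-! ### Truncated weights and their differences. -/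

/-- The truncated weight `min(⟨n⟩, R)^s`. -/
def tjap (s : ℕ) (R : ℝ) (n : Fin d → ℤ) : ℝ := min (jap n) R ^ s

lemma tjap_neg (s : ℕ) (R : ℝ) (n : Fin d → ℤ) : tjap s R (-n) = tjap s R n := by
  simp [tjap, jap_neg]

lemma abs_pow_sub_pow_le' {x y : ℝ} (hx : 0 ≤ x) (hy : 0 ≤ y) (s : ℕ) :
    |x ^ (s + 1) - y ^ (s + 1)| ≤ (s + 1) * |x - y| * (x ^ s + y ^ s) := by
  have h := abs_pow_sub_pow_le x y (s + 1)
  refine h.trans ?_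
  rw [abs_of_nonneg hx, abs_of_nonneg hy]
  have hm : max x y ^ s ≤ x ^ s + y ^ s := by
    rcases le_total x y with h | h
    · rw [max_eq_right h]; linarith [pow_nonneg hx s]
    · rw [max_eq_left h]; linarith [pow_nonneg hy s]
  simp only [Nat.add_sub_cancel]
  push_cast
  calc |x - y| * (s + 1) * max x y ^ s ≤ |x - y| * (s + 1) * (x ^ s + y ^ s) := by gcongr
    _ = _ := by ring

/-- Truncation is 1-Lipschitz, so ⟨n⟩ and ⟨n - m⟩ remain within ⟨m⟩ of each other after it, and a
difference of powers loses one power. The bound does not depend on R and trades one derivative for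
the factor ⟨m⟩: this is the source of the commutator estimate. -/
lemma abs_tjap_sub_le (σ : ℕ) {R : ℝ} (hR : 0 ≤ R) (n m : Fin d → ℤ) :
    |tjap (σ + 1) R n - tjap (σ + 1) R (n - m)| ≤
      ((σ + 1) * 2 ^ (σ + 1)) * (jap m * (jap m ^ σ + jap (n - m) ^ σ)) := by
  have hn := (jap_pos n).le
  have hm := (jap_pos m).le
  have hk := (jap_pos (n - m)).le
  have h1 := abs_pow_sub_pow_le' (le_min hn hR) (le_min hk hR) σ
  have h2 : |min (jap n) R - min (jap (n - m)) R| ≤ jap m :=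
    (abs_min_sub_min_le_max _ _ _ _).trans (by rw [sub_self, abs_zero]; exact max_le (abs_jap_sub_le n m) hm)
  have h3 : min (jap n) R ^ σ ≤ 2 ^ σ * (jap m ^ σ + jap (n - m) ^ σ) := by
    calc min (jap n) R ^ σ ≤ (jap m + jap (n - m)) ^ σ := by
          exact pow_le_pow_left₀ (le_min hn hR) ((min_le_left _ _).trans (jap_le_add n m)) _
      _ ≤ _ := by
        rcases le_total (jap m) (jap (n - m)) with h | h
        · calc (jap m + jap (n - m)) ^ σ ≤ (2 * jap (n - m)) ^ σ := by gcongr; linarith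
            _ ≤ _ := by rw [mul_pow]; gcongr; linarith [pow_nonneg hm σ]
        · calc (jap m + jap (n - m)) ^ σ ≤ (2 * jap m) ^ σ := by gcongr; linarith
            _ ≤ _ := by rw [mul_pow]; gcongr; linarith [pow_nonneg hk σ]
  have h4 : min (jap (n - m)) R ^ σ ≤ 2 ^ σ * (jap m ^ σ + jap (n - m) ^ σ) := by
    calc min (jap (n - m)) R ^ σ ≤ jap (n - m) ^ σ := by
          exact pow_le_pow_left₀ (le_min hk hR) (min_le_left _ _) _
      _ ≤ 1 * (jap m ^ σ + jap (n - m) ^ σ) := by linarith [pow_nonneg hm σ]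
      _ ≤ _ := by gcongr; exact one_le_pow₀ (by norm_num)
  unfold tjap
  calc _ ≤ _ := h1
    _ ≤ (σ + 1) * jap m * (2 ^ σ * (jap m ^ σ + jap (n - m) ^ σ)
        + 2 ^ σ * (jap m ^ σ + jap (n - m) ^ σ)) := by gcongr
    _ = _ := by ring

end Weights

open scoped ComplexConjugate

/-! ### Fourier coefficients on `L²(𝕋^d; ℝ^N)` -/

section Fourier

variable {d N : ℕ}

instance : IsProbabilityMeasure (torusMeasure d) := by
  unfold torusMeasure; infer_instance

instance : (torusMeasure d).IsAddHaarMeasure := by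
  unfold torusMeasure; infer_instance

/-- Fourier coefficients of a real valued function. -/
def fc (f : UnitAddTorus (Fin d) → ℝ) (n : Fin d → ℤ) : ℂ :=
  UnitAddTorus.mFourierCoeff (fun x => (f x : ℂ)) n

lemma mFourierCoeff_eq (f : UnitAddTorus (Fin d) → ℂ) (n : Fin d → ℤ) :
    UnitAddTorus.mFourierCoeff f n =
      ∫ x, UnitAddTorus.mFourier (-n) x * f x ∂(torusMeasure d) := rfl

lemma coeff_eq_fc (f : L2 d N) (n : Fin d → ℤ) (j : Fin N) :
    coeff f n j = fc (fun x => f x j) n := rfl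

lemma fc_congr {f g : UnitAddTorus (Fin d) → ℝ} (h : f =ᵐ[torusMeasure d] g) : fc f = fc g := by
  funext n
  unfold fc
  rw [mFourierCoeff_eq, mFourierCoeff_eq]
  refine integral_congr_ae ?_
  filter_upwards [h] with x hx
  rw [hx]

lemma fc_neg (f : UnitAddTorus (Fin d) → ℝ) (n : Fin d → ℤ) : fc f (-n) = conj (fc f n) := by
  unfold fc
  rw [mFourierCoeff_eq, mFourierCoeff_eq, ← integral_conj]
  refine integral_congr_ae (Eventually.of_forall fun x => ?_)
  simp [UnitAddTorus.mFourier_neg]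

lemma coeff_neg (f : L2 d N) (n : Fin d → ℤ) (j : Fin N) :
    coeff f (-n) j = conj (coeff f n j) := fc_neg _ _

/-- The Fourier basis of `L²(𝕋^d; ℂ)`. -/
def fourierBasis (d : ℕ) : HilbertBasis (Fin d → ℤ) ℂ (Lp ℂ 2 (torusMeasure d)) :=
  UnitAddTorus.mFourierBasis

lemma fourierBasis_repr (f : Lp ℂ 2 (torusMeasure d)) (n : Fin d → ℤ) :
    (fourierBasis d).repr f n = UnitAddTorus.mFourierCoeff f n :=
  UnitAddTorus.mFourierBasis_repr f n

/-- The `j`-th component of a vector field, as a complex valued function. -/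
def compC (j : Fin N) : L2 d N →L[ℝ] Lp ℂ 2 (torusMeasure d) :=
  (Complex.ofRealCLM.comp (EuclideanSpace.proj j)).compLpL 2 (torusMeasure d)

lemma compC_ae (j : Fin N) (f : L2 d N) :
    ∀ᵐ x ∂(torusMeasure d), compC j f x = ((f x j : ℝ) : ℂ) :=
  ContinuousLinearMap.coeFn_compLp _ f

lemma coeff_eq_repr (f : L2 d N) (n : Fin d → ℤ) (j : Fin N) :
    coeff f n j = (fourierBasis d).repr (compC j f) n := by
  rw [fourierBasis_repr, mFourierCoeff_eq, coeff, mFourierCoeff_eq]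
  refine integral_congr_ae ?_
  filter_upwards [compC_ae j f] with x hx
  rw [hx]

/-- A Fourier coefficient as a continuous linear functional. -/
def coeffCLM (n : Fin d → ℤ) (j : Fin N) : L2 d N →L[ℝ] ℂ :=
  ((innerSL ℂ (fourierBasis d n)).restrictScalars ℝ).comp (compC j)

lemma coeffCLM_apply (n : Fin d → ℤ) (j : Fin N) (f : L2 d N) :
    coeffCLM n j f = coeff f n j := by
  rw [coeff_eq_repr, HilbertBasis.repr_apply_apply]
  rfl

lemma coeff_add (f g : L2 d N) (n : Fin d → ℤ) : coeff (f + g) n = coeff f n + coeff g n := by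
  funext j
  simp [← coeffCLM_apply]

lemma coeff_sub (f g : L2 d N) (n : Fin d → ℤ) : coeff (f - g) n = coeff f n - coeff g n := by
  funext j
  simp [← coeffCLM_apply]

lemma coeff_smul (a : ℝ) (f : L2 d N) (n : Fin d → ℤ) :
    coeff (a • f) n = fun j => (a : ℂ) * coeff f n j := by
  funext j
  simp [← coeffCLM_apply]

lemma coeff_zero (n : Fin d → ℤ) : coeff (0 : L2 d N) n = 0 := by
  funext j
  simp [← coeffCLM_apply]

/-- The Fourier coefficient as an element of the Hermitian space `ℂ^N`. -/
def vec (f : L2 d N) (n : Fin d → ℤ) : EuclideanSpace ℂ (Fin N) := WithLp.toLp 2 (coeff f n)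

/-- Parseval's identity. -/
lemma hasSum_inner_vec (f g : L2 d N) :
    HasSum (fun n => (inner ℂ (vec f n) (vec g n)).re) (inner ℝ f g) := by
  have h1 : ∀ j, HasSum (fun n => (conj (coeff f n j) * coeff g n j).re)
      (∫ x, f x j * g x j ∂(torusMeasure d)) := by
    intro j
    have h2 : HasSum (fun n => conj (UnitAddTorus.mFourierCoeff (compC j f) n) *
        UnitAddTorus.mFourierCoeff (compC j g) n)
        (∫ x, conj (compC j f x) * compC j g x ∂(torusMeasure d)) :=
      UnitAddTorus.hasSum_prod_mFourierCoeff (compC j f) (compC j g)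
    have h3 := Complex.hasSum_re h2
    simp only [coeff_eq_repr, fourierBasis_repr]
    convert h3 using 1
    have h4 : ∫ x, conj (compC j f x) * compC j g x ∂(torusMeasure d) =
        ∫ x, ((f x j * g x j : ℝ) : ℂ) ∂(torusMeasure d) := by
      refine integral_congr_ae ?_
      filter_upwards [compC_ae j f, compC_ae j g] with x hx hx'
      rw [hx, hx']
      simp
    rw [h4, integral_complex_ofReal, Complex.ofReal_re]
  have h5 := hasSum_sum (s := Finset.univ) fun j (_ : j ∈ Finset.univ) => h1 j
  convert h5 using 1
  · funext n
    simp [vec, PiLp.inner_apply, mul_comm]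
  · rw [L2.inner_def, ← integral_finsetSum]
    · refine integral_congr_ae (Eventually.of_forall fun x => ?_)
      simp [PiLp.inner_apply, mul_comm]
    · intro j _
      have hm : ∀ f : L2 d N, MemLp (fun x => f x j) 2 (torusMeasure d) := fun f =>
        (EuclideanSpace.proj (𝕜 := ℝ) j).comp_memLp' (Lp.memLp f)
      exact (hm f).integrable_mul (hm g)

/-- The norms of the Fourier coefficients. -/
def ec (f : L2 d N) (n : Fin d → ℤ) : ℝ≥0∞ := ‖vec f n‖ₑ

lemma ec_sq (f : L2 d N) (n : Fin d → ℤ) : ec f n ^ 2 = ENNReal.ofReal (‖vec f n‖ ^ 2) := by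
  rw [ec, ENNReal.ofReal_pow (norm_nonneg _), ofReal_norm]

lemma hasSum_norm_vec_sq (f : L2 d N) : HasSum (fun n => ‖vec f n‖ ^ 2) (‖f‖ ^ 2) := by
  have := hasSum_inner_vec f f
  rw [real_inner_self_eq_norm_sq] at this
  convert this using 2 with n
  rw [inner_self_eq_norm_sq_to_K]
  norm_cast

lemma enorm_eq_l2 (f : L2 d N) : ‖f‖ₑ = l2 (ec f) := by
  refine (ENNReal.pow_right_strictMono two_ne_zero).injective ?_
  have h := hasSum_norm_vec_sq f
  simp only [l2_sq, ec_sq]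
  rw [← ENNReal.ofReal_tsum_of_nonneg (fun _ => by positivity) h.summable, h.tsum_eq,
    ENNReal.ofReal_pow (norm_nonneg _), ofReal_norm]

lemma sobolevNorm_eq_hs (s : ℕ) (f : L2 d N) : sobolevNorm s f = hs s (ec f) := by
  unfold sobolevNorm hs l2
  congr 1
  refine tsum_congr fun n => ?_
  rw [mul_pow, ec_sq, ejap, ← ENNReal.ofReal_pow (jap_pos n).le, ← ENNReal.ofReal_pow
    (pow_nonneg (jap_pos n).le _), ← ENNReal.ofReal_mul (by positivity), ← pow_mul, mul_comm s 2,
    pow_mul, jap_sq, EuclideanSpace.norm_sq_eq]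
  rfl

lemma sobolevNorm_zero_exp (f : L2 d N) : sobolevNorm 0 f = ‖f‖ₑ := by
  rw [sobolevNorm_eq_hs, hs_zero_exp, enorm_eq_l2]

lemma vec_ext {f g : L2 d N} (h : ∀ n, vec f n = vec g n) : f = g := by
  rw [← sub_eq_zero, ← norm_eq_zero, ← sq_eq_zero_iff, ← (hasSum_norm_vec_sq (f - g)).tsum_eq]
  have : ∀ n, vec (f - g) n = 0 := fun n => by
    have := h n
    simp only [vec] at this ⊢
    rw [coeff_sub, WithLp.toLp_sub, this, sub_self]
  simp [this]

lemma vec_add (f g : L2 d N) (n : Fin d → ℤ) : vec (f + g) n = vec f n + vec g n := by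
  simp [vec, coeff_add]

lemma vec_sub (f g : L2 d N) (n : Fin d → ℤ) : vec (f - g) n = vec f n - vec g n := by
  simp [vec, coeff_sub]

lemma vec_smul (a : ℝ) (f : L2 d N) (n : Fin d → ℤ) : vec (a • f) n = (a : ℂ) • vec f n := by
  simp only [vec, coeff_smul]; rfl

lemma vec_zero (n : Fin d → ℤ) : vec (0 : L2 d N) n = 0 := by
  simp [vec, coeff_zero]

lemma ec_add_le (f g : L2 d N) (n : Fin d → ℤ) : ec (f + g) n ≤ ec f n + ec g n := by
  rw [ec, vec_add]; exact enorm_add_le _ _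

lemma ec_sub_le (f g : L2 d N) (n : Fin d → ℤ) : ec (f - g) n ≤ ec f n + ec g n := by
  rw [ec, vec_sub]; exact enorm_sub_le

lemma sobolevNorm_add_le (s : ℕ) (f g : L2 d N) :
    sobolevNorm s (f + g) ≤ sobolevNorm s f + sobolevNorm s g := by
  simp only [sobolevNorm_eq_hs]
  exact (hs_mono (ec_add_le f g)).trans (hs_add_le _ _ _)

lemma sobolevNorm_sub_le (s : ℕ) (f g : L2 d N) :
    sobolevNorm s (f - g) ≤ sobolevNorm s f + sobolevNorm s g := by
  simp only [sobolevNorm_eq_hs]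
  exact (hs_mono (ec_sub_le f g)).trans (hs_add_le _ _ _)

lemma sobolevNorm_mono {s s' : ℕ} (h : s ≤ s') (f : L2 d N) :
    sobolevNorm s f ≤ sobolevNorm s' f := by
  simp only [sobolevNorm_eq_hs]
  exact hs_mono_exp h _

lemma sobolevNorm_sum_le {κ : Type*} (s : ℕ) (S : Finset κ) (f : κ → L2 d N) :
    sobolevNorm s (∑ i ∈ S, f i) ≤ ∑ i ∈ S, sobolevNorm s (f i) := by
  classical
  induction S using Finset.induction_on with
  | empty =>
    simp only [Finset.sum_empty, sobolevNorm_eq_hs, hs, ec, vec_zero, enorm_zero, mul_zero,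
      l2_zero, le_refl]
  | insert i S hi ih =>
    simp only [Finset.sum_insert hi]
    exact (sobolevNorm_add_le _ _ _).trans (by gcongr)

/-- The Riesz-Fischer theorem for real vector fields. -/
lemma exists_coeff_eq (c : (Fin d → ℤ) → Fin N → ℂ)
    (hc : ∀ j, Summable fun n => ‖c n j‖ ^ 2) (hneg : ∀ n j, c (-n) j = conj (c n j)) :
    ∃ f : L2 d N, ∀ n, coeff f n = c n := by
  have hmem : ∀ j, Memℓp (fun n => c n j) 2 := fun j => by
    refine memℓp_gen ?_
    simpa using hc j
  let g : Fin N → Lp ℂ 2 (torusMeasure d) := fun j =>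
    (fourierBasis d).repr.symm (⟨fun n => c n j, hmem j⟩ : lp (fun _ => ℂ) 2)
  have hg : ∀ j n, UnitAddTorus.mFourierCoeff (g j) n = c n j := by
    intro j n
    rw [← fourierBasis_repr]
    simp only [g, LinearIsometryEquiv.apply_symm_apply]
  have hre : ∀ j, MemLp (fun x => (g j x).re) 2 (torusMeasure d) := fun j =>
    (Lp.memLp (g j)).re
  have hF : MemLp (fun x => (WithLp.toLp 2 (fun j => (g j x).re) : EuclideanSpace ℝ (Fin N))) 2
      (torusMeasure d) := by
    rw [memLp_piLp_iff]
    exact hre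
  refine ⟨hF.toLp, fun n => funext fun j => ?_⟩
  have hint : ∀ m, Integrable (fun x => UnitAddTorus.mFourier m x * g j x) (torusMeasure d) := by
    intro m
    refine (((Lp.memLp (g j)).integrable one_le_two).bdd_mul (c := 1) ?_ ?_)
    · exact (UnitAddTorus.mFourier m).continuous.aestronglyMeasurable
    · exact Eventually.of_forall fun x =>
        (ContinuousMap.norm_coe_le_norm _ x).trans_eq UnitAddTorus.mFourier_norm
  -- The real part is the mean of g and its conjugate; by the symmetry of c both have the same
  -- Fourier coefficients.
  have h1 : coeff hF.toLp n j = ∫ x, (2 : ℂ)⁻¹ * (UnitAddTorus.mFourier (-n) x * g j x +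
      conj (UnitAddTorus.mFourier n x * g j x)) ∂(torusMeasure d) := by
    rw [coeff, mFourierCoeff_eq]
    refine integral_congr_ae ?_
    filter_upwards [hF.coeFn_toLp] with x hx
    rw [hx]
    simp only [map_mul, ← UnitAddTorus.mFourier_neg, Complex.re_eq_add_conj]
    ring
  have h2 : ∫ x, conj (UnitAddTorus.mFourier n x * g j x) ∂(torusMeasure d) = c n j := by
    rw [integral_conj]
    have := hg j (-n)
    rw [mFourierCoeff_eq, neg_neg] at this
    rw [this, hneg, Complex.conj_conj]
  have h3 : Integrable (fun x => conj (UnitAddTorus.mFourier n x * g j x)) (torusMeasure d) :=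
    (Complex.conjLIE.toContinuousLinearEquiv.toContinuousLinearMap).integrable_comp (hint n)
  rw [h1, integral_const_mul, integral_add (hint _) h3, h2]
  have := hg j n
  rw [mFourierCoeff_eq] at this
  rw [this]
  ring

end Fourier

/-! ### Fourier multipliers -/

section Multipliers

variable {d N : ℕ}

/-- Evenness of the real symbol preserves the conjugation symmetry of the coefficients, so real
fields go to real fields; boundedness of the symbol gives boundedness on L² by Parseval. -/
lemma exists_multiplier (j : (Fin d → ℤ) → ℝ) (B : ℝ) (hB : ∀ n, |j n| ≤ B)
    (hj : ∀ n, j (-n) = j n) :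
    ∃ J : L2 d N →L[ℝ] L2 d N, ∀ f n, vec (J f) n = (j n : ℂ) • vec f n := by
  have hB0 : 0 ≤ B := (abs_nonneg _).trans (hB 0)
  have hex : ∀ f : L2 d N, ∃ g : L2 d N, ∀ n, vec g n = (j n : ℂ) • vec f n := by
    intro f
    obtain ⟨g, hg⟩ := exists_coeff_eq (fun n a => (j n : ℂ) * coeff f n a) (fun a => by
      refine ((hasSum_norm_vec_sq f).summable.mul_left (B ^ 2)).of_nonneg_of_le
        (fun n => by positivity) fun n => ?_
      rw [norm_mul, mul_pow, Complex.norm_real, Real.norm_eq_abs]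
      gcongr
      · exact hB n
      · exact PiLp.norm_apply_le (vec f n) a) (fun n a => by
      simp [hj, coeff_neg])
    refine ⟨g, fun n => ?_⟩
    simp only [vec, hg]
    rfl
  choose g hg using hex
  refine ⟨LinearMap.mkContinuous
    { toFun := g
      map_add' := fun f f' => vec_ext fun n => by simp [hg, vec_add]
      map_smul' := fun a f => vec_ext fun n => by
        simp [hg, vec_smul, smul_smul, mul_comm] } B ?_, fun f n => hg f n⟩
  intro f
  refine (sq_le_sq₀ (norm_nonneg _) (by positivity)).1 ?_
  rw [mul_pow]
  refine hasSum_le (fun n => ?_) (hasSum_norm_vec_sq _) ((hasSum_norm_vec_sq f).mul_left (B ^ 2))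
  change ‖vec (g f) n‖ ^ 2 ≤ _
  rw [hg, norm_smul, mul_pow, Complex.norm_real, Real.norm_eq_abs]
  gcongr
  exact hB n

lemma tjap_nonneg (s R : ℕ) (n : Fin d → ℤ) : 0 ≤ tjap s R n :=
  pow_nonneg (le_min (jap_pos n).le R.cast_nonneg) _

lemma tjap_le_jap_pow (s R : ℕ) (n : Fin d → ℤ) : tjap s R n ≤ jap n ^ s :=
  pow_le_pow_left₀ (le_min (jap_pos n).le R.cast_nonneg) (min_le_left _ _) _

variable (N) in
lemma exists_jop (d s R : ℕ) : ∃ J : L2 d N →L[ℝ] L2 d N,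
    ∀ f n, vec (J f) n = ((tjap s R n : ℝ) : ℂ) • vec f n :=
  exists_multiplier (tjap s R) ((R : ℝ) ^ s) (fun n => by
    rw [abs_of_nonneg (tjap_nonneg s R n)]
    exact pow_le_pow_left₀ (le_min (jap_pos n).le R.cast_nonneg) (min_le_right _ _) _)
    (tjap_neg s R)

/-- The Fourier multiplier with symbol `min(⟨n⟩, R)^s`, a bounded approximation of
`(1 - Δ)^{s/2}`. -/
def jop (s R : ℕ) : L2 d N →L[ℝ] L2 d N := (exists_jop N d s R).choose

lemma vec_jop (s R : ℕ) (f : L2 d N) (n : Fin d → ℤ) :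
    vec (jop s R f) n = ((tjap s R n : ℝ) : ℂ) • vec f n :=
  (exists_jop N d s R).choose_spec f n

lemma jop_zero_exp (R : ℕ) (f : L2 d N) : jop 0 R f = f :=
  vec_ext fun n => by simp [vec_jop, tjap]

lemma inner_jop_left (s R : ℕ) (f g : L2 d N) :
    inner ℝ (jop s R f) g = inner ℝ f (jop s R g) := by
  rw [← (hasSum_inner_vec _ _).tsum_eq, ← (hasSum_inner_vec _ _).tsum_eq]
  refine tsum_congr fun n => ?_
  rw [vec_jop, vec_jop, inner_smul_left, inner_smul_right, Complex.conj_ofReal]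

lemma ec_jop (s R : ℕ) (f : L2 d N) (n : Fin d → ℤ) :
    ec (jop s R f) n = ENNReal.ofReal (tjap s R n) * ec f n := by
  rw [ec, vec_jop, enorm_smul, ec]
  congr 1
  rw [← ofReal_norm, Complex.norm_real, Real.norm_of_nonneg (tjap_nonneg s R n)]

lemma ec_jop_le (s R : ℕ) (f : L2 d N) (n : Fin d → ℤ) :
    ec (jop s R f) n ≤ ejap n ^ s * ec f n := by
  rw [ec_jop, ejap, ← ENNReal.ofReal_pow (jap_pos n).le]
  gcongr
  exact tjap_le_jap_pow s R n

lemma sobolevNorm_jop_le (a s R : ℕ) (f : L2 d N) :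
    sobolevNorm a (jop s R f) ≤ sobolevNorm (a + s) f := by
  rw [sobolevNorm_eq_hs, sobolevNorm_eq_hs, ← hs_ejap_mul]
  exact hs_mono (ec_jop_le s R f)

lemma enorm_jop_le (s R : ℕ) (f : L2 d N) : ‖jop s R f‖ₑ ≤ sobolevNorm s f := by
  rw [← sobolevNorm_zero_exp]
  simpa using sobolevNorm_jop_le 0 s R f

/-- On a finite set of frequencies the truncation is inactive once R is large, and finite sums
determine the norm. Through this lemma L² estimates that are uniform in R become H^s estimates. -/
lemma sobolevNorm_le_of_jop {s : ℕ} {f : L2 d N} {b : ℝ≥0∞} (h : ∀ R, ‖jop s R f‖ₑ ≤ b) :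
    sobolevNorm s f ≤ b := by
  rw [sobolevNorm_eq_hs, hs, l2_le_iff, ENNReal.tsum_eq_iSup_sum]
  refine iSup_le fun S => ?_
  obtain ⟨R, hR⟩ : ∃ R : ℕ, ∀ n ∈ S, jap n ≤ R := by
    obtain ⟨R, hR⟩ := exists_nat_ge (∑ n ∈ S, jap n)
    exact ⟨R, fun n hn => (Finset.single_le_sum (fun n _ => (jap_pos n).le) hn).trans hR⟩
  have h1 := h R
  rw [enorm_eq_l2, l2_le_iff] at h1
  refine le_trans ?_ ((ENNReal.sum_le_tsum S).trans h1)
  refine Finset.sum_le_sum fun n hn => ?_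
  rw [ec_jop, tjap, min_eq_left (hR n hn), ejap, ← ENNReal.ofReal_pow (jap_pos n).le]

lemma sobolevNorm_le_ofReal_iff {s : ℕ} {f : L2 d N} {b : ℝ} (hb : 0 ≤ b) :
    sobolevNorm s f ≤ ENNReal.ofReal b ↔ ∀ R, ‖jop s R f‖ ≤ b := by
  have : ∀ R, ‖jop s R f‖ₑ ≤ ENNReal.ofReal b ↔ ‖jop s R f‖ ≤ b := fun R => by
    rw [← ofReal_norm, ENNReal.ofReal_le_ofReal_iff hb]
  constructor
  · exact fun h R => (this R).1 ((enorm_jop_le s R f).trans h)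
  · exact fun h => sobolevNorm_le_of_jop fun R => (this R).2 (h R)

lemma norm_le_of_sobolevNorm {s : ℕ} {f : L2 d N} {b : ℝ} (hb : 0 ≤ b)
    (h : sobolevNorm s f ≤ ENNReal.ofReal b) : ‖f‖ ≤ b := by
  have := (sobolevNorm_mono (Nat.zero_le s) f).trans h
  rwa [sobolevNorm_zero_exp, ← ofReal_norm, ENNReal.ofReal_le_ofReal_iff hb] at this

/-- A mean value inequality in `H^s` for functions that are differentiable in `L²`. -/
lemma sobolevNorm_sub_le_of_deriv {T M : ℝ} {s : ℕ} {z z' : ℝ → L2 d N} (hM : 0 ≤ M)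
    (hz : ∀ t ∈ Set.Icc 0 T, HasDerivWithinAt z (z' t) (Set.Icc 0 T) t)
    (hz' : ∀ t ∈ Set.Icc 0 T, sobolevNorm s (z' t) ≤ ENNReal.ofReal M)
    {t t' : ℝ} (ht : t ∈ Set.Icc 0 T) (ht' : t' ∈ Set.Icc 0 T) :
    sobolevNorm s (z t' - z t) ≤ ENNReal.ofReal (M * |t' - t|) := by
  rw [sobolevNorm_le_ofReal_iff (by positivity)]
  intro R
  -- The bounded operator J_R preserves differentiability in L², so the usual mean value inequality
  -- applies to J_R z for each R.
  have := (convex_Icc (0 : ℝ) T).norm_image_sub_le_of_norm_hasDerivWithin_le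
    (f := fun t => jop s R (z t)) (f' := fun t => jop s R (z' t)) (C := M)
    (fun t ht => (jop s R).hasFDerivAt.comp_hasDerivWithinAt t (hz t ht))
    (fun t ht => (sobolevNorm_le_ofReal_iff hM).1 (hz' t ht) R) ht ht'
  rw [map_sub]
  exact this

/-! ### Weak derivatives -/

lemma isWeakDeriv_iff {i : Fin d} {f g : L2 d N} :
    IsWeakDeriv i f g ↔ ∀ n, vec g n = (2 * Real.pi * Complex.I * (n i : ℂ)) • vec f n := by
  constructor
  · intro h n
    ext j
    exact h n j
  · intro h n j
    exact congrFun (congrArg WithLp.ofLp (h n)) j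

lemma IsWeakDeriv.unique {i : Fin d} {f g g' : L2 d N} (h : IsWeakDeriv i f g)
    (h' : IsWeakDeriv i f g') : g = g' :=
  vec_ext fun n => by rw [isWeakDeriv_iff.1 h, isWeakDeriv_iff.1 h']

lemma IsWeakDeriv.sub {i : Fin d} {f g f' g' : L2 d N} (h : IsWeakDeriv i f g)
    (h' : IsWeakDeriv i f' g') : IsWeakDeriv i (f - f') (g - g') :=
  isWeakDeriv_iff.2 fun n => by
    rw [vec_sub, vec_sub, isWeakDeriv_iff.1 h, isWeakDeriv_iff.1 h', smul_sub]

lemma IsWeakDeriv.jop {i : Fin d} {f g : L2 d N} (h : IsWeakDeriv i f g) (s R : ℕ) :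
    IsWeakDeriv i (jop s R f) (jop s R g) :=
  isWeakDeriv_iff.2 fun n => by
    rw [vec_jop, vec_jop, isWeakDeriv_iff.1 h, smul_comm]

lemma enorm_two_pi_I_mul (i : Fin d) (n : Fin d → ℤ) :
    ‖(2 * Real.pi * Complex.I * (n i : ℂ))‖ₑ =
      ENNReal.ofReal (2 * Real.pi) * ENNReal.ofReal |(n i : ℝ)| := by
  rw [← ENNReal.ofReal_mul (by positivity), ← ofReal_norm]
  congr 1
  simp [abs_of_pos Real.pi_pos]

lemma IsWeakDeriv.ec_eq {i : Fin d} {f g : L2 d N} (h : IsWeakDeriv i f g) (n : Fin d → ℤ) :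
    ec g n = ENNReal.ofReal (2 * Real.pi) * (ENNReal.ofReal |(n i : ℝ)| * ec f n) := by
  rw [ec, isWeakDeriv_iff.1 h, enorm_smul, enorm_two_pi_I_mul, mul_assoc, ec]

lemma IsWeakDeriv.sobolevNorm_le {i : Fin d} {f g : L2 d N} (h : IsWeakDeriv i f g) (s : ℕ) :
    sobolevNorm s g ≤ ENNReal.ofReal (2 * Real.pi) * sobolevNorm (s + 1) f := by
  rw [sobolevNorm_eq_hs, sobolevNorm_eq_hs, ← hs_ejap_mul, ← hs_const_mul]
  refine hs_mono fun n => ?_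
  rw [h.ec_eq, pow_one]
  gcongr
  exact ENNReal.ofReal_le_ofReal (abs_le_jap n i)

lemma exists_isWeakDeriv (i : Fin d) {f : L2 d N} (hf : sobolevNorm 1 f < ⊤) :
    ∃ g, IsWeakDeriv i f g := by
  have hsum : Summable (fun n : Fin d → ℤ => |(n i : ℝ)| ^ 2 * ‖vec f n‖ ^ 2) := by
    have h1 : ∑' n : Fin d → ℤ, (ejap n ^ 1 * ec f n) ^ 2 ≠ ⊤ := by
      rw [← l2_sq]
      rw [sobolevNorm_eq_hs] at hf
      exact (ENNReal.pow_lt_top hf).ne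
    refine (ENNReal.summable_toReal h1).of_nonneg_of_le (fun n => by positivity) fun n => ?_
    rw [mul_pow, ENNReal.toReal_mul, ec_sq, ENNReal.toReal_ofReal (by positivity), pow_one, ejap,
      ← ENNReal.ofReal_pow (jap_pos n).le, ENNReal.toReal_ofReal (by positivity)]
    gcongr
    exact abs_le_jap n i
  obtain ⟨g, hg⟩ := exists_coeff_eq
    (fun n j => (2 * Real.pi * Complex.I * (n i : ℂ)) * coeff f n j) (fun j => by
      refine (hsum.mul_left ((2 * Real.pi) ^ 2)).of_nonneg_of_le
        (fun n => by positivity) fun n => ?_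
      have h2 : ‖coeff f n j‖ ≤ ‖vec f n‖ := PiLp.norm_apply_le (vec f n) j
      have h3 : ‖(2 * Real.pi * Complex.I * (n i : ℂ))‖ = 2 * Real.pi * |(n i : ℝ)| := by
        simp [abs_of_pos Real.pi_pos]
      rw [norm_mul, mul_pow, h3, mul_pow, mul_assoc]
      gcongr) (fun n j => by
      simp [coeff_neg, Complex.conj_ofNat])
  exact ⟨g, fun n j => congrFun (hg n) j⟩

lemma inner_isWeakDeriv {i : Fin d} {f f' g g' : L2 d N} (hf : IsWeakDeriv i f f')
    (hg : IsWeakDeriv i g g') : inner ℝ f' g = -inner ℝ f g' := by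
  rw [← (hasSum_inner_vec _ _).tsum_eq, ← (hasSum_inner_vec _ _).tsum_eq, ← tsum_neg]
  refine tsum_congr fun n => ?_
  rw [isWeakDeriv_iff.1 hf, isWeakDeriv_iff.1 hg, inner_smul_left, inner_smul_right,
    ← Complex.neg_re]
  congr 1
  simp [Complex.conj_ofNat]

/-! ### The kernel of the constraint operator -/

/-- The space of fields `f ∈ L²` with `L f = 0` in the sense of distributions. -/
def FirstOrderOp.ker {m : ℕ} (L : FirstOrderOp d N m) : Submodule ℝ (L2 d N) where
  carrier := {f | L.Maps f 0}
  add_mem' := by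
    intro f g hf hg n
    rw [coeff_add, Matrix.mulVec_add, ← hf n, ← hg n, coeff_zero, add_zero]
  zero_mem' := by
    intro n
    rw [coeff_zero, coeff_zero, Matrix.mulVec_zero]
  smul_mem' := by
    intro a f hf n
    have : coeff (a • f) n = (a : ℂ) • coeff f n := coeff_smul a f n
    rw [this, Matrix.mulVec_smul, ← hf n, coeff_zero, smul_zero]

lemma FirstOrderOp.mem_ker {m : ℕ} {L : FirstOrderOp d N m} {f : L2 d N} :
    f ∈ L.ker ↔ L.Maps f 0 := Iff.rfl

/-- The condition is imposed on one frequency at a time, and each coefficient is continuous on L².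
Closedness makes ker L a Hilbert space and keeps time derivatives inside it. -/
lemma FirstOrderOp.isClosed_ker {m : ℕ} (L : FirstOrderOp d N m) :
    IsClosed (L.ker : Set (L2 d N)) := by
  have : (L.ker : Set (L2 d N)) = ⋂ n, {f | L.symbol n *ᵥ coeff f n = 0} := by
    ext f
    simp only [SetLike.mem_coe, mem_ker, Maps, coeff_zero, Set.mem_iInter, Set.mem_ofPred_eq,
      eq_comm]
  rw [this]
  refine isClosed_iInter fun n => isClosed_eq ?_ continuous_const
  have : Continuous fun f : L2 d N => coeff f n := by
    refine continuous_pi fun j => ?_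
    simp only [← coeffCLM_apply]
    exact (coeffCLM n j).continuous
  exact continuous_const.matrix_mulVec this

/-- With constant coefficients the symbol of L acts separately at each frequency and commutes with
scalars. Hence J(Jz) is an admissible test function whenever z ∈ ker L. -/
lemma FirstOrderOp.jop_mem_ker {m : ℕ} {L : FirstOrderOp d N m} {f : L2 d N} (hf : f ∈ L.ker)
    (s R : ℕ) : jop s R f ∈ L.ker := by
  intro n
  have h : coeff (jop s R f) n = ((tjap s R n : ℝ) : ℂ) • coeff f n :=
    congrArg WithLp.ofLp (vec_jop s R f n)
  rw [h, Matrix.mulVec_smul, ← hf n, coeff_zero, smul_zero]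

lemma FirstOrderOp.adjoint_symbol {m : ℕ} (L : FirstOrderOp d N m) (n : Fin d → ℤ) :
    L.adjoint.symbol n = (L.symbol n)ᴴ := by
  ext a b
  simp [symbol, adjoint, Matrix.sum_apply]

/-- At each frequency the symbol of L^* is the conjugate transpose of that of L. This orthogonality
removes v and V from all estimates. -/
lemma FirstOrderOp.inner_adjoint {m : ℕ} {L : FirstOrderOp d N m} {v : L2 d m} {w f : L2 d N}
    (hw : L.adjoint.Maps v w) (hf : f ∈ L.ker) : inner ℝ w f = 0 := by
  rw [← (hasSum_inner_vec _ _).tsum_eq]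
  have : ∀ n, inner ℂ (vec w n) (vec f n) = 0 := by
    intro n
    have h1 := hf n
    rw [coeff_zero] at h1
    rw [EuclideanSpace.inner_eq_star_dotProduct]
    simp only [vec]
    rw [hw n, L.adjoint_symbol, Matrix.star_mulVec, Matrix.conjTranspose_conjTranspose,
      dotProduct_comm, ← Matrix.dotProduct_mulVec, ← h1, dotProduct_zero]
  simp [this]

/-! ### The Wiener algebra -/

/-- The sum of an absolutely convergent Fourier series. -/
def wser (c : (Fin d → ℤ) → ℂ) : C(UnitAddTorus (Fin d), ℂ) :=
  ∑' n, c n • UnitAddTorus.mFourier n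

lemma summable_norm_of_tsum_enorm {ι : Type*} {c : ι → ℂ} (h : ∑' n, ‖c n‖ₑ ≠ ⊤) :
    Summable fun n => ‖c n‖ := by
  simpa using ENNReal.summable_toReal h

lemma hasSum_wser {c : (Fin d → ℤ) → ℂ} (h : ∑' n, ‖c n‖ₑ ≠ ⊤) :
    HasSum (fun n => c n • UnitAddTorus.mFourier n) (wser c) := by
  refine Summable.hasSum (Summable.of_norm ?_)
  simpa [norm_smul, UnitAddTorus.mFourier_norm] using summable_norm_of_tsum_enorm h

lemma hasSum_wser_apply {c : (Fin d → ℤ) → ℂ} (h : ∑' n, ‖c n‖ₑ ≠ ⊤)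
    (x : UnitAddTorus (Fin d)) :
    HasSum (fun n => c n * UnitAddTorus.mFourier n x) (wser c x) := by
  simpa using (ContinuousMap.evalCLM ℂ x).hasSum (hasSum_wser h)

/-- The Fourier series converges to f in L² and uniformly to the continuous function `wser`; the two
limits agree in L². -/
lemma ofReal_ae_eq_wser {f : UnitAddTorus (Fin d) → ℝ} (hf : MemLp f 2 (torusMeasure d))
    (h : ∑' n, ‖fc f n‖ₑ ≠ ⊤) : ∀ᵐ x ∂(torusMeasure d), (f x : ℂ) = wser (fc f) x := by
  have hfC : MemLp (fun x => (f x : ℂ)) 2 (torusMeasure d) := hf.ofReal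
  have h2 : ∀ n, UnitAddTorus.mFourierCoeff hfC.toLp n = fc f n := by
    intro n
    rw [fc, mFourierCoeff_eq, mFourierCoeff_eq]
    refine integral_congr_ae ?_
    filter_upwards [hfC.coeFn_toLp] with x hx
    rw [hx]
  have h1 : HasSum (fun n => fc f n • ContinuousMap.toLp (E := ℂ) 2 (torusMeasure d) ℂ
      (UnitAddTorus.mFourier n)) hfC.toLp := by
    rw [← funext h2]
    exact UnitAddTorus.hasSum_mFourier_series_L2 hfC.toLp
  have h3 := (ContinuousMap.toLp (E := ℂ) 2 (torusMeasure d) ℂ).hasSum (hasSum_wser h)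
  simp only [map_smul] at h3
  have h4 := h1.unique h3
  filter_upwards [hfC.coeFn_toLp, ContinuousMap.coeFn_toLp (p := 2) (𝕜 := ℂ) (torusMeasure d)
    (wser (fc f))] with x hx hx'
  rw [← hx', ← hx]
  exact congrFun (congrArg (fun (g : Lp ℂ 2 (torusMeasure d)) => (g : _ → ℂ)) h4) x

lemma norm_mFourier_apply (n : Fin d → ℤ) (x : UnitAddTorus (Fin d)) :
    ‖UnitAddTorus.mFourier n x‖ = 1 := by
  simp only [UnitAddTorus.mFourier, fourier_apply, ContinuousMap.coe_mk, norm_prod,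
    Circle.norm_coe, Finset.prod_const_one]

lemma enorm_wser_le {c : (Fin d → ℤ) → ℂ} (h : ∑' n, ‖c n‖ₑ ≠ ⊤) (x : UnitAddTorus (Fin d)) :
    ‖wser c x‖ₑ ≤ ∑' n, ‖c n‖ₑ := by
  rw [← (hasSum_wser_apply h x).tsum_eq]
  refine enorm_tsum_le_tsum_enorm.trans (ENNReal.tsum_le_tsum fun n => ?_)
  rw [enorm_mul, ← ofReal_norm (UnitAddTorus.mFourier n x), norm_mFourier_apply]
  simp

lemma enorm_le_tsum_fc {f : UnitAddTorus (Fin d) → ℝ} (hf : MemLp f 2 (torusMeasure d)) :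
    ∀ᵐ x ∂(torusMeasure d), ‖f x‖ₑ ≤ ∑' n, ‖fc f n‖ₑ := by
  rcases eq_or_ne (∑' n, ‖fc f n‖ₑ) ⊤ with h | h
  · simp [h]
  filter_upwards [ofReal_ae_eq_wser hf h] with x hx
  refine le_trans (le_of_eq ?_) (enorm_wser_le h x)
  rw [← hx, ← ofReal_norm, ← ofReal_norm, Complex.norm_real]

/-- The Fourier coefficients of a product. -/
lemma hasSum_fc_mul {f g : UnitAddTorus (Fin d) → ℝ} (hf : MemLp f 2 (torusMeasure d))
    (h : ∑' n, ‖fc f n‖ₑ ≠ ⊤) (hg : MemLp g 2 (torusMeasure d)) (n : Fin d → ℤ) :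
    HasSum (fun m => fc f m * fc g (n - m)) (fc (fun x => f x * g x) n) := by
  have hgC : Integrable (fun x => (g x : ℂ)) (torusMeasure d) :=
    (hg.integrable one_le_two).ofReal
  have hint : ∀ m, Integrable (fun x => UnitAddTorus.mFourier m x * (g x : ℂ))
      (torusMeasure d) := fun m =>
    hgC.bdd_mul (c := 1) (UnitAddTorus.mFourier m).continuous.aestronglyMeasurable
      (Eventually.of_forall fun x => (norm_mFourier_apply m x).le)
  let F : (Fin d → ℤ) → UnitAddTorus (Fin d) → ℂ := fun m x =>
    fc f m * (UnitAddTorus.mFourier (m - n) x * (g x : ℂ))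
  have h1 : HasSum (fun m => ∫ x, F m x ∂(torusMeasure d))
      (∫ x, ∑' m, F m x ∂(torusMeasure d)) := by
    refine hasSum_integral_of_summable_integral_norm (fun m => (hint _).const_mul _) ?_
    simp only [F, norm_mul, norm_mFourier_apply, one_mul, integral_const_mul]
    exact (summable_norm_of_tsum_enorm h).mul_right _
  convert h1 using 1
  · funext m
    simp only [F, integral_const_mul]
    congr 1
    rw [fc, mFourierCoeff_eq, neg_sub]
  · rw [fc, mFourierCoeff_eq]
    refine integral_congr_ae ?_
    filter_upwards [ofReal_ae_eq_wser hf h] with x hx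
    push_cast
    rw [hx, ← (hasSum_wser_apply h x).tsum_eq, ← tsum_mul_right, ← tsum_mul_left]
    refine tsum_congr fun m => ?_
    simp only [F]
    rw [sub_eq_add_neg, UnitAddTorus.mFourier_add]
    ring

lemma memLp_apply (f : L2 d N) (j : Fin N) : MemLp (fun x => f x j) 2 (torusMeasure d) :=
  (EuclideanSpace.proj (𝕜 := ℝ) j).comp_memLp' (Lp.memLp f)

lemma enorm_coeff_le (f : L2 d N) (n : Fin d → ℤ) (j : Fin N) : ‖coeff f n j‖ₑ ≤ ec f n := by
  rw [ec, ← ofReal_norm, ← ofReal_norm]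
  exact ENNReal.ofReal_le_ofReal (PiLp.norm_apply_le (vec f n) j)

lemma enorm_toLp_le_sum {𝕜 : Type*} [RCLike 𝕜] (v : EuclideanSpace 𝕜 (Fin N)) :
    ‖v‖ₑ ≤ ∑ j, ‖v j‖ₑ := by
  have h : v = ∑ j, EuclideanSpace.single j (v j) := by
    ext i
    simp [Finset.sum_apply, Pi.single_apply]
  conv_lhs => rw [h]
  refine (enorm_sum_le _ _).trans (Finset.sum_le_sum fun j _ => le_of_eq ?_)
  rw [← ofReal_norm, ← ofReal_norm, PiLp.norm_single]

/-- The Sobolev embedding `H^p ⊆ L^∞`. -/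
lemma enorm_le_sobolevNorm (p : ℕ) (f : L2 d N) :
    ∀ᵐ x ∂(torusMeasure d), ‖f x‖ₑ ≤ N * (embConst d p * sobolevNorm p f) := by
  have h : ∀ j, ∀ᵐ x ∂(torusMeasure d), ‖f x j‖ₑ ≤ embConst d p * sobolevNorm p f := by
    intro j
    filter_upwards [enorm_le_tsum_fc (memLp_apply f j)] with x hx
    refine hx.trans ?_
    rw [sobolevNorm_eq_hs]
    exact (ENNReal.tsum_le_tsum fun n => enorm_coeff_le f n j).trans (tsum_le_embConst_mul_hs p _)
  filter_upwards [ae_all_iff.2 h] with x hx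
  calc ‖f x‖ₑ ≤ _ := enorm_toLp_le_sum _
    _ ≤ ∑ _j : Fin N, embConst d p * sobolevNorm p f := Finset.sum_le_sum fun j _ => hx j
    _ = _ := by simp

end Multipliers

/-! ### Multiplication by matrix fields -/

section Multiplication

variable {d N : ℕ}

/-- A measurable, essentially bounded field of matrices. -/
structure BddField (G : UnitAddTorus (Fin d) → Matrix (Fin N) (Fin N) ℝ) : Prop where
  meas : ∀ a b, AEStronglyMeasurable (fun x => G x a b) (torusMeasure d)
  bdd : ∃ C : ℝ, ∀ᵐ x ∂(torusMeasure d), ∀ a b, |G x a b| ≤ C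

variable {G G' : UnitAddTorus (Fin d) → Matrix (Fin N) (Fin N) ℝ}

lemma BddField.sub (h : BddField G) (h' : BddField G') : BddField (fun x => G x - G' x) := by
  obtain ⟨C, hC⟩ := h.bdd
  obtain ⟨C', hC'⟩ := h'.bdd
  refine ⟨fun a b => (h.meas a b).sub (h'.meas a b), C + C', ?_⟩
  filter_upwards [hC, hC'] with x hx hx' a b
  exact (abs_sub _ _).trans (add_le_add (hx a b) (hx' a b))

lemma BddField.memLp (h : BddField G) (q : ℝ≥0∞) (a b : Fin N) :
    MemLp (fun x => G x a b) q (torusMeasure d) := by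
  obtain ⟨C, hC⟩ := h.bdd
  refine MemLp.of_bound (h.meas a b) C ?_
  filter_upwards [hC] with x hx
  exact hx a b

lemma norm_toLp_mulVec_le (M : Matrix (Fin N) (Fin N) ℝ) (v : EuclideanSpace ℝ (Fin N)) :
    ‖(WithLp.toLp 2 (M *ᵥ v.ofLp) : EuclideanSpace ℝ (Fin N))‖ ≤ (∑ a, ∑ b, |M a b|) * ‖v‖ := by
  have h1 : ∀ w : EuclideanSpace ℝ (Fin N), ‖w‖ ≤ ∑ a, |w a| := fun w => by
    have := enorm_toLp_le_sum w
    simp only [← ofReal_norm] at this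
    rw [← ENNReal.ofReal_sum_of_nonneg (fun _ _ => norm_nonneg _),
      ENNReal.ofReal_le_ofReal_iff (by positivity)] at this
    exact this
  refine (h1 _).trans ?_
  rw [Finset.sum_mul]
  refine Finset.sum_le_sum fun a _ => ?_
  simp only [Matrix.mulVec, dotProduct]
  refine (Finset.abs_sum_le_sum_abs _ _).trans ?_
  rw [Finset.sum_mul]
  refine Finset.sum_le_sum fun b _ => ?_
  rw [abs_mul]
  gcongr
  exact PiLp.norm_apply_le v b

lemma BddField.memLp_mulVec (h : BddField G) (f : L2 d N) :
    MemLp (fun x => (WithLp.toLp 2 (G x *ᵥ (f x).ofLp) : EuclideanSpace ℝ (Fin N))) 2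
      (torusMeasure d) := by
  rw [memLp_piLp_iff]
  intro a
  simp only [Matrix.mulVec, dotProduct]
  exact memLp_finsetSum _ fun b _ => (memLp_apply f b).mul (h.memLp ⊤ a b)

open Classical in
/-- Multiplication by a bounded field of matrices. -/
def mulOp (G : UnitAddTorus (Fin d) → Matrix (Fin N) (Fin N) ℝ) : L2 d N →L[ℝ] L2 d N :=
  if h : BddField G then
    LinearMap.mkContinuousOfExistsBound
      { toFun := fun f => (h.memLp_mulVec f).toLp
        map_add' := fun f g => by
          ext1
          filter_upwards [(h.memLp_mulVec (f + g)).coeFn_toLp, (h.memLp_mulVec f).coeFn_toLp,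
            (h.memLp_mulVec g).coeFn_toLp, Lp.coeFn_add f g,
            Lp.coeFn_add (h.memLp_mulVec f).toLp (h.memLp_mulVec g).toLp] with x h1 h2 h3 h4 h5
          rw [h1, h5, Pi.add_apply, h2, h3, h4]
          simp [Matrix.mulVec_add]
        map_smul' := fun c f => by
          ext1
          filter_upwards [(h.memLp_mulVec (c • f)).coeFn_toLp, (h.memLp_mulVec f).coeFn_toLp,
            Lp.coeFn_smul c f, Lp.coeFn_smul c (h.memLp_mulVec f).toLp] with x h1 h2 h3 h4
          rw [h1, RingHom.id_apply, h4, Pi.smul_apply, h2, h3]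
          simp [Matrix.mulVec_smul] } (by
      obtain ⟨C, hC⟩ := h.bdd
      refine ⟨∑ _a : Fin N, ∑ _b : Fin N, C, fun f => Lp.norm_le_mul_norm_of_ae_le_mul ?_⟩
      filter_upwards [(h.memLp_mulVec f).coeFn_toLp, hC] with x h1 h2
      simp only [LinearMap.coe_mk, AddHom.coe_mk]
      rw [h1]
      refine (norm_toLp_mulVec_le _ _).trans ?_
      gcongr with a _ b _
      exact h2 a b)
  -- The default value makes `mulOp` a total function of G, so that statements such as `IsProjSol`
  -- need no proof of boundedness as an argument.
  else 0

lemma mulOp_ae (h : BddField G) (f : L2 d N) :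
    ∀ᵐ x ∂(torusMeasure d), (mulOp G f x).ofLp = G x *ᵥ (f x).ofLp := by
  have : mulOp G f = (h.memLp_mulVec f).toLp := by
    simp only [mulOp, dif_pos h]; rfl
  rw [this]
  filter_upwards [(h.memLp_mulVec f).coeFn_toLp] with x h1
  rw [h1]

lemma eq_mulOp (h : BddField G) {f g : L2 d N}
    (hg : ∀ᵐ x ∂(torusMeasure d), (g x).ofLp = G x *ᵥ (f x).ofLp) : g = mulOp G f := by
  ext1
  filter_upwards [hg, mulOp_ae h f] with x h1 h2
  exact WithLp.ofLp_injective 2 (h1.trans h2.symm)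

lemma mulOp_sub (h : BddField G) (h' : BddField G') (f : L2 d N) :
    mulOp (fun x => G x - G' x) f = mulOp G f - mulOp G' f := by
  symm
  refine eq_mulOp (h.sub h') ?_
  filter_upwards [Lp.coeFn_sub (mulOp G f) (mulOp G' f), mulOp_ae h f, mulOp_ae h' f]
    with x h1 h2 h3
  rw [h1, Pi.sub_apply, WithLp.ofLp_sub, h2, h3, Matrix.sub_mulVec]

lemma norm_mulOp_le_of_ae (h : BddField G) {C : ℝ} {f g : L2 d N}
    (hC : ∀ᵐ x ∂(torusMeasure d),
      ‖(WithLp.toLp 2 (G x *ᵥ (f x).ofLp) : EuclideanSpace ℝ (Fin N))‖ ≤ C * ‖g x‖) :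
    ‖mulOp G f‖ ≤ C * ‖g‖ := by
  refine Lp.norm_le_mul_norm_of_ae_le_mul ?_
  filter_upwards [hC, mulOp_ae h f] with x h1 h2
  rwa [← h2] at h1

lemma norm_mulOp_le (h : BddField G) {C : ℝ}
    (hC : ∀ᵐ x ∂(torusMeasure d), ∑ a, ∑ b, |G x a b| ≤ C) (f : L2 d N) :
    ‖mulOp G f‖ ≤ C * ‖f‖ := by
  refine norm_mulOp_le_of_ae h ?_
  filter_upwards [hC] with x h1
  exact (norm_toLp_mulVec_le _ _).trans (by gcongr)

lemma inner_mulOp_eq (h : BddField G) (f g : L2 d N) :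
    inner ℝ (mulOp G f) g = ∫ x, (G x *ᵥ (f x).ofLp) ⬝ᵥ (g x).ofLp ∂(torusMeasure d) := by
  rw [L2.inner_def]
  refine integral_congr_ae ?_
  filter_upwards [mulOp_ae h f] with x h1
  rw [EuclideanSpace.inner_eq_star_dotProduct, h1]
  simp [dotProduct_comm]

lemma inner_mulOp_comm (h : BddField G) (hs : ∀ x, (G x).IsSymm) (f g : L2 d N) :
    inner ℝ (mulOp G f) g = inner ℝ f (mulOp G g) := by
  rw [real_inner_comm _ f, inner_mulOp_eq h, inner_mulOp_eq h]
  congr 1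
  funext x
  rw [dotProduct_comm, Matrix.dotProduct_mulVec, ← Matrix.mulVec_transpose, (hs x).eq]

/-- Coercivity of multiplication by a uniformly positive definite field. -/
lemma le_inner_mulOp (h : BddField G) {lam : ℝ}
    (hl : ∀ᵐ x ∂(torusMeasure d), ∀ v : EuclideanSpace ℝ (Fin N),
      lam * ‖v‖ ^ 2 ≤ (G x *ᵥ v.ofLp) ⬝ᵥ v.ofLp) (f : L2 d N) :
    lam * ‖f‖ ^ 2 ≤ inner ℝ (mulOp G f) f := by
  rw [← real_inner_self_eq_norm_sq, L2.inner_def, L2.inner_def, ← integral_const_mul]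
  refine integral_mono_ae ((L2.integrable_inner f f).const_mul _)
    (L2.integrable_inner (mulOp G f) f) ?_
  filter_upwards [hl, mulOp_ae h f] with x h1 h2
  simp only [real_inner_self_eq_norm_sq]
  refine (h1 (f x)).trans (le_of_eq ?_)
  rw [EuclideanSpace.inner_eq_star_dotProduct, h2]
  simp [dotProduct_comm]

/-! ### Fourier coefficients of products -/

/-- The size of the Fourier coefficients of a matrix field. -/
def mc (G : UnitAddTorus (Fin d) → Matrix (Fin N) (Fin N) ℝ) (m : Fin d → ℤ) : ℝ≥0∞ :=
  ∑ a, ∑ b, ‖fc (fun x => G x a b) m‖ₑ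

lemma enorm_fc_le_mc (a b : Fin N) (m : Fin d → ℤ) : ‖fc (fun x => G x a b) m‖ₑ ≤ mc G m :=
  (Finset.single_le_sum (f := fun b => ‖fc (fun x => G x a b) m‖ₑ) (fun _ _ => zero_le)
    (Finset.mem_univ b)).trans
  (Finset.single_le_sum (f := fun a => ∑ b, ‖fc (fun x => G x a b) m‖ₑ) (fun _ _ => zero_le)
    (Finset.mem_univ a))

lemma hasSum_coeff_mulOp (h : BddField G) (hw : ∑' m, mc G m ≠ ⊤) (f : L2 d N)
    (n : Fin d → ℤ) (a : Fin N) :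
    HasSum (fun m => ∑ b, fc (fun x => G x a b) m * coeff f (n - m) b)
      (coeff (mulOp G f) n a) := by
  have h1 : ∀ b, HasSum (fun m => fc (fun x => G x a b) m * coeff f (n - m) b)
      (fc (fun x => G x a b * f x b) n) := fun b =>
    hasSum_fc_mul (h.memLp 2 a b) (ne_top_of_le_ne_top hw (ENNReal.tsum_le_tsum fun m =>
      enorm_fc_le_mc a b m)) (memLp_apply f b) n
  have h2 := hasSum_sum (s := Finset.univ) fun b (_ : b ∈ Finset.univ) => h1 b
  convert h2 using 1
  have hint : ∀ b, Integrable (fun x => UnitAddTorus.mFourier (-n) x *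
      ((G x a b * f x b : ℝ) : ℂ)) (torusMeasure d) := fun b =>
    ((((memLp_apply f b).mul (h.memLp ⊤ a b) : MemLp _ 2 _).integrable one_le_two).ofReal).bdd_mul
      (c := 1) (UnitAddTorus.mFourier (-n)).continuous.aestronglyMeasurable
      (Eventually.of_forall fun x => (norm_mFourier_apply (-n) x).le)
  simp only [coeff_eq_fc, fc, mFourierCoeff_eq]
  rw [← integral_finsetSum _ fun b _ => hint b]
  refine integral_congr_ae ?_
  filter_upwards [mulOp_ae h f] with x h1
  rw [h1, ← Finset.mul_sum]
  simp [Matrix.mulVec, dotProduct]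

lemma enorm_le_tsum_of_hasSum {ι : Type*} {c : ι → ℂ} {v : ℂ} (h : HasSum c v) :
    ‖v‖ₑ ≤ ∑' m, ‖c m‖ₑ :=
  h.tsum_eq ▸ enorm_tsum_le_tsum_enorm

/-- A bound for vectors that are given by weighted convolutions. -/
lemma enorm_le_tsum_mc (k : (Fin d → ℤ) → ℂ) (f : L2 d N) (n : Fin d → ℤ)
    (v : EuclideanSpace ℂ (Fin N))
    (hv : ∀ a, HasSum (fun m => k m * ∑ b, fc (fun x => G x a b) m * coeff f (n - m) b) (v a)) :
    ‖v‖ₑ ≤ ∑' m, ‖k m‖ₑ * (mc G m * ec f (n - m)) := by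
  have h1 : ∀ a, ‖v a‖ₑ ≤ ∑' m, ‖k m‖ₑ *
      ((∑ b, ‖fc (fun x => G x a b) m‖ₑ) * ec f (n - m)) := by
    intro a
    refine (enorm_le_tsum_of_hasSum (hv a)).trans (ENNReal.tsum_le_tsum fun m => ?_)
    rw [enorm_mul]
    gcongr
    refine (enorm_sum_le _ _).trans ?_
    rw [Finset.sum_mul]
    refine Finset.sum_le_sum fun b _ => ?_
    rw [enorm_mul]
    gcongr
    exact enorm_coeff_le f _ b
  calc ‖v‖ₑ ≤ ∑ a, ‖v a‖ₑ := enorm_toLp_le_sum v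
    _ ≤ ∑ a, ∑' m, ‖k m‖ₑ * ((∑ b, ‖fc (fun x => G x a b) m‖ₑ) * ec f (n - m)) :=
        Finset.sum_le_sum fun a _ => h1 a
    _ = _ := by
      rw [← Summable.tsum_finsetSum fun _ _ => ENNReal.summable]
      refine tsum_congr fun m => ?_
      rw [mc, ← Finset.mul_sum, Finset.sum_mul]

lemma ec_mulOp_le (h : BddField G) (hw : ∑' m, mc G m ≠ ⊤) (f : L2 d N) (n : Fin d → ℤ) :
    ec (mulOp G f) n ≤ conv (mc G) (ec f) n := by
  have := enorm_le_tsum_mc (fun _ => 1) f n (vec (mulOp G f) n) (fun a => by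
    simpa using! hasSum_coeff_mulOp h hw f n a)
  simpa [conv] using! this

lemma tsum_mc_ne_top {p : ℕ} (hp : d < 2 * p) (hG : hs p (mc G) ≠ ⊤) : ∑' m, mc G m ≠ ⊤ :=
  ne_top_of_le_ne_top (ENNReal.mul_ne_top (embConst_lt_top hp).ne hG)
    (tsum_le_embConst_mul_hs p _)

/-- The constant in the product estimates. -/
def prodConst (d p : ℕ) : ℝ≥0∞ := 2 ^ p * (4 * embConst d p)

lemma prodConst_lt_top {p : ℕ} (hp : d < 2 * p) : prodConst d p < ⊤ :=
  ENNReal.mul_lt_top (by norm_num) (ENNReal.mul_lt_top (by norm_num) (embConst_lt_top hp))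

lemma hs_conv_le_prodConst {σ p : ℕ} (h : σ ≤ p) (α β : (Fin d → ℤ) → ℝ≥0∞) :
    hs σ (conv α β) ≤ prodConst d p * hs p α * hs σ β := by
  refine (hs_conv_le h α β).trans ?_
  unfold prodConst
  gcongr
  norm_num

/-- `‖G f‖_σ ≤ C ‖G‖_p ‖f‖_σ`. -/
lemma sobolevNorm_mulOp_le {σ p : ℕ} (hp : d < 2 * p) (hσ : σ ≤ p) (h : BddField G)
    (hG : hs p (mc G) ≠ ⊤) (f : L2 d N) :
    sobolevNorm σ (mulOp G f) ≤ prodConst d p * hs p (mc G) * sobolevNorm σ f := by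
  simp only [sobolevNorm_eq_hs]
  exact (hs_mono (ec_mulOp_le h (tsum_mc_ne_top hp hG) f)).trans (hs_conv_le_prodConst hσ _ _)

/-- `‖G f‖_σ ≤ C ‖G‖_σ ‖f‖_p`. -/
lemma sobolevNorm_mulOp_le' {σ p : ℕ} (hp : d < 2 * p) (hσ : σ ≤ p) (h : BddField G)
    (hG : hs p (mc G) ≠ ⊤) (f : L2 d N) :
    sobolevNorm σ (mulOp G f) ≤ prodConst d p * hs σ (mc G) * sobolevNorm p f := by
  simp only [sobolevNorm_eq_hs]
  refine (hs_mono (ec_mulOp_le h (tsum_mc_ne_top hp hG) f)).trans ?_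
  rw [conv_comm]
  refine (hs_conv_le_prodConst hσ _ _).trans (le_of_eq ?_)
  ring

/-- `‖G f‖ ≤ C ‖G‖_a ‖f‖_b` for `a + b = p > d / 2`. -/
lemma enorm_mulOp_le {a b p : ℕ} (hp : d < 2 * p) (hab : a + b = p) (h : BddField G)
    (hG : hs p (mc G) ≠ ⊤) (f : L2 d N) :
    ‖mulOp G f‖ₑ ≤ 2 * embConst d p * hs a (mc G) * sobolevNorm b f := by
  rw [enorm_eq_l2, sobolevNorm_eq_hs]
  exact (l2_mono (ec_mulOp_le h (tsum_mc_ne_top hp hG) f)).trans (l2_conv_le_hs_mul_hs hab _ _)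

/-- The constant in the commutator estimate. -/
def commConst (d p : ℕ) : ℝ≥0∞ :=
  ENNReal.ofReal ((p + 1) * 2 ^ (p + 1)) * (4 * embConst d p)

lemma commConst_lt_top {p : ℕ} (hp : d < 2 * p) : commConst d p < ⊤ :=
  ENNReal.mul_lt_top ENNReal.ofReal_lt_top (ENNReal.mul_lt_top (by norm_num) (embConst_lt_top hp))

/-- The commutator estimate for `J_{σ+1}`. -/
lemma enorm_commutator_le {σ p : ℕ} (hp : d < 2 * p) (hσ : σ ≤ p) (h : BddField G)
    (hG : hs (p + 1) (mc G) ≠ ⊤) (R : ℕ) (f : L2 d N) :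
    ‖jop (σ + 1) R (mulOp G f) - mulOp G (jop (σ + 1) R f)‖ₑ ≤
      commConst d p * hs (p + 1) (mc G) * sobolevNorm σ f := by
  have hG' : hs p (mc G) ≠ ⊤ := ne_top_of_le_ne_top hG (hs_mono_exp p.le_succ _)
  have hw := tsum_mc_ne_top hp hG'
  set D := ENNReal.ofReal ((p + 1) * 2 ^ (p + 1)) with hD
  -- With w the truncated weight, the coefficient of the commutator at n is the sum over m of (w(n)
  -- - w(n - m)) Ĝ(m) f̂(n - m). The factor ⟨m⟩ gained from the difference is charged to G, whence
  -- the order p + 1 there, and f keeps only σ derivatives.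
  have key : ∀ n, ec (jop (σ + 1) R (mulOp G f) - mulOp G (jop (σ + 1) R f)) n ≤
      D * ∑' m, (ejap m ^ σ + ejap (n - m) ^ σ) * ((ejap m ^ 1 * mc G m) * ec f (n - m)) := by
    intro n
    have h1 := enorm_le_tsum_mc (G := G)
      (fun m => ((tjap (σ + 1) R n - tjap (σ + 1) R (n - m) : ℝ) : ℂ)) f n
      (vec (jop (σ + 1) R (mulOp G f) - mulOp G (jop (σ + 1) R f)) n) (fun a => by
        have h2 := (hasSum_coeff_mulOp h hw f n a).mul_left ((tjap (σ + 1) R n : ℝ) : ℂ)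
        have h3 := hasSum_coeff_mulOp h hw (jop (σ + 1) R f) n a
        have h4 := h2.sub h3
        have e : vec (jop (σ + 1) R (mulOp G f) - mulOp G (jop (σ + 1) R f)) n a =
            ((tjap (σ + 1) R n : ℝ) : ℂ) * coeff (mulOp G f) n a -
              coeff (mulOp G (jop (σ + 1) R f)) n a := by
          rw [vec_sub, vec_jop]
          rfl
        rw [e]
        refine HasSum.congr_fun h4 fun m => ?_
        have : ∀ b, coeff (jop (σ + 1) R f) (n - m) b =
            ((tjap (σ + 1) R (n - m) : ℝ) : ℂ) * coeff f (n - m) b := fun b =>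
          congrFun (congrArg WithLp.ofLp (vec_jop (σ + 1) R f (n - m))) b
        simp only [this, Finset.mul_sum, ← Finset.sum_sub_distrib]
        refine Finset.sum_congr rfl fun b _ => ?_
        push_cast
        ring)
    refine h1.trans ?_
    rw [← ENNReal.tsum_mul_left]
    refine ENNReal.tsum_le_tsum fun m => ?_
    have h5 : ‖((tjap (σ + 1) R n - tjap (σ + 1) R (n - m) : ℝ) : ℂ)‖ₑ ≤
        D * (ejap m * (ejap m ^ σ + ejap (n - m) ^ σ)) := by
      rw [← ofReal_norm, Complex.norm_real, Real.norm_eq_abs, hD, ejap, ejap,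
        ← ENNReal.ofReal_pow (jap_pos _).le, ← ENNReal.ofReal_pow (jap_pos _).le,
        ← ENNReal.ofReal_add (pow_nonneg (jap_pos _).le _) (pow_nonneg (jap_pos _).le _),
        ← ENNReal.ofReal_mul (jap_pos _).le, ← ENNReal.ofReal_mul (by positivity)]
      refine ENNReal.ofReal_le_ofReal ((abs_tjap_sub_le σ R.cast_nonneg n m).trans ?_)
      have := jap_pos m
      have := jap_pos (n - m)
      gcongr
      norm_num
    calc _ ≤ D * (ejap m * (ejap m ^ σ + ejap (n - m) ^ σ)) * (mc G m * ec f (n - m)) := by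
          gcongr
      _ = _ := by ring
  rw [enorm_eq_l2]
  refine (l2_mono key).trans ?_
  rw [l2_const_mul]
  refine (mul_le_mul_right (l2_weighted_conv_le hσ _ _) D).trans (le_of_eq ?_)
  rw [hs_ejap_mul, sobolevNorm_eq_hs, commConst]
  ring

/-- Integration by parts for symmetric `G`: `|⟨G ∂f, f⟩| ≤ C ‖G‖_{p+1} ‖f‖²`. -/
lemma abs_inner_mulOp_weakDeriv_le {p : ℕ} (hp : d < 2 * p) (h : BddField G)
    (hsym : ∀ x, (G x).IsSymm) {b : ℝ} (hb : 0 ≤ b) (hG : hs (p + 1) (mc G) ≤ ENNReal.ofReal b)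
    {i : Fin d} {f f' : L2 d N} (hf : IsWeakDeriv i f f') (hf1 : sobolevNorm 1 f < ⊤) :
    |inner ℝ (mulOp G f') f| ≤ Real.pi * (embConst d p).toReal * b * ‖f‖ ^ 2 := by
  have hGt : hs (p + 1) (mc G) ≠ ⊤ := ne_top_of_le_ne_top ENNReal.ofReal_ne_top hG
  have hG' : hs p (mc G) ≠ ⊤ := ne_top_of_le_ne_top hGt (hs_mono_exp p.le_succ _)
  have hw := tsum_mc_ne_top hp hG'
  have hemb := embConst_lt_top hp
  obtain ⟨g, hg⟩ := exists_isWeakDeriv i (f := mulOp G f) (by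
    refine (sobolevNorm_mulOp_le hp (by lia) h hG' f).trans_lt ?_
    exact ENNReal.mul_lt_top (ENNReal.mul_lt_top (prodConst_lt_top hp) hG'.lt_top) hf1)
  have h1 : inner ℝ (mulOp G f') f = -inner ℝ f g := by
    rw [inner_mulOp_comm h hsym, inner_isWeakDeriv hf hg]
  -- By symmetry, 2⟨G∂f, f⟩ = -⟨f, ∂(Gf) - G∂f⟩. The difference is (∂G)f, whose coefficients are
  -- convolutions with 2πi m_i Ĝ(m), summable because G has p + 1 derivatives.
  have h2 : 2 * inner ℝ (mulOp G f') f = -inner ℝ f (g - mulOp G f') := by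
    rw [inner_sub_right, real_inner_comm (mulOp G f') f]
    linarith
  have key : ∀ n, ec (g - mulOp G f') n ≤ ENNReal.ofReal (2 * Real.pi) *
      conv (fun m => ejap m ^ 1 * mc G m) (ec f) n := by
    intro n
    have h3 := enorm_le_tsum_mc (G := G)
      (fun m => 2 * Real.pi * Complex.I * (m i : ℂ)) f n (vec (g - mulOp G f') n) (fun a => by
        have h2 := (hasSum_coeff_mulOp h hw f n a).mul_left (2 * Real.pi * Complex.I * (n i : ℂ))
        have h3 := hasSum_coeff_mulOp h hw f' n a
        have h4 := h2.sub h3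
        have e : vec (g - mulOp G f') n a =
            2 * Real.pi * Complex.I * (n i : ℂ) * coeff (mulOp G f) n a -
              coeff (mulOp G f') n a := by
          rw [vec_sub, isWeakDeriv_iff.1 hg]
          rfl
        rw [e]
        refine HasSum.congr_fun h4 fun m => ?_
        simp only [fun b => hf (n - m) b, Finset.mul_sum, ← Finset.sum_sub_distrib]
        refine Finset.sum_congr rfl fun b _ => ?_
        push_cast [Pi.sub_apply]
        ring)
    refine h3.trans ?_
    rw [conv, ← ENNReal.tsum_mul_left]
    refine ENNReal.tsum_le_tsum fun m => ?_
    rw [enorm_two_pi_I_mul, mul_assoc, pow_one, mul_assoc]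
    gcongr
    exact ENNReal.ofReal_le_ofReal (abs_le_jap m i)
  have h4 : ‖g - mulOp G f'‖ ≤ 2 * Real.pi * ((embConst d p).toReal * b * ‖f‖) := by
    rw [← ENNReal.ofReal_le_ofReal_iff (by positivity), ofReal_norm, enorm_eq_l2]
    refine (l2_mono key).trans ?_
    rw [l2_const_mul, ENNReal.ofReal_mul (p := 2 * Real.pi) (by positivity),
      ENNReal.ofReal_mul (p := (embConst d p).toReal * b) (by positivity),
      ENNReal.ofReal_mul (p := (embConst d p).toReal) (by positivity), ENNReal.ofReal_toReal hemb.ne, ofReal_norm, enorm_eq_l2]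
    gcongr
    refine (l2_conv_le _ _).trans ?_
    gcongr
    refine (tsum_le_embConst_mul_hs p _).trans ?_
    gcongr
    rwa [hs_ejap_mul]
  have h5 : |inner ℝ f (g - mulOp G f')| ≤ ‖f‖ * ‖g - mulOp G f'‖ := abs_real_inner_le_norm _ _
  have h6 : 2 * |inner ℝ (mulOp G f') f| = |inner ℝ f (g - mulOp G f')| := by
    rw [← abs_neg (inner ℝ f (g - mulOp G f')), ← h2, abs_mul, abs_two]
  have h7 := mul_le_mul_of_nonneg_left h4 (norm_nonneg f)
  nlinarith

end Multiplication

/-! ### The chain rule -/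

section ChainRule

variable {d N : ℕ}

lemma mFourier_add_apply (m : Fin d → ℤ) (x y : UnitAddTorus (Fin d)) :
    UnitAddTorus.mFourier m (x + y) =
      UnitAddTorus.mFourier m x * UnitAddTorus.mFourier m y := by
  simp only [UnitAddTorus.mFourier, ContinuousMap.coe_mk, Pi.add_apply, ← Finset.prod_mul_distrib]
  refine Finset.prod_congr rfl fun i _ => ?_
  simp only [fourier_apply, smul_add, AddCircle.toCircle_add, Circle.coe_mul]

/-- The translation by `h` in the direction `i`. -/
def stp (i : Fin d) (h : ℝ) : UnitAddTorus (Fin d) := Pi.single i (h : UnitAddCircle)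

lemma mFourier_stp (m : Fin d → ℤ) (i : Fin d) (h : ℝ) :
    UnitAddTorus.mFourier m (stp i h) = Complex.exp (2 * Real.pi * Complex.I * (m i : ℂ) * h) := by
  simp only [UnitAddTorus.mFourier, ContinuousMap.coe_mk, stp]
  rw [Finset.prod_eq_single i]
  · rw [Pi.single_eq_same, fourier_coe_apply]
    simp
  · intro j _ hj
    rw [Pi.single_eq_of_ne hj]
    simp
  · simp

lemma hasDerivAt_mFourier_stp (m : Fin d → ℤ) (i : Fin d) (h : ℝ) :
    HasDerivAt (fun h : ℝ => UnitAddTorus.mFourier m (stp i h))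
      (2 * Real.pi * Complex.I * (m i : ℂ) * UnitAddTorus.mFourier m (stp i h)) h := by
  simp only [mFourier_stp]
  have h1 : HasDerivAt (fun h : ℝ => 2 * Real.pi * Complex.I * (m i : ℂ) * (h : ℂ))
      (2 * Real.pi * Complex.I * (m i : ℂ) * 1) h :=
    (Complex.ofRealCLM.hasDerivAt).const_mul _
  convert h1.cexp using 1
  ring

lemma hasDerivAt_wser {c c' : (Fin d → ℤ) → ℂ} (i : Fin d)
    (hc' : ∀ m, c' m = 2 * Real.pi * Complex.I * (m i : ℂ) * c m)
    (hc : ∑' m, ‖c m‖ₑ ≠ ⊤) (hs' : ∑' m, ‖c' m‖ₑ ≠ ⊤) (x : UnitAddTorus (Fin d)) (h : ℝ) :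
    HasDerivAt (fun h => wser c (x + stp i h)) (wser c' (x + stp i h)) h := by
  have h1 := hasDerivAt_tsum (summable_norm_of_tsum_enorm hs')
    (g := fun m h => c m * UnitAddTorus.mFourier m (x + stp i h))
    (g' := fun m h => c' m * UnitAddTorus.mFourier m (x + stp i h)) (y₀ := 0)
    (fun m h => by
      simp only [mFourier_add_apply, hc']
      convert! ((hasDerivAt_mFourier_stp m i h).const_mul
        (UnitAddTorus.mFourier m x)).const_mul (c m) using 1
      ring)
    (fun m h => by rw [norm_mul, norm_mFourier_apply, mul_one])
    (hasSum_wser_apply hc _).summable h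
  simpa only [(hasSum_wser_apply hc _).tsum_eq, (hasSum_wser_apply hs' _).tsum_eq] using h1

/-- The continuous representative of a field with absolutely summable Fourier coefficients. -/
def crep (f : L2 d N) (x : UnitAddTorus (Fin d)) : EuclideanSpace ℝ (Fin N) :=
  WithLp.toLp 2 fun j => (wser (fun n => coeff f n j) x).re

lemma continuous_crep (f : L2 d N) : Continuous (crep f) := by
  refine (PiLp.continuous_toLp 2 _).comp (continuous_pi fun j => ?_)
  exact Complex.continuous_re.comp (ContinuousMap.continuous _)

lemma tsum_coeff_ne_top {p : ℕ} (hp : d < 2 * p) {f : L2 d N} (hf : sobolevNorm p f < ⊤)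
    (j : Fin N) : ∑' n, ‖coeff f n j‖ₑ ≠ ⊤ := by
  rw [sobolevNorm_eq_hs] at hf
  refine ne_top_of_le_ne_top (ENNReal.mul_ne_top (embConst_lt_top hp).ne hf.ne)
    ((ENNReal.tsum_le_tsum fun n => ?_).trans (tsum_le_embConst_mul_hs p _))
  exact enorm_coeff_le f n j

lemma ae_eq_crep {p : ℕ} (hp : d < 2 * p) {f : L2 d N} (hf : sobolevNorm p f < ⊤) :
    ∀ᵐ x ∂(torusMeasure d), f x = crep f x := by
  have h : ∀ j, ∀ᵐ x ∂(torusMeasure d), ((f x j : ℝ) : ℂ) = wser (fun n => coeff f n j) x :=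
    fun j => ofReal_ae_eq_wser (memLp_apply f j) (tsum_coeff_ne_top hp hf j)
  filter_upwards [ae_all_iff.2 h] with x hx
  ext j
  simp [crep, ← hx j]

lemma hasDerivAt_crep {p : ℕ} (hp : d < 2 * p) {f g : L2 d N} (hf : sobolevNorm p f < ⊤)
    (hg : sobolevNorm p g < ⊤) {i : Fin d} (hfg : IsWeakDeriv i f g) (x : UnitAddTorus (Fin d))
    (h : ℝ) : HasDerivAt (fun h => crep f (x + stp i h)) (crep g (x + stp i h)) h := by
  have h1 : HasDerivAt (fun h => WithLp.ofLp (crep f (x + stp i h)))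
      (WithLp.ofLp (crep g (x + stp i h))) h := by
    rw [hasDerivAt_pi]
    intro j
    have h2 := hasDerivAt_wser i (fun m => hfg m j) (tsum_coeff_ne_top hp hf j)
      (tsum_coeff_ne_top hp hg j) x h
    exact Complex.reCLM.hasFDerivAt.comp_hasDerivAt h h2
  exact ((PiLp.continuousLinearEquiv 2 ℝ
    (fun _ : Fin N => ℝ)).symm.toContinuousLinearMap).hasFDerivAt.comp_hasDerivAt h h1

/-- The chain rule `∂(a ∘ f) = a'(f) ∂f` on the Fourier side. -/
lemma fc_chain {p : ℕ} (hp : d < 2 * p) {f g : L2 d N} (hf : sobolevNorm p f < ⊤)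
    (hg : sobolevNorm p g < ⊤) {i : Fin d} (hfg : IsWeakDeriv i f g)
    {a : EuclideanSpace ℝ (Fin N) → ℝ} (ha : ContDiff ℝ ∞ a) (n : Fin d → ℤ) :
    fc (fun x => fderiv ℝ a (f x) (g x)) n =
      2 * Real.pi * Complex.I * (n i : ℂ) * fc (fun x => a (f x)) n := by
  have hfe := ae_eq_crep hp hf
  have hge := ae_eq_crep hp hg
  have hac : Continuous fun x => a (crep f x) := ha.continuous.comp (continuous_crep f)
  have hdc : Continuous fun x => fderiv ℝ a (crep f x) (crep g x) :=
    ((ha.continuous_fderiv (by simp)).comp (continuous_crep f)).clm_apply (continuous_crep g)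
  obtain ⟨B, hB⟩ := (isCompact_range hdc).isBounded.exists_norm_le
  have e1 : fc (fun x => a (f x)) = fc (fun x => a (crep f x)) :=
    fc_congr (hfe.mono fun x hx => by simp only [hx])
  have e2 : fc (fun x => fderiv ℝ a (f x) (g x)) =
      fc (fun x => fderiv ℝ a (crep f x) (crep g x)) :=
    fc_congr (by filter_upwards [hfe, hge] with x hx hx'; rw [hx, hx'])
  rw [e1, e2]
  -- Ψ(h) is the n-th coefficient of the composition translated by h in direction i. Its derivative
  -- at 0 is computed twice: under the integral sign, which gives a'(f)∂f, and by translation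
  -- invariance, where h enters only through a character.
  let Ψ : ℝ → ℂ := fun h => ∫ x, UnitAddTorus.mFourier (-n) x *
    ((a (crep f (x + stp i h)) : ℝ) : ℂ) ∂(torusMeasure d)
  have hder : HasDerivAt Ψ (∫ x, UnitAddTorus.mFourier (-n) x *
      ((fderiv ℝ a (crep f (x + stp i 0)) (crep g (x + stp i 0)) : ℝ) : ℂ) ∂(torusMeasure d))
      0 := by
    refine (hasDerivAt_integral_of_dominated_loc_of_deriv_le (s := Set.univ) (bound := fun _ => B)
      (F' := fun h x => UnitAddTorus.mFourier (-n) x *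
        ((fderiv ℝ a (crep f (x + stp i h)) (crep g (x + stp i h)) : ℝ) : ℂ))
      Filter.univ_mem (Eventually.of_forall fun h => ?_) ?_ ?_ ?_ ?_ ?_).2
    · have : Continuous fun x => UnitAddTorus.mFourier (-n) x *
          ((a (crep f (x + stp i h)) : ℝ) : ℂ) :=
        (ContinuousMap.continuous _).mul (Complex.continuous_ofReal.comp
          (hac.comp (continuous_id.add continuous_const)))
      exact this.aestronglyMeasurable
    · have : Continuous fun x => UnitAddTorus.mFourier (-n) x *
          ((a (crep f (x + stp i 0)) : ℝ) : ℂ) :=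
        (ContinuousMap.continuous _).mul (Complex.continuous_ofReal.comp
          (hac.comp (continuous_id.add continuous_const)))
      exact this.integrable_of_hasCompactSupport (HasCompactSupport.of_compactSpace _)
    · have : Continuous fun x => UnitAddTorus.mFourier (-n) x *
          ((fderiv ℝ a (crep f (x + stp i 0)) (crep g (x + stp i 0)) : ℝ) : ℂ) :=
        (ContinuousMap.continuous _).mul (Complex.continuous_ofReal.comp
          (hdc.comp (continuous_id.add continuous_const)))
      exact this.aestronglyMeasurable
    · refine Eventually.of_forall fun x h _ => ?_
      rw [norm_mul, norm_mFourier_apply, one_mul, Complex.norm_real]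
      exact hB _ ⟨x + stp i h, rfl⟩
    · exact integrable_const _
    · refine Eventually.of_forall fun x h _ => ?_
      have h1 : HasDerivAt (fun h => a (crep f (x + stp i h)))
          (fderiv ℝ a (crep f (x + stp i h)) (crep g (x + stp i h))) h :=
        ((ha.differentiable (by simp)) _).hasFDerivAt.comp_hasDerivAt h
          (hasDerivAt_crep hp hf hg hfg x h)
      exact (h1.ofReal_comp).const_mul _
  have hΨ : ∀ h : ℝ, Ψ h = UnitAddTorus.mFourier n (stp i h) * fc (fun x => a (crep f x)) n := by
    intro h
    have h1 := integral_add_right_eq_self (μ := torusMeasure d)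
      (fun y => UnitAddTorus.mFourier (-n) (y - stp i h) * ((a (crep f y) : ℝ) : ℂ)) (stp i h)
    simp only [add_sub_cancel_right] at h1
    simp only [Ψ, h1, fc, mFourierCoeff_eq]
    rw [← integral_const_mul]
    refine integral_congr_ae (Eventually.of_forall fun x => ?_)
    simp only [sub_eq_add_neg, mFourier_add_apply]
    have h2 : UnitAddTorus.mFourier (-n) (-(stp i h)) = UnitAddTorus.mFourier n (stp i h) := by
      simp [UnitAddTorus.mFourier, fourier_apply]
    rw [h2]
    ring
  have hder2 : HasDerivAt Ψ (2 * Real.pi * Complex.I * (n i : ℂ) *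
      UnitAddTorus.mFourier n (stp i 0) * fc (fun x => a (crep f x)) n) 0 := by
    rw [funext hΨ]
    exact (hasDerivAt_mFourier_stp n i 0).mul_const _
  have h3 := hder.unique hder2
  have h4 : stp i 0 = 0 := by simp [stp]
  have h5 : UnitAddTorus.mFourier n (0 : UnitAddTorus (Fin d)) = 1 := by
    simp [UnitAddTorus.mFourier]
  simp only [h4, add_zero, h5, mul_one] at h3
  exact h3

/-! ### Composition with smooth functions -/

/-- The sizes of the Fourier coefficients of a scalar function. -/
def fce (f : UnitAddTorus (Fin d) → ℝ) (n : Fin d → ℤ) : ℝ≥0∞ := ‖fc f n‖ₑ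

lemma l2_fce {f : UnitAddTorus (Fin d) → ℝ} (hf : MemLp f 2 (torusMeasure d)) :
    l2 (fce f) = eLpNorm f 2 (torusMeasure d) := by
  have hF : MemLp (fun x => (WithLp.toLp 2 (fun _ => f x) : EuclideanSpace ℝ (Fin 1))) 2
      (torusMeasure d) := by
    rw [memLp_piLp_iff]
    exact fun _ => hf
  have h1 := enorm_eq_l2 hF.toLp
  have h2 : ec hF.toLp = fce f := by
    funext n
    have h3 : ∀ j, coeff hF.toLp n j = fc f n := fun j => by
      rw [coeff_eq_fc]
      refine congrFun (fc_congr ?_) n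
      filter_upwards [hF.coeFn_toLp] with x hx
      rw [hx]
    rw [ec, fce, ← ofReal_norm, ← ofReal_norm, EuclideanSpace.norm_eq]
    simp [vec, h3]
  rw [← h2, ← h1, Lp.enorm_def, eLpNorm_congr_ae hF.coeFn_toLp]
  refine eLpNorm_congr_norm_ae (Eventually.of_forall fun x => ?_)
  rw [EuclideanSpace.norm_eq]
  simp [Real.sqrt_sq_eq_abs]

lemma l2_fce_le {f : UnitAddTorus (Fin d) → ℝ} {g : L2 d N} {C : ℝ}
    (hf : AEStronglyMeasurable f (torusMeasure d))
    (h : ∀ᵐ x ∂(torusMeasure d), |f x| ≤ C * ‖g x‖) :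
    l2 (fce f) ≤ ENNReal.ofReal C * ‖g‖ₑ := by
  have hm : MemLp f 2 (torusMeasure d) := (Lp.memLp g).of_le_mul hf h
  rw [l2_fce hm, Lp.enorm_def]
  exact eLpNorm_le_mul_eLpNorm_of_ae_le_mul h 2

lemma l2_fce_le_const {f : UnitAddTorus (Fin d) → ℝ} {C : ℝ}
    (hf : AEStronglyMeasurable f (torusMeasure d))
    (h : ∀ᵐ x ∂(torusMeasure d), |f x| ≤ C) :
    l2 (fce f) ≤ ENNReal.ofReal C := by
  have hm : MemLp f 2 (torusMeasure d) := MemLp.of_bound hf C h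
  rw [l2_fce hm]
  refine (eLpNorm_le_of_ae_bound h).trans ?_
  simp

lemma fce_mul_le {f g : UnitAddTorus (Fin d) → ℝ} (hf : MemLp f 2 (torusMeasure d))
    (h : ∑' n, fce f n ≠ ⊤) (hg : MemLp g 2 (torusMeasure d)) (n : Fin d → ℤ) :
    fce (fun x => f x * g x) n ≤ conv (fce f) (fce g) n := by
  refine (enorm_le_tsum_of_hasSum (hasSum_fc_mul hf h hg n)).trans (le_of_eq ?_)
  simp only [enorm_mul]
  rfl

lemma fc_sum {κ : Type*} (S : Finset κ) (f : κ → UnitAddTorus (Fin d) → ℝ)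
    (hf : ∀ b ∈ S, Integrable (f b) (torusMeasure d)) (n : Fin d → ℤ) :
    fc (fun x => ∑ b ∈ S, f b x) n = ∑ b ∈ S, fc (f b) n := by
  simp only [fc, mFourierCoeff_eq]
  rw [← integral_finsetSum]
  · refine integral_congr_ae (Eventually.of_forall fun x => ?_)
    simp [Finset.mul_sum]
  · intro b hb
    exact ((hf b hb).ofReal).bdd_mul (c := 1)
      (UnitAddTorus.mFourier (-n)).continuous.aestronglyMeasurable
      (Eventually.of_forall fun x => (norm_mFourier_apply (-n) x).le)

lemma fc_sub {f g : UnitAddTorus (Fin d) → ℝ} (hf : Integrable f (torusMeasure d))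
    (hg : Integrable g (torusMeasure d)) (n : Fin d → ℤ) :
    fc (fun x => f x - g x) n = fc f n - fc g n := by
  simp only [fc, mFourierCoeff_eq]
  have h : ∀ {f : UnitAddTorus (Fin d) → ℝ}, Integrable f (torusMeasure d) →
      Integrable (fun x => UnitAddTorus.mFourier (-n) x * (f x : ℂ)) (torusMeasure d) := fun hf =>
    (hf.ofReal).bdd_mul (c := 1)
      (UnitAddTorus.mFourier (-n)).continuous.aestronglyMeasurable
      (Eventually.of_forall fun x => (norm_mFourier_apply (-n) x).le)
  rw [← integral_sub (h hf) (h hg)]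
  refine integral_congr_ae (Eventually.of_forall fun x => ?_)
  simp [mul_sub]

/-- A bound for the sup norm of a field in `H^p` with norm at most `K`. -/
def supBd (d N p : ℕ) (K : ℝ) : ℝ := N * ((embConst d p).toReal * K)

lemma norm_le_supBd {p : ℕ} (hp : d < 2 * p) {K : ℝ} (hK : 0 ≤ K) {f : L2 d N}
    (hf : sobolevNorm p f ≤ ENNReal.ofReal K) :
    ∀ᵐ x ∂(torusMeasure d), ‖f x‖ ≤ supBd d N p K := by
  filter_upwards [enorm_le_sobolevNorm p f] with x hx
  have h0 : 0 ≤ supBd d N p K := by unfold supBd; positivity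
  rw [← ENNReal.ofReal_le_ofReal_iff h0, ofReal_norm, supBd, ENNReal.ofReal_mul (by positivity),
    ENNReal.ofReal_mul (by positivity), ENNReal.ofReal_toReal (embConst_lt_top hp).ne,
    ENNReal.ofReal_natCast]
  exact hx.trans (by gcongr)

/-- The partial derivatives of a scalar function. -/
def pd (a : EuclideanSpace ℝ (Fin N) → ℝ) (b : Fin N) (y : EuclideanSpace ℝ (Fin N)) : ℝ :=
  fderiv ℝ a y (EuclideanSpace.single b 1)

lemma contDiff_pd {a : EuclideanSpace ℝ (Fin N) → ℝ} (ha : ContDiff ℝ ∞ a) (b : Fin N) :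
    ContDiff ℝ ∞ (pd a b) :=
  (ha.fderiv_right (m := ∞) le_rfl).clm_apply contDiff_const

lemma fderiv_eq_sum_pd (a : EuclideanSpace ℝ (Fin N) → ℝ) (y v : EuclideanSpace ℝ (Fin N)) :
    fderiv ℝ a y v = ∑ b, v b * pd a b y := by
  have h : v = ∑ j, v j • EuclideanSpace.single j (1 : ℝ) := by
    ext i
    simp [Finset.sum_apply, Pi.single_apply]
  conv_lhs => rw [h]
  simp [pd]

lemma exists_bound_on_ball {a : EuclideanSpace ℝ (Fin N) → ℝ} (ha : Continuous a) (ρ : ℝ) :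
    ∃ C, 0 ≤ C ∧ ∀ y, ‖y‖ ≤ ρ → |a y| ≤ C := by
  obtain ⟨C, hC⟩ := ((isCompact_closedBall (0 : EuclideanSpace ℝ (Fin N)) ρ).image
    ha).isBounded.exists_norm_le
  refine ⟨max C 0, le_max_right _ _, fun y hy => le_trans ?_ (le_max_left _ _)⟩
  exact hC _ ⟨y, by simpa using hy, rfl⟩

lemma exists_lipschitz_on_ball {a : EuclideanSpace ℝ (Fin N) → ℝ} (ha : ContDiff ℝ ∞ a) (ρ : ℝ) :
    ∃ C, 0 ≤ C ∧ ∀ y y', ‖y‖ ≤ ρ → ‖y'‖ ≤ ρ → |a y - a y'| ≤ C * ‖y - y'‖ := by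
  obtain ⟨C, hC⟩ := ((isCompact_closedBall (0 : EuclideanSpace ℝ (Fin N)) ρ).image
    (ha.continuous_fderiv (by simp))).isBounded.exists_norm_le
  refine ⟨max C 0, le_max_right _ _, fun y y' hy hy' => ?_⟩
  exact (convex_closedBall (0 : EuclideanSpace ℝ (Fin N)) ρ).norm_image_sub_le_of_norm_fderiv_le
    (fun z _ => (ha.differentiable (by simp)) z)
    (fun z hz => (hC _ ⟨z, hz, rfl⟩).trans (le_max_left _ _)) (by simpa using hy')
    (by simpa using hy)

lemma aesm_comp {a : EuclideanSpace ℝ (Fin N) → ℝ} (ha : Continuous a) (f : L2 d N) :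
    AEStronglyMeasurable (fun x => a (f x)) (torusMeasure d) :=
  ha.comp_aestronglyMeasurable (Lp.aestronglyMeasurable f)

lemma memLp_comp {p : ℕ} (hp : d < 2 * p) {a : EuclideanSpace ℝ (Fin N) → ℝ} (ha : Continuous a)
    {f : L2 d N} (hf : sobolevNorm p f < ⊤) (q : ℝ≥0∞) :
    MemLp (fun x => a (f x)) q (torusMeasure d) := by
  have h1 := norm_le_supBd hp ENNReal.toReal_nonneg (ENNReal.ofReal_toReal hf.ne).ge
  obtain ⟨C, -, hC⟩ := exists_bound_on_ball ha (supBd d N p (sobolevNorm p f).toReal)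
  exact MemLp.of_bound (aesm_comp ha f) C (h1.mono fun x hx => hC _ hx)

lemma le_two_pi_mul (x : ℝ≥0∞) : x ≤ ENNReal.ofReal (2 * Real.pi) * x := by
  refine le_mul_of_one_le_left' ?_
  rw [← ENNReal.ofReal_one]
  exact ENNReal.ofReal_le_ofReal (by linarith [Real.pi_gt_three])

lemma tsum_ec_apply_ne_top {p : ℕ} (hp : d < 2 * p) {f : L2 d N} (hf : sobolevNorm p f < ⊤)
    (j : Fin N) : ∑' n, fce (fun x => f x j) n ≠ ⊤ :=
  tsum_coeff_ne_top hp hf j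

/-- The derivative of a composition in terms of convolutions. -/
lemma fce_deriv_comp_le {p : ℕ} (hp : d < 2 * p) {f g : L2 d N} (hf : sobolevNorm p f < ⊤)
    (hg : sobolevNorm p g < ⊤) {i : Fin d} (hfg : IsWeakDeriv i f g)
    {a : EuclideanSpace ℝ (Fin N) → ℝ} (ha : ContDiff ℝ ∞ a) (n : Fin d → ℤ) :
    ENNReal.ofReal |(n i : ℝ)| * fce (fun x => a (f x)) n ≤
      ∑ b, conv (ec g) (fce (fun x => pd a b (f x))) n := by
  refine (le_two_pi_mul _).trans ?_
  rw [← mul_assoc, ← enorm_two_pi_I_mul, fce, ← enorm_mul, ← fc_chain hp hf hg hfg ha n]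
  simp only [fderiv_eq_sum_pd]
  have hm : ∀ b, MemLp (fun x => pd a b (f x)) ⊤ (torusMeasure d) := fun b =>
    memLp_comp hp (contDiff_pd ha b).continuous hf ⊤
  rw [fc_sum Finset.univ (fun b x => g x b * pd a b (f x)) fun b _ =>
    ((hm b).mul (memLp_apply g b) : MemLp _ 2 _).integrable one_le_two]
  refine (enorm_sum_le _ _).trans (Finset.sum_le_sum fun b _ => ?_)
  refine (fce_mul_le (memLp_apply g b) (tsum_ec_apply_ne_top hp hg b)
    ((hm b).mono_exponent le_top) n).trans ?_
  unfold conv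
  refine ENNReal.tsum_le_tsum fun m => ?_
  gcongr
  exact enorm_coeff_le g m b

/-- Composition with a smooth function is bounded on `H^{p+1}`. -/
theorem exists_hs_comp_le {p : ℕ} (hp : d < 2 * p) {K : ℝ} (hK : 0 ≤ K) :
    ∀ j ≤ p + 1, ∀ a : EuclideanSpace ℝ (Fin N) → ℝ, ContDiff ℝ ∞ a →
      ∃ C : ℝ, 0 ≤ C ∧ ∀ f : L2 d N, sobolevNorm (p + 1) f ≤ ENNReal.ofReal K →
        hs j (fce fun x => a (f x)) ≤ ENNReal.ofReal C := by
  -- The induction treats all smooth a at once, since the step replaces a by its partial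
  -- derivatives. The base case is the sup norm bound; in the step ∂_i f ∈ H^p multiplies a field in
  -- H^j with j ≤ p.
  intro j
  induction j with
  | zero =>
    intro _ a ha
    obtain ⟨C, hC0, hC⟩ := exists_bound_on_ball ha.continuous (supBd d N p K)
    refine ⟨C, hC0, fun f hf => ?_⟩
    rw [hs_zero_exp]
    refine l2_fce_le_const (aesm_comp ha.continuous f) ?_
    filter_upwards [norm_le_supBd hp hK ((sobolevNorm_mono p.le_succ f).trans hf)] with x hx
    exact hC _ hx
  | succ j ih =>
    intro hj a ha
    obtain ⟨C0, hC0, h0⟩ := ih (by lia) a ha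
    have hb := fun b => ih (by lia) (pd a b) (contDiff_pd ha b)
    choose Cb hCb0 hCb using hb
    set P := (prodConst d p).toReal
    have hP : ENNReal.ofReal P = prodConst d p := ENNReal.ofReal_toReal (prodConst_lt_top hp).ne
    have hP0 : 0 ≤ P := ENNReal.toReal_nonneg
    refine ⟨C0 + ∑ _i : Fin d, ∑ b, P * (2 * Real.pi * K) * Cb b, ?_, fun f hf => ?_⟩
    · refine add_nonneg hC0 (Finset.sum_nonneg fun _ _ => Finset.sum_nonneg fun b _ => ?_)
      have := hCb0 b
      positivity
    have hft : sobolevNorm (p + 1) f < ⊤ := hf.trans_lt ENNReal.ofReal_lt_top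
    have hfp : sobolevNorm p f < ⊤ := (sobolevNorm_mono p.le_succ f).trans_lt hft
    rw [ENNReal.ofReal_add hC0 (Finset.sum_nonneg fun _ _ => Finset.sum_nonneg fun b _ => by
        have := hCb0 b; positivity),
      ENNReal.ofReal_sum_of_nonneg (fun _ _ => Finset.sum_nonneg fun b _ => by
        have := hCb0 b; positivity)]
    refine (hs_succ_le _ _).trans (add_le_add (h0 f hf) (Finset.sum_le_sum fun i _ => ?_))
    obtain ⟨g, hg⟩ := exists_isWeakDeriv i ((sobolevNorm_mono (by lia) f).trans_lt hft)
    have hgp : sobolevNorm p g ≤ ENNReal.ofReal (2 * Real.pi * K) := by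
      rw [ENNReal.ofReal_mul (by positivity)]
      exact (hg.sobolevNorm_le p).trans (by gcongr)
    refine (hs_mono (fce_deriv_comp_le hp hfp (hgp.trans_lt ENNReal.ofReal_lt_top) hg ha)).trans ?_
    refine (hs_finsetSum_le _ _ _).trans ?_
    rw [ENNReal.ofReal_sum_of_nonneg (fun b _ => by have := hCb0 b; positivity)]
    refine Finset.sum_le_sum fun b _ => ?_
    refine (hs_conv_le_prodConst (p := p) (by lia) _ _).trans ?_
    rw [ENNReal.ofReal_mul (by positivity), ENNReal.ofReal_mul hP0, hP, ← sobolevNorm_eq_hs]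
    gcongr
    exact hCb b f hf

end ChainRule

/-! ### Lipschitz bounds for compositions, and matrix valued functions of a field. -/

section Differences

variable {d N : ℕ}

/-- The derivative of a difference of compositions in terms of convolutions. -/
lemma fce_deriv_sub_comp_le {p : ℕ} (hp : d < 2 * p) {f g f' g' : L2 d N}
    (hf : sobolevNorm p f < ⊤) (hg : sobolevNorm p g < ⊤) (hf' : sobolevNorm p f' < ⊤)
    (hg' : sobolevNorm p g' < ⊤) {i : Fin d} (hfg : IsWeakDeriv i f g)
    (hfg' : IsWeakDeriv i f' g')
    {a : EuclideanSpace ℝ (Fin N) → ℝ} (ha : ContDiff ℝ ∞ a) (n : Fin d → ℤ) :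
    ENNReal.ofReal |(n i : ℝ)| * fce (fun x => a (f x) - a (f' x)) n ≤
      ∑ b, (conv (ec (g - g')) (fce (fun x => pd a b (f x))) n +
        conv (ec g') (fce (fun x => pd a b (f x) - pd a b (f' x))) n) := by
  have hgg : sobolevNorm p (g - g') < ⊤ :=
    (sobolevNorm_sub_le p g g').trans_lt (ENNReal.add_lt_top.2 ⟨hg, hg'⟩)
  have hm : ∀ {f : L2 d N}, sobolevNorm p f < ⊤ → ∀ b,
      MemLp (fun x => pd a b (f x)) ⊤ (torusMeasure d) := fun hf b =>
    memLp_comp hp (contDiff_pd ha b).continuous hf ⊤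
  have hi : ∀ {h : UnitAddTorus (Fin d) → ℝ} (g : L2 d N) (b : Fin N),
      MemLp h ⊤ (torusMeasure d) → Integrable (fun x => g x b * h x) (torusMeasure d) :=
    fun g b hh => (hh.mul (memLp_apply g b) : MemLp _ 2 _).integrable one_le_two
  have hia : ∀ {f : L2 d N}, sobolevNorm p f < ⊤ →
      Integrable (fun x => a (f x)) (torusMeasure d) := fun hf =>
    (memLp_comp hp ha.continuous hf 2).integrable one_le_two
  have h1 : 2 * Real.pi * Complex.I * (n i : ℂ) * fc (fun x => a (f x) - a (f' x)) n =
      ∑ b, (fc (fun x => (g - g') x b * pd a b (f x)) n +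
        fc (fun x => g' x b * (pd a b (f x) - pd a b (f' x))) n) := by
    rw [fc_sub (hia hf) (hia hf'), mul_sub, ← fc_chain hp hf hg hfg ha n,
      ← fc_chain hp hf' hg' hfg' ha n]
    simp only [fderiv_eq_sum_pd]
    rw [fc_sum Finset.univ (fun b x => g x b * pd a b (f x)) fun b _ => hi g b (hm hf b),
      fc_sum Finset.univ (fun b x => g' x b * pd a b (f' x)) fun b _ => hi g' b (hm hf' b),
      ← Finset.sum_sub_distrib]
    refine Finset.sum_congr rfl fun b _ => ?_
    have e1 : fc (fun x => (g - g') x b * pd a b (f x)) n =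
        fc (fun x => g x b * pd a b (f x)) n - fc (fun x => g' x b * pd a b (f x)) n := by
      rw [← fc_sub (hi g b (hm hf b)) (hi g' b (hm hf b))]
      refine congrFun (fc_congr ?_) n
      filter_upwards [Lp.coeFn_sub g g'] with x hx
      rw [hx, Pi.sub_apply, PiLp.sub_apply]
      ring
    have e2 : fc (fun x => g' x b * (pd a b (f x) - pd a b (f' x))) n =
        fc (fun x => g' x b * pd a b (f x)) n - fc (fun x => g' x b * pd a b (f' x)) n := by
      rw [← fc_sub (hi g' b (hm hf b)) (hi g' b (hm hf' b))]
      simp only [mul_sub]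
    rw [e1, e2]
    ring
  refine (le_two_pi_mul _).trans ?_
  rw [← mul_assoc, ← enorm_two_pi_I_mul, fce, ← enorm_mul, h1]
  refine (enorm_sum_le _ _).trans (Finset.sum_le_sum fun b _ => ?_)
  have hmul : ∀ (g : L2 d N) (h : UnitAddTorus (Fin d) → ℝ), sobolevNorm p g < ⊤ →
      MemLp h ⊤ (torusMeasure d) → ‖fc (fun x => g x b * h x) n‖ₑ ≤ conv (ec g) (fce h) n := by
    intro g h hg hh
    refine (fce_mul_le (memLp_apply g b) (tsum_ec_apply_ne_top hp hg b)
      (hh.mono_exponent le_top) n).trans ?_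
    unfold conv
    refine ENNReal.tsum_le_tsum fun m => ?_
    gcongr
    exact enorm_coeff_le g m b
  exact (enorm_add_le _ _).trans (add_le_add (hmul _ _ hgg (hm hf b))
    (hmul _ _ hg' ((hm hf b).sub (hm hf' b))))

/-- Composition with a smooth function is Lipschitz in `H^σ` on bounded subsets of `H^{p+1}`. -/
theorem exists_hs_sub_comp_le {p : ℕ} (hp : d < 2 * p) {K : ℝ} (hK : 0 ≤ K) :
    ∀ σ ≤ p, ∀ a : EuclideanSpace ℝ (Fin N) → ℝ, ContDiff ℝ ∞ a →
      ∃ C : ℝ, 0 ≤ C ∧ ∀ f f' : L2 d N, sobolevNorm (p + 1) f ≤ ENNReal.ofReal K →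
        sobolevNorm (p + 1) f' ≤ ENNReal.ofReal K →
        hs σ (fce fun x => a (f x) - a (f' x)) ≤ ENNReal.ofReal C * sobolevNorm σ (f - f') := by
  intro σ
  induction σ with
  | zero =>
    intro _ a ha
    obtain ⟨C, hC0, hC⟩ := exists_lipschitz_on_ball ha (supBd d N p K)
    refine ⟨C, hC0, fun f f' hf hf' => ?_⟩
    rw [hs_zero_exp, sobolevNorm_zero_exp]
    refine l2_fce_le ((aesm_comp ha.continuous f).sub (aesm_comp ha.continuous f')) ?_
    filter_upwards [norm_le_supBd hp hK ((sobolevNorm_mono p.le_succ f).trans hf),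
      norm_le_supBd hp hK ((sobolevNorm_mono p.le_succ f').trans hf'), Lp.coeFn_sub f f']
      with x hx hx' hs
    rw [hs]
    exact hC _ _ hx hx'
  | succ σ ih =>
    intro hσ a ha
    obtain ⟨C0, hC0, h0⟩ := ih (by lia) a ha
    have hb := fun b => ih (by lia) (pd a b) (contDiff_pd ha b)
    choose Cb hCb0 hCb using hb
    -- The derivative of the difference has two kinds of terms. Next to ∂_i(f - f') ∈ H^σ the
    -- coefficient is needed in H^p, which is the composition bound; next to ∂_i f' ∈ H^p stands a
    -- difference of coefficients, covered by induction.
    have hb' := fun b => exists_hs_comp_le (N := N) hp hK p p.le_succ (pd a b) (contDiff_pd ha b)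
    choose Db hDb0 hDb using hb'
    set P := (prodConst d p).toReal
    have hP : ENNReal.ofReal P = prodConst d p := ENNReal.ofReal_toReal (prodConst_lt_top hp).ne
    have hP0 : 0 ≤ P := ENNReal.toReal_nonneg
    have hpos : ∀ b, 0 ≤ P * Db b * (2 * Real.pi) + P * (2 * Real.pi * K) * Cb b := fun b => by
      have := hCb0 b
      have := hDb0 b
      positivity
    refine ⟨C0 + ∑ _i : Fin d, ∑ b, (P * Db b * (2 * Real.pi) + P * (2 * Real.pi * K) * Cb b),
      ?_, fun f f' hf hf' => ?_⟩
    · exact add_nonneg hC0 (Finset.sum_nonneg fun _ _ => Finset.sum_nonneg fun b _ => hpos b)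
    have ht : ∀ {f : L2 d N}, sobolevNorm (p + 1) f ≤ ENNReal.ofReal K →
        sobolevNorm (p + 1) f < ⊤ := fun hf => hf.trans_lt ENNReal.ofReal_lt_top
    have htp : ∀ {f : L2 d N}, sobolevNorm (p + 1) f ≤ ENNReal.ofReal K →
        sobolevNorm p f < ⊤ := fun hf => (sobolevNorm_mono p.le_succ _).trans_lt (ht hf)
    rw [ENNReal.ofReal_add hC0 (Finset.sum_nonneg fun _ _ => Finset.sum_nonneg fun b _ => hpos b),
      ENNReal.ofReal_sum_of_nonneg (fun _ _ => Finset.sum_nonneg fun b _ => hpos b), add_mul,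
      Finset.sum_mul]
    refine (hs_succ_le _ _).trans (add_le_add ((h0 f f' hf hf').trans ?_)
      (Finset.sum_le_sum fun i _ => ?_))
    · gcongr
      exact sobolevNorm_mono σ.le_succ _
    obtain ⟨g, hg⟩ := exists_isWeakDeriv i ((sobolevNorm_mono (by lia) f).trans_lt (ht hf))
    obtain ⟨g', hg'⟩ := exists_isWeakDeriv i ((sobolevNorm_mono (by lia) f').trans_lt (ht hf'))
    have hgp : ∀ {f g : L2 d N}, sobolevNorm (p + 1) f ≤ ENNReal.ofReal K → IsWeakDeriv i f g →
        sobolevNorm p g ≤ ENNReal.ofReal (2 * Real.pi * K) := fun hf hg => by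
      rw [ENNReal.ofReal_mul (by positivity)]
      exact (hg.sobolevNorm_le p).trans (by gcongr)
    refine (hs_mono (fce_deriv_sub_comp_le hp (htp hf)
      ((hgp hf hg).trans_lt ENNReal.ofReal_lt_top) (htp hf')
      ((hgp hf' hg').trans_lt ENNReal.ofReal_lt_top) hg hg' ha)).trans ?_
    refine (hs_finsetSum_le _ _ _).trans ?_
    rw [ENNReal.ofReal_sum_of_nonneg (fun b _ => hpos b), Finset.sum_mul]
    refine Finset.sum_le_sum fun b _ => (hs_add_le _ _ _).trans ?_
    have := hCb0 b
    have := hDb0 b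
    rw [ENNReal.ofReal_add (by positivity) (by positivity), add_mul]
    refine add_le_add ?_ ?_
    · rw [conv_comm]
      refine (hs_conv_le_prodConst (p := p) (by lia) _ _).trans ?_
      rw [ENNReal.ofReal_mul (p := P * Db b) (by positivity), ENNReal.ofReal_mul hP0, hP,
        ← sobolevNorm_eq_hs, mul_assoc _ (ENNReal.ofReal (2 * Real.pi))]
      gcongr
      · exact hDb b f ((hf))
      · exact (hg.sub hg').sobolevNorm_le σ
    · refine (hs_conv_le_prodConst (p := p) (by lia) _ _).trans ?_
      rw [ENNReal.ofReal_mul (p := P * _) (by positivity), ENNReal.ofReal_mul hP0, hP,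
        ← sobolevNorm_eq_hs, mul_assoc _ (ENNReal.ofReal (Cb b))]
      gcongr
      · exact hgp hf' hg'
      · exact (hCb b f f' hf hf').trans (by gcongr; exact sobolevNorm_mono σ.le_succ _)

/-! ### Matrix valued functions of a field -/

variable {A : EuclideanSpace ℝ (Fin N) → Matrix (Fin N) (Fin N) ℝ}

lemma bddField_comp {p : ℕ} (hp : d < 2 * p) (hA : ∀ a b, ContDiff ℝ ∞ fun y => A y a b)
    {f : L2 d N} (hf : sobolevNorm p f < ⊤) : BddField (fun x => A (f x)) := by
  refine ⟨fun a b => aesm_comp (hA a b).continuous f, ?_⟩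
  have h1 := norm_le_supBd hp ENNReal.toReal_nonneg (ENNReal.ofReal_toReal hf.ne).ge
  have h2 := fun a b => exists_bound_on_ball (hA a b).continuous
    (supBd d N p (sobolevNorm p f).toReal)
  choose C hC0 hC using h2
  refine ⟨∑ a, ∑ b, C a b, h1.mono fun x hx a b => (hC a b _ hx).trans ?_⟩
  exact (Finset.single_le_sum (f := fun b => C a b) (fun b _ => hC0 a b)
      (Finset.mem_univ b)).trans
    (Finset.single_le_sum (f := fun a => ∑ b, C a b)
      (fun a _ => Finset.sum_nonneg fun b _ => hC0 a b) (Finset.mem_univ a))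

lemma hs_mc_le (s : ℕ) (G : UnitAddTorus (Fin d) → Matrix (Fin N) (Fin N) ℝ) :
    hs s (mc G) ≤ ∑ a, ∑ b, hs s (fce fun x => G x a b) :=
  (hs_finsetSum_le _ _ _).trans (Finset.sum_le_sum fun _ _ => hs_finsetSum_le _ _ _)

lemma exists_mc_comp_le {p : ℕ} (hp : d < 2 * p) {K : ℝ} (hK : 0 ≤ K)
    (hA : ∀ a b, ContDiff ℝ ∞ fun y => A y a b) :
    ∃ C : ℝ, 0 ≤ C ∧ ∀ f : L2 d N, sobolevNorm (p + 1) f ≤ ENNReal.ofReal K →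
      hs (p + 1) (mc fun x => A (f x)) ≤ ENNReal.ofReal C := by
  have h := fun a b => exists_hs_comp_le hp hK (p + 1) le_rfl _ (hA a b)
  choose C hC0 hC using h
  refine ⟨∑ a, ∑ b, C a b, Finset.sum_nonneg fun a _ => Finset.sum_nonneg fun b _ => hC0 a b,
    fun f hf => (hs_mc_le _ _).trans ?_⟩
  rw [ENNReal.ofReal_sum_of_nonneg fun a _ => Finset.sum_nonneg fun b _ => hC0 a b]
  refine Finset.sum_le_sum fun a _ => ?_
  rw [ENNReal.ofReal_sum_of_nonneg fun b _ => hC0 a b]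
  exact Finset.sum_le_sum fun b _ => hC a b f hf

lemma exists_mc_sub_le {p : ℕ} (hp : d < 2 * p) {K : ℝ} (hK : 0 ≤ K)
    (hA : ∀ a b, ContDiff ℝ ∞ fun y => A y a b) {σ : ℕ} (hσ : σ ≤ p) :
    ∃ C : ℝ, 0 ≤ C ∧ ∀ f f' : L2 d N, sobolevNorm (p + 1) f ≤ ENNReal.ofReal K →
      sobolevNorm (p + 1) f' ≤ ENNReal.ofReal K →
      hs σ (mc fun x => A (f x) - A (f' x)) ≤ ENNReal.ofReal C * sobolevNorm σ (f - f') := by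
  have h := fun a b => exists_hs_sub_comp_le hp hK σ hσ _ (hA a b)
  choose C hC0 hC using h
  refine ⟨∑ a, ∑ b, C a b, Finset.sum_nonneg fun a _ => Finset.sum_nonneg fun b _ => hC0 a b,
    fun f f' hf hf' => (hs_mc_le _ _).trans ?_⟩
  rw [ENNReal.ofReal_sum_of_nonneg fun a _ => Finset.sum_nonneg fun b _ => hC0 a b,
    Finset.sum_mul]
  refine Finset.sum_le_sum fun a _ => ?_
  rw [ENNReal.ofReal_sum_of_nonneg fun b _ => hC0 a b, Finset.sum_mul]
  exact Finset.sum_le_sum fun b _ => hC a b f f' hf hf'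

lemma exists_matrix_lipschitz (hA : ∀ a b, ContDiff ℝ ∞ fun y => A y a b) (ρ : ℝ) :
    ∃ C : ℝ, 0 ≤ C ∧ ∀ y y', ‖y‖ ≤ ρ → ‖y'‖ ≤ ρ →
      ∑ a, ∑ b, |(A y - A y') a b| ≤ C * ‖y - y'‖ := by
  have h := fun a b => exists_lipschitz_on_ball (hA a b) ρ
  choose C hC0 hC using h
  refine ⟨∑ a, ∑ b, C a b, Finset.sum_nonneg fun a _ => Finset.sum_nonneg fun b _ => hC0 a b,
    fun y y' hy hy' => ?_⟩
  simp only [Finset.sum_mul]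
  exact Finset.sum_le_sum fun a _ => Finset.sum_le_sum fun b _ => hC a b y y' hy hy'

/-- Minimum of a positive continuous function on the compact product of ball and unit sphere,
extended to all v by homogeneity. The product is empty if ρ < 0 or N = 0, and then any constant will
do. -/
lemma exists_coercive_on_ball (hA : ∀ a b, ContDiff ℝ ∞ fun y => A y a b)
    (hpos : ∀ y, (A y).PosDef) (ρ : ℝ) :
    ∃ lam : ℝ, 0 < lam ∧ ∀ y, ‖y‖ ≤ ρ → ∀ v : EuclideanSpace ℝ (Fin N),
      lam * ‖v‖ ^ 2 ≤ (A y *ᵥ v.ofLp) ⬝ᵥ v.ofLp := by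
  let S := Metric.closedBall (0 : EuclideanSpace ℝ (Fin N)) ρ ×ˢ
    Metric.sphere (0 : EuclideanSpace ℝ (Fin N)) 1
  have hS : IsCompact S := (isCompact_closedBall _ _).prod (isCompact_sphere _ _)
  let q : EuclideanSpace ℝ (Fin N) × EuclideanSpace ℝ (Fin N) → ℝ :=
    fun z => (A z.1 *ᵥ z.2.ofLp) ⬝ᵥ z.2.ofLp
  have hv : Continuous fun z : EuclideanSpace ℝ (Fin N) × EuclideanSpace ℝ (Fin N) => z.2.ofLp :=
    (PiLp.continuous_ofLp 2 _).comp continuous_snd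
  have hAc : Continuous fun z : EuclideanSpace ℝ (Fin N) × EuclideanSpace ℝ (Fin N) => A z.1 :=
    continuous_matrix fun a b => (hA a b).continuous.comp continuous_fst
  have hq : Continuous q := (hAc.matrix_mulVec hv).dotProduct hv
  have hqpos : ∀ z ∈ S, 0 < q z := by
    rintro ⟨y, v⟩ ⟨-, hv⟩
    have hv0 : v.ofLp ≠ 0 := by
      intro h0
      have : v = 0 := WithLp.ofLp_injective 2 h0
      simp [this] at hv
    have := (hpos y).dotProduct_mulVec_pos hv0
    simpa [q, dotProduct_comm] using this
  obtain ⟨lam, hl, hlam⟩ : ∃ lam : ℝ, 0 < lam ∧ ∀ z ∈ S, lam ≤ q z := by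
    rcases S.eq_empty_or_nonempty with hE | hE
    · exact ⟨1, one_pos, fun z hz => by simp [hE] at hz⟩
    · obtain ⟨z, hz, hmin⟩ := hS.exists_isMinOn hE hq.continuousOn
      exact ⟨q z, hqpos z hz, fun w hw => hmin hw⟩
  refine ⟨lam, hl, fun y hy v => ?_⟩
  rcases eq_or_ne v 0 with rfl | hv0
  · simp
  have hn : ‖v‖ ≠ 0 := norm_ne_zero_iff.2 hv0
  have h1 := hlam (y, ‖v‖⁻¹ • v) ⟨by simpa using hy, by simp [norm_smul, hn]⟩
  simp only [q, WithLp.ofLp_smul, Matrix.mulVec_smul, smul_dotProduct, dotProduct_smul,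
    smul_eq_mul] at h1
  have h2 := mul_le_mul_of_nonneg_right h1 (sq_nonneg ‖v‖)
  refine h2.trans (le_of_eq ?_)
  field_simp

end Differences

/-! ### The elliptic problem `P (G y) = P g` on the kernel of the constraint operator -/

section Elliptic

variable {d N m : ℕ}

/-- `y ∈ ker L` solves `G y - g ⊥ ker L`. -/
structure IsProjSol (L : FirstOrderOp d N m)
    (G : UnitAddTorus (Fin d) → Matrix (Fin N) (Fin N) ℝ) (g y : L2 d N) : Prop where
  mem : y ∈ L.ker
  orth : ∀ φ ∈ L.ker, inner ℝ (mulOp G y - g) φ = 0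

lemma IsProjSol.sub {L : FirstOrderOp d N m}
    {G : UnitAddTorus (Fin d) → Matrix (Fin N) (Fin N) ℝ} {g g' y y' : L2 d N}
    (h : IsProjSol L G g y) (h' : IsProjSol L G g' y') : IsProjSol L G (g - g') (y - y') where
  mem := L.ker.sub_mem h.mem h'.mem
  orth := fun φ hφ => by
    have h1 := h.orth φ hφ
    have h2 := h'.orth φ hφ
    rw [map_sub, show mulOp G y - mulOp G y' - (g - g') =
      (mulOp G y - g) - (mulOp G y' - g') by abel, inner_sub_left, h1, h2, sub_zero]

/-- Lax-Milgram on the Hilbert space ker L, for multiplication by G followed by the orthogonal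
projection onto ker L. -/
lemma exists_isProjSol (L : FirstOrderOp d N m)
    (G : UnitAddTorus (Fin d) → Matrix (Fin N) (Fin N) ℝ) {lam : ℝ} (hl : 0 < lam)
    (hG : ∀ f : L2 d N, lam * ‖f‖ ^ 2 ≤ inner ℝ (mulOp G f) f) (g : L2 d N) :
    ∃ y, IsProjSol L G g y := by
  have : CompleteSpace L.ker := L.isClosed_ker.completeSpace_coe
  let T : L.ker →L[ℝ] L.ker :=
    L.ker.orthogonalProjectionOnto.comp ((mulOp G).comp L.ker.subtypeL)
  have hT : ∀ y φ : L.ker, inner ℝ (T y) φ = inner ℝ (mulOp G (y : L2 d N)) (φ : L2 d N) := by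
    intro y φ
    simp [T]
  let B : L.ker →L[ℝ] L.ker →L[ℝ] ℝ := (innerSL ℝ).comp T
  have hB : ∀ y φ, B y φ = inner ℝ (T y) φ := fun y φ => rfl
  have hco : IsCoercive B := by
    refine ⟨lam, hl, fun y => ?_⟩
    rw [hB, hT]
    have := hG (y : L2 d N)
    rw [pow_two, ← mul_assoc] at this
    exact this
  obtain ⟨y, hy⟩ := hco.continuousLinearEquivOfBilin.surjective (L.ker.orthogonalProjectionOnto g)
  refine ⟨y, y.2, fun φ hφ => ?_⟩
  have h1 := hco.continuousLinearEquivOfBilin_apply y ⟨φ, hφ⟩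
  rw [hy, hB, hT] at h1
  rw [inner_sub_left, ← h1]
  simp

/-- Elliptic regularity. -/
theorem exists_elliptic_bound {p : ℕ} (hp : d < 2 * p) {lam B : ℝ} (hl : 0 < lam) (hB : 0 ≤ B)
    (L : FirstOrderOp d N m) :
    ∀ σ ≤ p + 1, ∃ C : ℝ, 0 ≤ C ∧ ∀ G : UnitAddTorus (Fin d) → Matrix (Fin N) (Fin N) ℝ,
      BddField G → hs (p + 1) (mc G) ≤ ENNReal.ofReal B →
      (∀ f : L2 d N, lam * ‖f‖ ^ 2 ≤ inner ℝ (mulOp G f) f) →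
      ∀ g y, IsProjSol L G g y → ∀ b, 0 ≤ b → sobolevNorm σ g ≤ ENNReal.ofReal b →
        sobolevNorm σ y ≤ ENNReal.ofReal (C * b) := by
  have key : ∀ (G : UnitAddTorus (Fin d) → Matrix (Fin N) (Fin N) ℝ) (f h : L2 d N) (E : ℝ),
      lam * ‖f‖ ^ 2 ≤ inner ℝ (mulOp G f) f → inner ℝ (mulOp G f) f = inner ℝ h f → ‖h‖ ≤ E →
      ‖f‖ ≤ lam⁻¹ * E := by
    intro G f h E h1 h2 h3
    have h4 : inner ℝ h f ≤ E * ‖f‖ := (real_inner_le_norm h f).trans (by gcongr)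
    rcases (norm_nonneg f).eq_or_lt with h0 | h0
    · rw [← h0]
      have := (norm_nonneg h).trans h3
      positivity
    · rw [le_inv_mul_iff₀ hl]
      refine le_of_mul_le_mul_right ?_ h0
      rw [h2, pow_two, ← mul_assoc] at h1
      exact h1.trans h4
  intro σ
  induction σ with
  | zero =>
    intro _
    refine ⟨lam⁻¹, by positivity, fun G _ _ hco g y hy b hb hg => ?_⟩
    rw [sobolevNorm_zero_exp, ← ofReal_norm]
    refine ENNReal.ofReal_le_ofReal (key G y g b (hco y) ?_ (norm_le_of_sobolevNorm hb hg))
    have := hy.orth y hy.mem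
    rw [inner_sub_left] at this
    linarith
  | succ σ ih =>
    intro hσ
    obtain ⟨C, hC0, hC⟩ := ih (by lia)
    have hcc := commConst_lt_top hp
    set c := (commConst d p).toReal with hc
    have hc0 : 0 ≤ c := ENNReal.toReal_nonneg
    -- Coercivity is applied to Jy. The source contributes b and the commutator of J with G
    -- contributes c·B·(C b), where C b bounds y in the previous order.
    refine ⟨lam⁻¹ * (1 + c * B * C), by positivity, fun G hG hGB hco g y hy b hb hg => ?_⟩
    have hgσ : sobolevNorm σ g ≤ ENNReal.ofReal b := (sobolevNorm_mono σ.le_succ g).trans hg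
    have hyσ := hC G hG hGB hco g y hy b hb hgσ
    rw [sobolevNorm_le_ofReal_iff (by positivity)]
    intro R
    set J : L2 d N →L[ℝ] L2 d N := jop (σ + 1) R
    have hcomm : ‖J (mulOp G y) - mulOp G (J y)‖ ≤ c * B * (C * b) := by
      rw [← ENNReal.ofReal_le_ofReal_iff (by positivity), ofReal_norm]
      refine (enorm_commutator_le hp (by lia) hG (ne_top_of_le_ne_top ENNReal.ofReal_ne_top hGB)
        R y).trans ?_
      rw [ENNReal.ofReal_mul (p := c * B) (by positivity), ENNReal.ofReal_mul hc0, hc,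
        ENNReal.ofReal_toReal hcc.ne]
      gcongr
    have hJg : ‖J g‖ ≤ b := (sobolevNorm_le_ofReal_iff hb).1 hg R
    -- The orthogonality relation tested with J(Jy) ∈ ker L, J being self-adjoint.
    have h1 : inner ℝ (J (mulOp G y)) (J y) = inner ℝ (J g) (J y) := by
      have := hy.orth (J (J y)) (FirstOrderOp.jop_mem_ker (FirstOrderOp.jop_mem_ker hy.mem _ _) _ _)
      rw [inner_sub_left] at this
      rw [inner_jop_left, inner_jop_left]
      linarith
    have h2 : inner ℝ (mulOp G (J y)) (J y) =
        inner ℝ (J g - (J (mulOp G y) - mulOp G (J y))) (J y) := by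
      rw [inner_sub_left, inner_sub_left, h1]
      ring
    refine (key G (J y) _ (b + c * B * (C * b)) (hco _) h2 ?_).trans (le_of_eq (by ring))
    exact (norm_sub_le _ _).trans (add_le_add hJg hcomm)

end Elliptic

/-! ### Bounds with real constants -/

section Bounds

variable {d N : ℕ}

/-- `‖f‖_s ≤ b`. -/
def SobLE (s : ℕ) (f : L2 d N) (b : ℝ) : Prop := sobolevNorm s f ≤ ENNReal.ofReal b

/-- `‖G‖_s ≤ b` for a matrix field. -/
def FieldLE (s : ℕ) (G : UnitAddTorus (Fin d) → Matrix (Fin N) (Fin N) ℝ) (b : ℝ) : Prop :=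
  hs s (mc G) ≤ ENNReal.ofReal b

variable {s : ℕ} {f g : L2 d N} {a b : ℝ}

lemma SobLE.mono (h : SobLE s f a) (hab : a ≤ b) : SobLE s f b :=
  le_trans h (ENNReal.ofReal_le_ofReal hab)

lemma SobLE.mono_exp {s' : ℕ} (h : SobLE s f a) (hs : s' ≤ s) : SobLE s' f a :=
  (sobolevNorm_mono hs f).trans h

lemma SobLE.lt_top (h : SobLE s f a) : sobolevNorm s f < ⊤ := lt_of_le_of_lt h ENNReal.ofReal_lt_top

lemma SobLE.norm_le (h : SobLE s f a) (ha : 0 ≤ a) : ‖f‖ ≤ a := norm_le_of_sobolevNorm ha h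

lemma SobLE.norm_jop_le (h : SobLE s f a) (ha : 0 ≤ a) (R : ℕ) : ‖jop s R f‖ ≤ a :=
  (sobolevNorm_le_ofReal_iff ha).1 h R

lemma SobLE.add (hf : SobLE s f a) (hg : SobLE s g b) (ha : 0 ≤ a) (hb : 0 ≤ b) :
    SobLE s (f + g) (a + b) := by
  unfold SobLE
  rw [ENNReal.ofReal_add ha hb]
  exact (sobolevNorm_add_le s f g).trans (add_le_add hf hg)

lemma SobLE.sub (hf : SobLE s f a) (hg : SobLE s g b) (ha : 0 ≤ a) (hb : 0 ≤ b) :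
    SobLE s (f - g) (a + b) := by
  unfold SobLE
  rw [ENNReal.ofReal_add ha hb]
  exact (sobolevNorm_sub_le s f g).trans (add_le_add hf hg)

lemma SobLE.sum {f : Fin d → L2 d N} (hf : ∀ i, SobLE s (f i) a) :
    SobLE s (∑ i, f i) (d * a) := by
  refine (sobolevNorm_sum_le s _ f).trans ((Finset.sum_le_sum fun i _ => hf i).trans ?_)
  rw [ENNReal.ofReal_mul (by positivity)]
  simp

lemma SobLE.weakDeriv {i : Fin d} (hf : SobLE (s + 1) f a) (h : IsWeakDeriv i f g) :
    SobLE s g (2 * Real.pi * a) := by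
  unfold SobLE
  rw [ENNReal.ofReal_mul (by positivity)]
  exact (h.sobolevNorm_le s).trans (by gcongr; exact hf)

variable {G : UnitAddTorus (Fin d) → Matrix (Fin N) (Fin N) ℝ} {p : ℕ}

lemma FieldLE.ne_top (h : FieldLE s G a) : hs s (mc G) ≠ ⊤ :=
  ne_top_of_le_ne_top ENNReal.ofReal_ne_top h

lemma FieldLE.mono_exp {s' : ℕ} (h : FieldLE s G a) (hs : s' ≤ s) : FieldLE s' G a :=
  (hs_mono_exp hs _).trans h

/-- The constant in the product estimates, as a real number. -/
def prodR (d p : ℕ) : ℝ := (prodConst d p).toReal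

lemma prodR_nonneg (d p : ℕ) : 0 ≤ prodR d p := ENNReal.toReal_nonneg

lemma FieldLE.mulOp (hG : FieldLE p G a) (hf : SobLE s f b) (hp : d < 2 * p) (hs : s ≤ p)
    (h : BddField G) (ha : 0 ≤ a) : SobLE s (mulOp G f) (prodR d p * a * b) := by
  unfold SobLE prodR
  rw [ENNReal.ofReal_mul (by positivity), ENNReal.ofReal_mul (by positivity),
    ENNReal.ofReal_toReal (prodConst_lt_top hp).ne]
  exact (sobolevNorm_mulOp_le hp hs h hG.ne_top f).trans (by gcongr; exacts [hG, hf])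

lemma FieldLE.mulOp' (hG : FieldLE s G a) (hf : SobLE p f b) (hp : d < 2 * p) (hs : s ≤ p)
    (h : BddField G) (hGp : SymHyp.hs p (mc G) ≠ ⊤) (ha : 0 ≤ a) :
    SobLE s (SymHyp.mulOp G f) (prodR d p * a * b) := by
  unfold SobLE prodR
  rw [ENNReal.ofReal_mul (by positivity), ENNReal.ofReal_mul (by positivity),
    ENNReal.ofReal_toReal (prodConst_lt_top hp).ne]
  exact (sobolevNorm_mulOp_le' hp hs h hGp f).trans (by gcongr; exacts [hG, hf])

/-- The commutator estimate for `J_s` with `0 ≤ s ≤ p + 1`. -/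
lemma FieldLE.norm_commutator_le (hG : FieldLE (p + 1) G a) (hp : d < 2 * p) (hs : s ≤ p + 1)
    (h : BddField G) (hf : ∀ σ, s = σ + 1 → SobLE σ f b) (ha : 0 ≤ a) (hb : 0 ≤ b) (R : ℕ) :
    ‖jop s R (SymHyp.mulOp G f) - SymHyp.mulOp G (jop s R f)‖ ≤ (commConst d p).toReal * a * b := by
  cases s with
  | zero =>
    rw [jop_zero_exp, jop_zero_exp, sub_self, norm_zero]
    positivity
  | succ σ =>
    rw [← ENNReal.ofReal_le_ofReal_iff (by positivity), ofReal_norm,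
      ENNReal.ofReal_mul (by positivity), ENNReal.ofReal_mul (by positivity),
      ENNReal.ofReal_toReal (commConst_lt_top hp).ne]
    exact (enorm_commutator_le hp (by lia) h hG.ne_top R f).trans
      (by gcongr; exacts [hG, hf σ rfl])

/-- An `L²` bound for products in terms of `H^s` and `H^{p-s}` norms, with a pointwise control of
the matrix field. -/
lemma norm_mulOp_le_of_pointwise (hp : d < 2 * p) (hs : s ≤ p) (h : BddField G) {Λ : ℝ}
    (hΛ : 0 ≤ Λ) (hG : ∀ᵐ x ∂(torusMeasure d), ∑ i, ∑ j, |G x i j| ≤ Λ * ‖g x‖)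
    (hgp : sobolevNorm p g < ⊤) (hg : SobLE s g a) (hf : SobLE (p - s) f b)
    (ha : 0 ≤ a) (hb : 0 ≤ b) :
    ‖mulOp G f‖ ≤ Λ * (N * (2 * (embConst d p).toReal * (N * N * a) * b)) := by
  -- A pointwise bound of G by |g| gives no Sobolev bound for G. The product is therefore compared
  -- with the scalar products g_c f, to which the estimate H^s · H^{p-s} ⊆ L² applies. This serves
  -- A₀(U) - A₀(Ũ), since Ũ is only bounded in H^p while the composition estimates ask for H^{p+1}.
  have hD : ∀ c, BddField (fun x => Matrix.diagonal fun _ : Fin N => g x c) := by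
    intro c
    refine ⟨fun i j => ?_, ?_⟩
    · by_cases hij : i = j
      · subst hij
        simpa using (memLp_apply g c).aestronglyMeasurable
      · simpa [hij] using aestronglyMeasurable_const
    · refine ⟨supBd d N p (sobolevNorm p g).toReal, ?_⟩
      filter_upwards [norm_le_supBd hp ENNReal.toReal_nonneg (ENNReal.ofReal_toReal hgp.ne).ge]
        with x hx i j
      refine le_trans ?_ hx
      by_cases hij : i = j
      · subst hij
        simpa using PiLp.norm_apply_le (g x) c
      · simp [hij]
  have hmc : ∀ c n, mc (fun x => Matrix.diagonal fun _ : Fin N => g x c) n ≤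
      (N * N : ℝ≥0∞) * ec g n := by
    intro c n
    have : ∀ i j : Fin N, ‖fc (fun x => (Matrix.diagonal fun _ : Fin N => g x c) i j) n‖ₑ ≤
        ec g n := by
      intro i j
      by_cases hij : i = j
      · subst hij
        simpa using! enorm_coeff_le g n c
      · simp only [Matrix.diagonal_apply, if_neg hij]
        simp [fc, mFourierCoeff_eq]
    calc _ ≤ ∑ _i : Fin N, ∑ _j : Fin N, ec g n :=
          Finset.sum_le_sum fun i _ => Finset.sum_le_sum fun j _ => this i j
      _ = _ := by simp [mul_assoc]
  have hN : ∀ c, ‖mulOp (fun x => Matrix.diagonal fun _ : Fin N => g x c) f‖ ≤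
      2 * (embConst d p).toReal * (N * N * a) * b := by
    intro c
    rw [← ENNReal.ofReal_le_ofReal_iff (by positivity), ofReal_norm,
      ENNReal.ofReal_mul (p := 2 * (embConst d p).toReal * (N * N * a)) (by positivity),
      ENNReal.ofReal_mul (p := 2 * (embConst d p).toReal) (by positivity),
      ENNReal.ofReal_mul (p := 2) (by positivity),
      ENNReal.ofReal_mul (p := (N * N : ℝ)) (by positivity),
      ENNReal.ofReal_mul (p := (N : ℝ)) (by positivity),
      ENNReal.ofReal_toReal (embConst_lt_top hp).ne, ENNReal.ofReal_ofNat,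
      ENNReal.ofReal_natCast]
    refine (enorm_mulOp_le hp (Nat.add_sub_cancel' hs) (hD c) ?_ f).trans ?_
    · refine ne_top_of_le_ne_top ?_ (hs_mono (hmc c))
      rw [hs_const_mul, ← sobolevNorm_eq_hs]
      exact ENNReal.mul_ne_top (ENNReal.mul_ne_top (by simp) (by simp)) hgp.ne
    · gcongr
      · refine (hs_mono (hmc c)).trans ?_
        rw [hs_const_mul, ← sobolevNorm_eq_hs]
        gcongr
        exact hg
      · exact hf
  have hpt : ∀ᵐ x ∂(torusMeasure d), ‖mulOp G f x‖ ≤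
      Λ * ‖∑ c, ‖mulOp (fun x => Matrix.diagonal fun _ : Fin N => g x c) f x‖‖ := by
    filter_upwards [hG, mulOp_ae h f, ae_all_iff.2 fun c => mulOp_ae (hD c) f] with x h1 h2 h3
    have h4 : ∀ c, ‖mulOp (fun x => Matrix.diagonal fun _ : Fin N => g x c) f x‖ =
        |g x c| * ‖f x‖ := by
      intro c
      have : mulOp (fun x => Matrix.diagonal fun _ : Fin N => g x c) f x = g x c • f x := by
        refine WithLp.ofLp_injective 2 ?_
        rw [h3 c]
        ext j
        simp [Matrix.mulVec_diagonal]
      rw [this, norm_smul, Real.norm_eq_abs]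
    have h5 : ‖mulOp G f x‖ ≤ (∑ i, ∑ j, |G x i j|) * ‖f x‖ := by
      have := norm_toLp_mulVec_le (G x) (f x)
      rwa [← h2] at this
    have h6 : ‖g x‖ ≤ ∑ c, |g x c| := by
      have := enorm_toLp_le_sum (g x)
      simp only [← ofReal_norm] at this
      rw [← ENNReal.ofReal_sum_of_nonneg (fun _ _ => norm_nonneg _),
        ENNReal.ofReal_le_ofReal_iff (by positivity)] at this
      exact this
    simp only [h4]
    rw [Real.norm_of_nonneg (by positivity), ← Finset.sum_mul]
    calc _ ≤ _ := h5
      _ ≤ (Λ * ∑ c, |g x c|) * ‖f x‖ := by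
        gcongr
        exact h1.trans (by gcongr)
      _ = _ := by ring
  have h7 : ‖mulOp G f‖ₑ ≤ ENNReal.ofReal Λ *
      ∑ c, ‖mulOp (fun x => Matrix.diagonal fun _ : Fin N => g x c) f‖ₑ := by
    rw [Lp.enorm_def]
    refine (eLpNorm_le_mul_eLpNorm_of_ae_le_mul hpt 2).trans ?_
    gcongr
    have := eLpNorm_sum_le (μ := torusMeasure d) (p := 2) (s := Finset.univ)
      (f := fun c x => ‖mulOp (fun x => Matrix.diagonal fun _ : Fin N => g x c) f x‖)
      (fun c _ => (Lp.aestronglyMeasurable _).norm) one_le_two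
    simp only [eLpNorm_norm, ← Lp.enorm_def] at this
    refine le_trans (le_of_eq ?_) this
    congr 1
    funext x
    simp
  rw [← ENNReal.ofReal_le_ofReal_iff (by positivity), ofReal_norm, ENNReal.ofReal_mul hΛ]
  refine h7.trans ?_
  gcongr
  calc ∑ c, ‖mulOp (fun x => Matrix.diagonal fun _ : Fin N => g x c) f‖ₑ
      ≤ ∑ _c : Fin N, ENNReal.ofReal (2 * (embConst d p).toReal * (N * N * a) * b) :=
        Finset.sum_le_sum fun c _ => by
          rw [← ofReal_norm]; exact ENNReal.ofReal_le_ofReal (hN c)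
    _ = _ := by
      rw [ENNReal.ofReal_mul (p := (N : ℝ)) (by positivity)]
      simp

end Bounds

/-! ### Uniform bounds for the coefficients of the system -/

section Coefficients

variable {d N : ℕ}

/-- The structural assumptions on the coefficients of the symmetric hyperbolic system. -/
structure SymCoeffs (A₀ : EuclideanSpace ℝ (Fin N) → Matrix (Fin N) (Fin N) ℝ)
    (A : Fin d → EuclideanSpace ℝ (Fin N) → Matrix (Fin N) (Fin N) ℝ) : Prop where
  smooth₀ : ∀ a b, ContDiff ℝ ∞ fun y => A₀ y a b
  smooth : ∀ i a b, ContDiff ℝ ∞ fun y => A i y a b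
  symm₀ : ∀ y, (A₀ y).IsSymm
  symm : ∀ i y, (A i y).IsSymm
  pos : ∀ y, (A₀ y).PosDef

variable {A₀ : EuclideanSpace ℝ (Fin N) → Matrix (Fin N) (Fin N) ℝ}
  {A : Fin d → EuclideanSpace ℝ (Fin N) → Matrix (Fin N) (Fin N) ℝ} {p : ℕ}

lemma SymCoeffs.exists_fieldLE (hA : SymCoeffs A₀ A) (hp : d < 2 * p) {K : ℝ} (hK : 0 ≤ K) :
    ∃ B : ℝ, 0 ≤ B ∧ ∀ u : L2 d N, SobLE (p + 1) u K →
      FieldLE (p + 1) (fun x => A₀ (u x)) B ∧ ∀ i, FieldLE (p + 1) (fun x => A i (u x)) B := by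
  obtain ⟨B₀, hB₀, h₀⟩ := exists_mc_comp_le hp hK hA.smooth₀
  choose B hB h using fun i => exists_mc_comp_le hp hK (hA.smooth i)
  refine ⟨B₀ + ∑ i, B i, add_nonneg hB₀ (Finset.sum_nonneg fun i _ => hB i), fun u hu => ⟨?_, ?_⟩⟩
  · exact (h₀ u hu).trans (ENNReal.ofReal_le_ofReal
      (le_add_of_nonneg_right (Finset.sum_nonneg fun i _ => hB i)))
  · intro i
    refine (h i u hu).trans (ENNReal.ofReal_le_ofReal ?_)
    have := Finset.single_le_sum (fun i _ => hB i) (Finset.mem_univ i)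
    linarith

lemma SymCoeffs.exists_fieldLE_sub (hA : SymCoeffs A₀ A) (hp : d < 2 * p) {K : ℝ} (hK : 0 ≤ K)
    {σ : ℕ} (hσ : σ ≤ p) :
    ∃ D : ℝ, 0 ≤ D ∧ ∀ (u u' : L2 d N) (b : ℝ), SobLE (p + 1) u K → SobLE (p + 1) u' K →
      SobLE σ (u - u') b →
      FieldLE σ (fun x => A₀ (u x) - A₀ (u' x)) (D * b) ∧
        ∀ i, FieldLE σ (fun x => A i (u x) - A i (u' x)) (D * b) := by
  obtain ⟨D₀, hD₀, h₀⟩ := exists_mc_sub_le hp hK hA.smooth₀ hσ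
  choose D hD h using fun i => exists_mc_sub_le hp hK (hA.smooth i) hσ
  have hpos : 0 ≤ D₀ + ∑ i, D i := add_nonneg hD₀ (Finset.sum_nonneg fun i _ => hD i)
  refine ⟨D₀ + ∑ i, D i, hpos, fun u u' b hu hu' hb => ⟨?_, ?_⟩⟩
  · unfold FieldLE
    rw [ENNReal.ofReal_mul hpos]
    refine (h₀ u u' hu hu').trans ?_
    gcongr
    · exact le_add_of_nonneg_right (Finset.sum_nonneg fun i _ => hD i)
    · exact hb
  · intro i
    unfold FieldLE
    rw [ENNReal.ofReal_mul hpos]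
    refine (h i u u' hu hu').trans ?_
    gcongr
    · have := Finset.single_le_sum (fun i _ => hD i) (Finset.mem_univ i)
      linarith
    · exact hb

lemma SymCoeffs.exists_coercive (hA : SymCoeffs A₀ A) (hp : d < 2 * p) {K : ℝ} (hK : 0 ≤ K) :
    ∃ lam : ℝ, 0 < lam ∧ ∀ u : L2 d N, SobLE p u K →
      ∀ f : L2 d N, lam * ‖f‖ ^ 2 ≤ inner ℝ (mulOp (fun x => A₀ (u x)) f) f := by
  obtain ⟨lam, hl, h⟩ := exists_coercive_on_ball hA.smooth₀ hA.pos (supBd d N p K)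
  refine ⟨lam, hl, fun u hu f => ?_⟩
  refine le_inner_mulOp (bddField_comp hp hA.smooth₀ hu.lt_top) ?_ f
  filter_upwards [norm_le_supBd hp hK hu] with x hx
  exact h _ hx

/-! ### The regular part of the right hand side. -/

open Classical in
/-- The weak derivative in the direction `i`, if it exists. -/
def wd (i : Fin d) (f : L2 d N) : L2 d N := if h : ∃ g, IsWeakDeriv i f g then h.choose else 0

lemma isWeakDeriv_wd (i : Fin d) {f : L2 d N} (hf : sobolevNorm 1 f < ⊤) :
    IsWeakDeriv i f (wd i f) := by
  have h := exists_isWeakDeriv i hf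
  rw [wd, dif_pos h]
  exact h.choose_spec

lemma SobLE.isWeakDeriv_wd {s : ℕ} {f : L2 d N} {a : ℝ} (h : SobLE (s + 1) f a) (i : Fin d) :
    IsWeakDeriv i f (wd i f) := SymHyp.isWeakDeriv_wd i (h.mono_exp (by lia)).lt_top

/-- The regular part `F - ∑ A_i(u) ∂_i u` of the right hand side. -/
def regRhs (A : Fin d → EuclideanSpace ℝ (Fin N) → Matrix (Fin N) (Fin N) ℝ) (F u : L2 d N) :
    L2 d N :=
  F - ∑ i, mulOp (fun x => A i (u x)) (wd i u)

lemma SymCoeffs.exists_regRhs_le (hA : SymCoeffs A₀ A) (hp : d < 2 * p) {K : ℝ} (hK : 0 ≤ K) :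
    ∃ C : ℝ, 0 ≤ C ∧ ∀ F u : L2 d N, SobLE p F K → SobLE (p + 1) u K →
      SobLE p (regRhs A F u) C := by
  obtain ⟨B, hB, h⟩ := hA.exists_fieldLE hp hK
  have := prodR_nonneg d p
  refine ⟨K + d * (prodR d p * B * (2 * Real.pi * K)), by positivity, fun F u hF hu => ?_⟩
  refine hF.sub (SobLE.sum fun i => ?_) hK (by positivity)
  exact (((h u hu).2 i).mono_exp p.le_succ).mulOp (hu.weakDeriv (hu.isWeakDeriv_wd i)) hp le_rfl
    (bddField_comp hp (hA.smooth i) (hu.mono_exp p.le_succ).lt_top) hB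

/-- Finiteness alone, as required by `FieldLE.mulOp'`; the crude bound K + K for the difference
suffices. -/
lemma SymCoeffs.hs_mc_sub_ne_top (hA : SymCoeffs A₀ A) (hp : d < 2 * p) {K : ℝ} (hK : 0 ≤ K)
    {u u' : L2 d N} (hu : SobLE (p + 1) u K) (hu' : SobLE (p + 1) u' K) :
    hs p (mc fun x => A₀ (u x) - A₀ (u' x)) ≠ ⊤ ∧
      ∀ i, hs p (mc fun x => A i (u x) - A i (u' x)) ≠ ⊤ := by
  obtain ⟨D, hD, h⟩ := hA.exists_fieldLE_sub hp hK le_rfl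
  have h1 := h u u' (K + K) hu hu' ((hu.sub hu' hK hK).mono_exp p.le_succ)
  exact ⟨h1.1.ne_top, fun i => (h1.2 i).ne_top⟩

/-- Lipschitz dependence of `∑ A_i(u) ∂_i v` on `u`. -/
lemma SymCoeffs.exists_sum_sub_le (hA : SymCoeffs A₀ A) (hp : d < 2 * p) {K : ℝ} (hK : 0 ≤ K)
    {σ : ℕ} (hσ : σ ≤ p) :
    ∃ C : ℝ, 0 ≤ C ∧ ∀ (u u' : L2 d N) (b : ℝ), SobLE (p + 1) u K → SobLE (p + 1) u' K →
      0 ≤ b → SobLE σ (u - u') b →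
      SobLE σ (∑ i, mulOp (fun x => A i (u x) - A i (u' x)) (wd i u)) (C * b) := by
  obtain ⟨D, hD, h⟩ := hA.exists_fieldLE_sub hp hK hσ
  have := prodR_nonneg d p
  refine ⟨d * (prodR d p * D * (2 * Real.pi * K)), by positivity, fun u u' b hu hu' hb hub => ?_⟩
  refine (SobLE.sum fun i => ((h u u' b hu hu' hub).2 i).mulOp' (hu.weakDeriv
    (hu.isWeakDeriv_wd i)) hp hσ ?_ ((hA.hs_mc_sub_ne_top hp hK hu hu').2 i)
    (by positivity)).mono (le_of_eq (by ring))
  exact (bddField_comp hp (hA.smooth i) (hu.mono_exp p.le_succ).lt_top).sub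
    (bddField_comp hp (hA.smooth i) (hu'.mono_exp p.le_succ).lt_top)

/-- Continuous dependence of the regular part of the right hand side in `L²`. -/
lemma SymCoeffs.exists_regRhs_sub_le (hA : SymCoeffs A₀ A) (hp : d < 2 * p) {K : ℝ}
    (hK : 0 ≤ K) :
    ∃ C : ℝ, 0 ≤ C ∧ ∀ (F F' u u' : L2 d N) (b : ℝ), SobLE (p + 1) u K → SobLE (p + 1) u' K →
      0 ≤ b → SobLE 0 (F - F') b → SobLE (p + 1) (u - u') b →
      SobLE 0 (regRhs A F u - regRhs A F' u') (C * b) := by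
  obtain ⟨B, hB, h⟩ := hA.exists_fieldLE hp hK
  obtain ⟨C, hC, hC'⟩ := hA.exists_sum_sub_le hp hK (Nat.zero_le p)
  have := prodR_nonneg d p
  refine ⟨1 + (C + d * (prodR d p * B * (2 * Real.pi))), by positivity,
    fun F F' u u' b hu hu' hb hF hub => ?_⟩
  have hbu : ∀ {u : L2 d N}, SobLE (p + 1) u K → ∀ i, BddField fun x => A i (u x) := fun hu i =>
    bddField_comp hp (hA.smooth i) (hu.mono_exp p.le_succ).lt_top
  have h1 := hC' u u' b hu hu' hb (hub.mono_exp (Nat.zero_le _))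
  have h2 : ∀ i, SobLE 0 (mulOp (fun x => A i (u' x)) (wd i u - wd i u'))
      (prodR d p * B * (2 * Real.pi * b)) := fun i =>
    (((h u' hu').2 i).mono_exp p.le_succ).mulOp ((hub.weakDeriv
      ((hu.isWeakDeriv_wd i).sub (hu'.isWeakDeriv_wd i))).mono_exp (Nat.zero_le _)) hp
      (Nat.zero_le _) (hbu hu' i) hB
  have h3 : regRhs A F u - regRhs A F' u' = (F - F') -
      (∑ i, mulOp (fun x => A i (u x) - A i (u' x)) (wd i u) +
        ∑ i, mulOp (fun x => A i (u' x)) (wd i u - wd i u')) := by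
    simp only [regRhs, fun i => mulOp_sub (hbu hu i) (hbu hu' i), map_sub,
      Finset.sum_sub_distrib]
    abel
  rw [h3]
  refine (hF.sub (h1.add (SobLE.sum h2) (by positivity) (by positivity)) hb
    (by positivity)).mono (le_of_eq (by ring))

end Coefficients

/-! ### The energy estimate at a fixed time -/

section Slice

variable {d N m : ℕ} {A₀ : EuclideanSpace ℝ (Fin N) → Matrix (Fin N) (Fin N) ℝ}
  {A : Fin d → EuclideanSpace ℝ (Fin N) → Matrix (Fin N) (Fin N) ℝ}
  {L : FirstOrderOp d N m} {p s : ℕ} {K K' M : ℝ}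

/-- Splitting off the contribution of the error `ξ` from a solution of the elliptic problem. -/
lemma SymCoeffs.exists_split_le (hA : SymCoeffs A₀ A) (hp : d < 2 * p) (hK : 0 ≤ K) (hs : s ≤ p)
    (L : FirstOrderOp d N m) :
    ∃ C : ℝ, 0 ≤ C ∧ ∀ (F u ξ y y₁ : L2 d N) (ε : ℝ), SobLE p F K → SobLE (p + 1) u K → 0 ≤ ε →
      SobLE s ξ ε → IsProjSol L (fun x => A₀ (u x)) (regRhs A F u + ξ) y →
      IsProjSol L (fun x => A₀ (u x)) (regRhs A F u) y₁ →
      SobLE p y₁ C ∧ SobLE s (y - y₁) (C * ε) := by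
  obtain ⟨B, hB, hBu⟩ := hA.exists_fieldLE hp hK
  obtain ⟨lam, hl, hco⟩ := hA.exists_coercive hp hK
  obtain ⟨Cg, hCg, hg⟩ := hA.exists_regRhs_le hp hK
  obtain ⟨C₁, hC₁, h₁⟩ := exists_elliptic_bound hp hl hB L p p.le_succ
  obtain ⟨C₂, hC₂, h₂⟩ := exists_elliptic_bound hp hl hB L s (by lia)
  refine ⟨C₁ * Cg + C₂, by positivity, fun F u ξ y y₁ ε hF hu hε hξ hy hy₁ => ?_⟩
  have hb := bddField_comp hp hA.smooth₀ (hu.mono_exp p.le_succ).lt_top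
  have hc := hco u (hu.mono_exp p.le_succ)
  constructor
  · exact SobLE.mono (h₁ _ hb (hBu u hu).1 hc _ _ hy₁ Cg hCg (hg F u hF hu))
      (le_add_of_nonneg_right hC₂)
  -- By linearity y - y₁ solves the same problem with source ξ.
  · have hsub := hy.sub hy₁
    rw [add_sub_cancel_left] at hsub
    refine SobLE.mono (h₂ _ hb (hBu u hu).1 hc _ _ hsub ε hε hξ) ?_
    gcongr
    exact le_add_of_nonneg_left (by positivity)

/-- The situation at a fixed time: two solutions `u`, `U` with modified time derivatives `yu`, `yU`
that split as `y₁ + O(δ)` with `y₁` bounded in `H^p`, and an approximation `Ũ` of `U`. -/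
structure SliceData (A₀ : EuclideanSpace ℝ (Fin N) → Matrix (Fin N) (Fin N) ℝ)
    (A : Fin d → EuclideanSpace ℝ (Fin N) → Matrix (Fin N) (Fin N) ℝ)
    (L : FirstOrderOp d N m) (p s : ℕ) (K K' M δ ν : ℝ)
    (F u U Ũ ξu ξU Θ yu yU y₁u y₁U : L2 d N) : Prop where
  δ_nonneg : 0 ≤ δ
  ν_nonneg : 0 ≤ ν
  u_le : SobLE (p + 1) u K
  U_le : SobLE (p + 1) U K
  Ũ_le : SobLE p Ũ K'
  sub_Ũ_le : SobLE s (U - Ũ) (M * δ)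
  ξu_le : SobLE s ξu (M * δ)
  ξU_le : SobLE s ξU (M * δ)
  Θ_le : SobLE (s + 1) Θ (M * δ)
  y₁u_le : SobLE p y₁u M
  y₁U_le : SobLE p y₁U M
  sub_y₁u_le : SobLE s (yu - y₁u) (M * δ)
  sub_y₁U_le : SobLE s (yU - y₁U) (M * δ)
  solu : IsProjSol L (fun x => A₀ (u x)) (regRhs A F u + ξu) yu
  solU : IsProjSol L (fun x => A₀ (U x)) (regRhs A F U + ξU) yU
  mem : u - U - Θ ∈ L.ker
  z_le : SobLE s (u - U - Θ) ν

/-- The remainder in the equation for `z = u - U - Θ`. -/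
def sliceRem (A₀ : EuclideanSpace ℝ (Fin N) → Matrix (Fin N) (Fin N) ℝ)
    (A : Fin d → EuclideanSpace ℝ (Fin N) → Matrix (Fin N) (Fin N) ℝ)
    (u U ξu ξU Θ yu : L2 d N) : L2 d N :=
  (ξu - ξU) - (mulOp (fun x => A₀ (u x) - A₀ (U x)) yu +
    (∑ i, mulOp (fun x => A i (u x) - A i (U x)) (wd i u) +
      ∑ i, mulOp (fun x => A i (U x)) (wd i Θ)))

variable {δ ν : ℝ} {F u U Ũ ξu ξU Θ yu yU y₁u y₁U : L2 d N}

namespace SliceData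

lemma bdd₀ (h : SliceData A₀ A L p s K K' M δ ν F u U Ũ ξu ξU Θ yu yU y₁u y₁U)
    (hA : SymCoeffs A₀ A) (hp : d < 2 * p) :
    BddField (fun x => A₀ (u x)) ∧ BddField (fun x => A₀ (U x)) ∧ BddField (fun x => A₀ (Ũ x)) :=
  ⟨bddField_comp hp hA.smooth₀ (h.u_le.mono_exp p.le_succ).lt_top,
    bddField_comp hp hA.smooth₀ (h.U_le.mono_exp p.le_succ).lt_top,
    bddField_comp hp hA.smooth₀ h.Ũ_le.lt_top⟩

lemma bdd (h : SliceData A₀ A L p s K K' M δ ν F u U Ũ ξu ξU Θ yu yU y₁u y₁U)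
    (hA : SymCoeffs A₀ A) (hp : d < 2 * p) (i : Fin d) :
    BddField (fun x => A i (u x)) ∧ BddField (fun x => A i (U x)) :=
  ⟨bddField_comp hp (hA.smooth i) (h.u_le.mono_exp p.le_succ).lt_top,
    bddField_comp hp (hA.smooth i) (h.U_le.mono_exp p.le_succ).lt_top⟩

lemma isWeakDeriv_z (h : SliceData A₀ A L p s K K' M δ ν F u U Ũ ξu ξU Θ yu yU y₁u y₁U)
    (i : Fin d) : IsWeakDeriv i (u - U - Θ) (wd i u - wd i U - wd i Θ) :=
  ((h.u_le.isWeakDeriv_wd i).sub (h.U_le.isWeakDeriv_wd i)).sub (h.Θ_le.isWeakDeriv_wd i)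

/-- Purely qualitative: it justifies the integration by parts in the energy estimate, and its size
enters no constant. -/
lemma z_lt_top (h : SliceData A₀ A L p s K K' M δ ν F u U Ũ ξu ξU Θ yu yU y₁u y₁U)
    (hs : s ≤ p) : sobolevNorm (s + 1) (u - U - Θ) < ⊤ := by
  refine (sobolevNorm_sub_le _ _ _).trans_lt (ENNReal.add_lt_top.2 ⟨?_, h.Θ_le.lt_top⟩)
  exact (sobolevNorm_sub_le _ _ _).trans_lt (ENNReal.add_lt_top.2
    ⟨(h.u_le.mono_exp (by lia)).lt_top, (h.U_le.mono_exp (by lia)).lt_top⟩)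

/-- The equation for `z = u - U - Θ`. -/
lemma isProjSol (h : SliceData A₀ A L p s K K' M δ ν F u U Ũ ξu ξU Θ yu yU y₁u y₁U)
    (hA : SymCoeffs A₀ A) (hp : d < 2 * p) :
    IsProjSol L (fun x => A₀ (U x)) (sliceRem A₀ A u U ξu ξU Θ yu -
      ∑ i, mulOp (fun x => A i (U x)) (wd i u - wd i U - wd i Θ)) (yu - yU) where
  mem := L.ker.sub_mem h.solu.mem h.solU.mem
  orth := fun φ hφ => by
    have h1 := h.solu.orth φ hφ
    have h2 := h.solU.orth φ hφ
    have e : mulOp (fun x => A₀ (U x)) (yu - yU) - (sliceRem A₀ A u U ξu ξU Θ yu -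
        ∑ i, mulOp (fun x => A i (U x)) (wd i u - wd i U - wd i Θ)) =
        (mulOp (fun x => A₀ (u x)) yu - (regRhs A F u + ξu)) -
          (mulOp (fun x => A₀ (U x)) yU - (regRhs A F U + ξU)) := by
      simp only [sliceRem, regRhs, mulOp_sub (h.bdd₀ hA hp).1 (h.bdd₀ hA hp).2.1,
        fun i => mulOp_sub (h.bdd hA hp i).1 (h.bdd hA hp i).2, map_sub,
        Finset.sum_sub_distrib]
      abel
    rw [e, inner_sub_left, h1, h2, sub_zero]

end SliceData

/-- The remainder is `O(ν + δ)` in `H^s`. -/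
lemma SymCoeffs.exists_sliceRem_le (hA : SymCoeffs A₀ A) (hp : d < 2 * p) (hK : 0 ≤ K)
    (hM : 0 ≤ M) (hs : s ≤ p) :
    ∃ C : ℝ, 0 ≤ C ∧ ∀ {m : ℕ} {L : FirstOrderOp d N m} {K' δ ν : ℝ}
      {F u U Ũ ξu ξU Θ yu yU y₁u y₁U : L2 d N},
      SliceData A₀ A L p s K K' M δ ν F u U Ũ ξu ξU Θ yu yU y₁u y₁U →
      SobLE s (sliceRem A₀ A u U ξu ξU Θ yu) (C * (ν + δ)) := by
  obtain ⟨B, hB, hBu⟩ := hA.exists_fieldLE hp hK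
  obtain ⟨D, hD, hDs⟩ := hA.exists_fieldLE_sub hp hK hs
  obtain ⟨Dp, hDp, hDps⟩ := hA.exists_fieldLE_sub hp hK le_rfl
  obtain ⟨E, hE, hEs⟩ := hA.exists_sum_sub_le hp hK hs
  have hP := prodR_nonneg d p
  refine ⟨(M + M) + ((prodR d p * (D * (1 + M)) * M + prodR d p * (Dp * (K + K)) * M) +
    (E * (1 + M) + d * (prodR d p * B * (2 * Real.pi * M)))), by positivity, ?_⟩
  intro m L K' δ ν F u U Ũ ξu ξU Θ yu yU y₁u y₁U h
  have hδ := h.δ_nonneg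
  have hν := h.ν_nonneg
  have hδb : δ ≤ ν + δ := by linarith
  have hb : 0 ≤ ν + δ := by positivity
  have hw : SobLE s (u - U) ((1 + M) * (ν + δ)) := by
    have := h.z_le.add (h.Θ_le.mono_exp s.le_succ) hν (by positivity)
    rw [sub_add_cancel] at this
    refine this.mono ?_
    nlinarith
  have hbd := (h.bdd₀ hA hp).1.sub (h.bdd₀ hA hp).2.1
  have h1 : SobLE s (ξu - ξU) ((M + M) * (ν + δ)) := by
    refine (h.ξu_le.sub h.ξU_le (by positivity) (by positivity)).mono ?_
    nlinarith
  -- The product with y_u is split. Against y₁, bounded in H^p, the matrix difference is needed in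
  -- H^s, where it is O(ν + δ); against y_u - y₁, which is O(δ) in H^s, a bound of the matrix
  -- difference in H^p is enough.
  have h2 : SobLE s (mulOp (fun x => A₀ (u x) - A₀ (U x)) y₁u)
      (prodR d p * (D * (1 + M)) * M * (ν + δ)) :=
    ((hDs u U _ h.u_le h.U_le hw).1.mulOp' h.y₁u_le hp hs hbd
      (hA.hs_mc_sub_ne_top hp hK h.u_le h.U_le).1 (by positivity)).mono (le_of_eq (by ring))
  have h3 : SobLE s (mulOp (fun x => A₀ (u x) - A₀ (U x)) (yu - y₁u))
      (prodR d p * (Dp * (K + K)) * M * (ν + δ)) := by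
    refine ((hDps u U _ h.u_le h.U_le ((h.u_le.sub h.U_le hK hK).mono_exp p.le_succ)).1.mulOp
      h.sub_y₁u_le hp hs hbd (by positivity)).mono ?_
    rw [mul_assoc _ M]
    gcongr
  have h23 : SobLE s (mulOp (fun x => A₀ (u x) - A₀ (U x)) yu)
      ((prodR d p * (D * (1 + M)) * M + prodR d p * (Dp * (K + K)) * M) * (ν + δ)) := by
    have := h2.add h3 (by positivity) (by positivity)
    rw [← map_add, add_sub_cancel] at this
    exact this.mono (le_of_eq (by ring))
  have h4 : SobLE s (∑ i, mulOp (fun x => A i (u x) - A i (U x)) (wd i u))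
      (E * (1 + M) * (ν + δ)) :=
    (hEs u U _ h.u_le h.U_le (by positivity) hw).mono (le_of_eq (by ring))
  -- This term calls for Θ in H^{s+1}, one derivative more than ξ.
  have h5 : SobLE s (∑ i, mulOp (fun x => A i (U x)) (wd i Θ))
      (d * (prodR d p * B * (2 * Real.pi * M)) * (ν + δ)) := by
    refine (SobLE.sum fun i => ((((hBu U h.U_le).2 i).mono_exp p.le_succ).mulOp
      (h.Θ_le.weakDeriv (h.Θ_le.isWeakDeriv_wd i)) hp hs (h.bdd hA hp i).2 hB)).mono ?_
    calc (d : ℝ) * (prodR d p * B * (2 * Real.pi * (M * δ)))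
        = d * (prodR d p * B * (2 * Real.pi * M)) * δ := by ring
      _ ≤ _ := by gcongr
  exact (h1.sub (h23.add (h4.add h5 (by positivity) (by positivity)) (by positivity)
    (by positivity)) (by positivity) (by positivity)).mono (le_of_eq (by ring))

/-- The modified time derivative of `z` is `O(ν + δ)` in `H^{s-1}`. -/
lemma SymCoeffs.exists_sub_deriv_le (hA : SymCoeffs A₀ A) (hp : d < 2 * p) (hK : 0 ≤ K)
    (hM : 0 ≤ M) (L : FirstOrderOp d N m) {σ : ℕ} (hσ : σ + 1 ≤ p) :
    ∃ C : ℝ, 0 ≤ C ∧ ∀ {K' δ ν : ℝ} {F u U Ũ ξu ξU Θ yu yU y₁u y₁U : L2 d N},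
      SliceData A₀ A L p (σ + 1) K K' M δ ν F u U Ũ ξu ξU Θ yu yU y₁u y₁U →
      SobLE σ (yu - yU) (C * (ν + δ)) := by
  obtain ⟨B, hB, hBu⟩ := hA.exists_fieldLE hp hK
  obtain ⟨lam, hl, hco⟩ := hA.exists_coercive hp hK
  obtain ⟨C₁, hC₁, h₁⟩ := hA.exists_sliceRem_le hp hK hM hσ
  obtain ⟨C₂, hC₂, h₂⟩ := exists_elliptic_bound hp hl hB L σ (by lia)
  have hP := prodR_nonneg d p
  refine ⟨C₂ * (C₁ + d * (prodR d p * B * (2 * Real.pi))), by positivity, ?_⟩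
  intro K' δ ν F u U Ũ ξu ξU Θ yu yU y₁u y₁U h
  have hδ := h.δ_nonneg
  have hν := h.ν_nonneg
  have h3 : SobLE σ (∑ i, mulOp (fun x => A i (U x)) (wd i u - wd i U - wd i Θ))
      (d * (prodR d p * B * (2 * Real.pi * ν))) :=
    SobLE.sum fun i => (((hBu U h.U_le).2 i).mono_exp p.le_succ).mulOp
      (h.z_le.weakDeriv (h.isWeakDeriv_z i)) hp (by lia) (h.bdd hA hp i).2 hB
  have h4 := ((h₁ h).mono_exp σ.le_succ).sub h3 (by positivity) (by positivity)
  refine SobLE.mono (h₂ _ (h.bdd₀ hA hp).2.1 (hBu U h.U_le).1 (hco U (h.U_le.mono_exp p.le_succ))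
    _ _ (h.isProjSol hA hp) _ (by positivity) h4) ?_
  rw [mul_assoc C₂, add_mul]
  refine mul_le_mul_of_nonneg_left (add_le_add le_rfl ?_) hC₂
  calc (d : ℝ) * (prodR d p * B * (2 * Real.pi * ν))
      = d * (prodR d p * B * (2 * Real.pi)) * ν := by ring
    _ ≤ _ := by gcongr; linarith

/-- Replacing `A₀(U)` by `A₀(Ũ)` costs `O(δ)`. -/
lemma SymCoeffs.exists_norm_mulOp_sub_le (hA : SymCoeffs A₀ A) (hp : d < 2 * p) (hK : 0 ≤ K)
    (hK' : 0 ≤ K') (hM : 0 ≤ M) (hs : s ≤ p) :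
    ∃ C : ℝ, 0 ≤ C ∧ ∀ {m : ℕ} {L : FirstOrderOp d N m} {δ ν : ℝ}
      {F u U Ũ ξu ξU Θ yu yU y₁u y₁U : L2 d N},
      SliceData A₀ A L p s K K' M δ ν F u U Ũ ξu ξU Θ yu yU y₁u y₁U → ∀ R : ℕ,
      ‖mulOp (fun x => A₀ (U x) - A₀ (Ũ x)) (jop s R (yu - yU))‖ ≤ C * δ := by
  set ρ := max (supBd d N p K) (supBd d N p K') with hρ
  obtain ⟨Λ, hΛ, hlip⟩ := exists_matrix_lipschitz hA.smooth₀ ρ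
  have hρ0 : 0 ≤ ρ := le_trans (by unfold supBd; positivity) (le_max_left _ _)
  refine ⟨Λ * (N * (2 * (embConst d p).toReal * (N * N * M) * (M + M))) +
    Λ * (ρ + ρ) * (M + M), by positivity, ?_⟩
  intro m L δ ν F u U Ũ ξu ξU Θ yu yU y₁u y₁U h R
  have hδ := h.δ_nonneg
  have hbd := (h.bdd₀ hA hp).2.1.sub (h.bdd₀ hA hp).2.2
  have hU : ∀ᵐ x ∂(torusMeasure d), ‖U x‖ ≤ ρ :=
    (norm_le_supBd hp hK (h.U_le.mono_exp p.le_succ)).mono fun x hx => hx.trans (le_max_left _ _)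
  have hŨ : ∀ᵐ x ∂(torusMeasure d), ‖Ũ x‖ ≤ ρ :=
    (norm_le_supBd hp hK' h.Ũ_le).mono fun x hx => hx.trans (le_max_right _ _)
  -- The difference of the y₁ is bounded in H^p, so J_s of it lies in H^{p-s} and pairs with U - Ũ =
  -- O(δ) in H^s. The rest is O(δ) in H^s, and there the sup norm bound of the matrix difference
  -- suffices.
  have hsplit : yu - yU = (y₁u - y₁U) + ((yu - y₁u) - (yU - y₁U)) := by abel
  rw [hsplit, map_add, map_add]
  refine (norm_add_le _ _).trans ?_
  rw [add_mul]
  refine add_le_add ?_ ?_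
  · have h1 : SobLE (p - s) (jop s R (y₁u - y₁U)) (M + M) := by
      refine (sobolevNorm_jop_le _ _ _ _).trans ?_
      rw [Nat.sub_add_cancel hs]
      exact h.y₁u_le.sub h.y₁U_le hM hM
    refine (norm_mulOp_le_of_pointwise hp hs hbd hΛ (g := U - Ũ) ?_ ?_ h.sub_Ũ_le h1
      (by positivity) (by positivity)).trans (le_of_eq (by ring))
    · filter_upwards [hU, hŨ, Lp.coeFn_sub U Ũ] with x h1 h2 h3
      rw [h3]
      exact hlip _ _ h1 h2
    · exact (sobolevNorm_sub_le _ _ _).trans_lt (ENNReal.add_lt_top.2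
        ⟨(h.U_le.mono_exp p.le_succ).lt_top, h.Ũ_le.lt_top⟩)
  · have h1 : ‖jop s R ((yu - y₁u) - (yU - y₁U))‖ ≤ M * δ + M * δ :=
      (h.sub_y₁u_le.sub h.sub_y₁U_le (by positivity) (by positivity)).norm_jop_le
        (by positivity) R
    refine (norm_mulOp_le hbd (C := Λ * (ρ + ρ)) ?_ _).trans ?_
    · filter_upwards [hU, hŨ] with x h1 h2
      refine (hlip _ _ h1 h2).trans ?_
      gcongr
      exact (norm_sub_le _ _).trans (add_le_add h1 h2)
    · rw [mul_assoc _ (M + M), add_mul M M δ]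
      gcongr

/-- The energy estimate at a fixed time. -/
theorem SymCoeffs.exists_energy_le (hA : SymCoeffs A₀ A) (hp : d < 2 * p) (hK : 0 ≤ K)
    (hK' : 0 ≤ K') (hM : 0 ≤ M) (hs : s ≤ p) (L : FirstOrderOp d N m) :
    ∃ C : ℝ, 0 ≤ C ∧ ∀ {δ ν : ℝ} {F u U Ũ ξu ξU Θ yu yU y₁u y₁U : L2 d N},
      SliceData A₀ A L p s K K' M δ ν F u U Ũ ξu ξU Θ yu yU y₁u y₁U → ∀ R : ℕ,
      inner ℝ (mulOp (fun x => A₀ (Ũ x)) (jop s R (yu - yU))) (jop s R (u - U - Θ)) ≤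
        C * (ν + δ) ^ 2 := by
  obtain ⟨B, hB, hBu⟩ := hA.exists_fieldLE hp hK
  obtain ⟨C₁, hC₁, h₁⟩ := hA.exists_sliceRem_le hp hK hM hs
  -- The time derivative is needed in H^{s-1}, for the commutator of J_s with A₀(U). For s = 0 the
  -- multiplier is the identity and nothing is needed.
  obtain ⟨C₂, hC₂, h₂⟩ : ∃ C : ℝ, 0 ≤ C ∧ ∀ {δ ν : ℝ} {F u U Ũ ξu ξU Θ yu yU y₁u y₁U : L2 d N},
      SliceData A₀ A L p s K K' M δ ν F u U Ũ ξu ξU Θ yu yU y₁u y₁U →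
      ∀ σ, s = σ + 1 → SobLE σ (yu - yU) (C * (ν + δ)) := by
    cases s with
    | zero => exact ⟨0, le_rfl, fun _ σ hσ => by lia⟩
    | succ σ =>
      obtain ⟨C, hC, h⟩ := hA.exists_sub_deriv_le hp hK hM L hs
      refine ⟨C, hC, fun hd σ' hσ' => ?_⟩
      obtain rfl : σ = σ' := by lia
      exact h hd
  obtain ⟨C₃, hC₃, h₃⟩ := hA.exists_norm_mulOp_sub_le hp hK hK' hM hs
  set cc := (commConst d p).toReal
  have hcc : 0 ≤ cc := ENNReal.toReal_nonneg
  set ee := (embConst d p).toReal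
  have hee : 0 ≤ ee := ENNReal.toReal_nonneg
  refine ⟨C₁ + d * (Real.pi * ee * B + cc * B * (2 * Real.pi)) + cc * B * C₂ + C₃,
    by positivity, ?_⟩
  intro δ ν F u U Ũ ξu ξU Θ yu yU y₁u y₁U h R
  have hδ := h.δ_nonneg
  have hν := h.ν_nonneg
  set z := u - U - Θ with hz
  set J : L2 d N →L[ℝ] L2 d N := jop s R with hJ
  set zx : Fin d → L2 d N := fun i => wd i u - wd i U - wd i Θ with hzx
  set rem := sliceRem A₀ A u U ξu ξU Θ yu with hrem
  have hJz : ‖J z‖ ≤ ν := h.z_le.norm_jop_le hν R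
  have hJz0 := norm_nonneg (J z)
  have hb0 := (h.bdd₀ hA hp).2.1
  -- The equation for z tested with J(Jz) ∈ ker L.
  have e1 : inner ℝ (J (mulOp (fun x => A₀ (U x)) (yu - yU))) (J z) =
      inner ℝ (J rem) (J z) - ∑ i, inner ℝ (J (mulOp (fun x => A i (U x)) (zx i))) (J z) := by
    have := (h.isProjSol hA hp).orth (J (J z))
      (FirstOrderOp.jop_mem_ker (FirstOrderOp.jop_mem_ker h.mem _ _) _ _)
    have hr : inner ℝ (J (rem - ∑ i, mulOp (fun x => A i (U x)) (zx i))) (J z) =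
        inner ℝ (J rem) (J z) - ∑ i, inner ℝ (J (mulOp (fun x => A i (U x)) (zx i))) (J z) := by
      rw [map_sub, map_sum, inner_sub_left, sum_inner]
    rw [← hr, hJ, inner_jop_left s R _ (jop s R z), inner_jop_left s R _ (jop s R z), ← sub_eq_zero,
      ← inner_sub_left]
    exact this
  -- Passing from JA₀(U) to A₀(Ũ)J leaves two errors: the commutator of J with A₀(U), and the
  -- exchange of U for Ũ.
  have e2 : inner ℝ (mulOp (fun x => A₀ (Ũ x)) (J (yu - yU))) (J z) =
      inner ℝ (J (mulOp (fun x => A₀ (U x)) (yu - yU))) (J z) -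
      inner ℝ (J (mulOp (fun x => A₀ (U x)) (yu - yU)) -
        mulOp (fun x => A₀ (U x)) (J (yu - yU))) (J z) -
      inner ℝ (mulOp (fun x => A₀ (U x) - A₀ (Ũ x)) (J (yu - yU))) (J z) := by
    rw [mulOp_sub hb0 (h.bdd₀ hA hp).2.2, inner_sub_left, inner_sub_left]
    ring
  have b1 : |inner ℝ (J rem) (J z)| ≤ C₁ * (ν + δ) * ν :=
    (abs_real_inner_le_norm _ _).trans
      (mul_le_mul ((h₁ h).norm_jop_le (by positivity) R) hJz hJz0 (by positivity))
  -- No derivative is lost: the commutator with A_i(U) sees ∂_i z only in H^{s-1}, and symmetry of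
  -- A_i moves the remaining derivative from Jz onto A_i(U).
  have b2 : ∀ i, |inner ℝ (J (mulOp (fun x => A i (U x)) (zx i))) (J z)| ≤
      (Real.pi * ee * B + cc * B * (2 * Real.pi)) * ν * ν := by
    intro i
    have hbi := (h.bdd hA hp i).2
    have c1 : |inner ℝ (mulOp (fun x => A i (U x)) (J (zx i))) (J z)| ≤
        Real.pi * ee * B * ‖J z‖ ^ 2 :=
      abs_inner_mulOp_weakDeriv_le hp hbi (fun x => hA.symm i _) hB ((hBu U h.U_le).2 i)
        ((h.isWeakDeriv_z i).jop s R) ((sobolevNorm_jop_le 1 s R z).trans_lt (by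
          rw [add_comm]; exact h.z_lt_top hs))
    have c2 : ‖J (mulOp (fun x => A i (U x)) (zx i)) - mulOp (fun x => A i (U x)) (J (zx i))‖ ≤
        cc * B * (2 * Real.pi * ν) :=
      ((hBu U h.U_le).2 i).norm_commutator_le hp (by lia) hbi (fun σ hσ => by
        subst hσ
        exact h.z_le.weakDeriv (h.isWeakDeriv_z i)) hB (by positivity) R
    have c3 : inner ℝ (J (mulOp (fun x => A i (U x)) (zx i))) (J z) =
        inner ℝ (mulOp (fun x => A i (U x)) (J (zx i))) (J z) +
        inner ℝ (J (mulOp (fun x => A i (U x)) (zx i)) -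
          mulOp (fun x => A i (U x)) (J (zx i))) (J z) := by
      rw [inner_sub_left]; ring
    have c4 : ‖J z‖ ^ 2 ≤ ν ^ 2 := by gcongr
    rw [c3]
    refine (abs_add_le _ _).trans ?_
    have c5 := (abs_real_inner_le_norm (J (mulOp (fun x => A i (U x)) (zx i)) -
      mulOp (fun x => A i (U x)) (J (zx i))) (J z)).trans
      (mul_le_mul c2 hJz hJz0 (by positivity))
    have c6 : Real.pi * ee * B * ‖J z‖ ^ 2 ≤ Real.pi * ee * B * ν ^ 2 := by gcongr
    calc _ ≤ Real.pi * ee * B * ν ^ 2 + cc * B * (2 * Real.pi * ν) * ν :=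
          add_le_add (c1.trans c6) c5
      _ = _ := by ring
  have b3 := (abs_real_inner_le_norm (J (mulOp (fun x => A₀ (U x)) (yu - yU)) -
        mulOp (fun x => A₀ (U x)) (J (yu - yU))) (J z)).trans
      (mul_le_mul ((hBu U h.U_le).1.norm_commutator_le hp (by lia) hb0 (h₂ h) hB
        (by positivity) R) hJz hJz0 (by positivity))
  have b4 := (abs_real_inner_le_norm (mulOp (fun x => A₀ (U x) - A₀ (Ũ x)) (J (yu - yU)))
    (J z)).trans (mul_le_mul (h₃ h R) hJz hJz0 (by positivity))
  have b5 : |∑ i, inner ℝ (J (mulOp (fun x => A i (U x)) (zx i))) (J z)| ≤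
      d * ((Real.pi * ee * B + cc * B * (2 * Real.pi)) * ν * ν) := by
    refine (Finset.abs_sum_le_sum_abs _ _).trans ((Finset.sum_le_sum fun i _ => b2 i).trans ?_)
    simp
  rw [e2, e1]
  rw [abs_le] at b1 b3 b4 b5
  have k1 : (ν + δ) * ν ≤ (ν + δ) ^ 2 := by nlinarith
  have k2 : ν * ν ≤ (ν + δ) ^ 2 := by nlinarith
  have k3 : δ * ν ≤ (ν + δ) ^ 2 := by nlinarith
  have m1 : C₁ * (ν + δ) * ν ≤ C₁ * (ν + δ) ^ 2 := by rw [mul_assoc]; gcongr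
  have m2 : d * ((Real.pi * ee * B + cc * B * (2 * Real.pi)) * ν * ν) ≤
      d * (Real.pi * ee * B + cc * B * (2 * Real.pi)) * (ν + δ) ^ 2 := by
    rw [mul_assoc _ ν ν, ← mul_assoc (d : ℝ)]; gcongr
  have m3 : cc * B * (C₂ * (ν + δ)) * ν ≤ cc * B * C₂ * (ν + δ) ^ 2 := by
    rw [show cc * B * (C₂ * (ν + δ)) * ν = cc * B * C₂ * ((ν + δ) * ν) by ring]; gcongr
  have m4 : C₃ * δ * ν ≤ C₃ * (ν + δ) ^ 2 := by rw [mul_assoc]; gcongr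
  have tot : (C₁ + d * (Real.pi * ee * B + cc * B * (2 * Real.pi)) + cc * B * C₂ + C₃) *
      (ν + δ) ^ 2 = C₁ * (ν + δ) ^ 2 +
      d * (Real.pi * ee * B + cc * B * (2 * Real.pi)) * (ν + δ) ^ 2 +
      cc * B * C₂ * (ν + δ) ^ 2 + C₃ * (ν + δ) ^ 2 := by ring
  rw [tot]
  linarith [b1.2, b3.1, b4.1, b5.1]

end Slice

/-! ### Evolution -/

section Evolution

variable {d N m : ℕ} {A₀ : EuclideanSpace ℝ (Fin N) → Matrix (Fin N) (Fin N) ℝ}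
  {A : Fin d → EuclideanSpace ℝ (Fin N) → Matrix (Fin N) (Fin N) ℝ}
  {L : FirstOrderOp d N m} {p s : ℕ} {K K' T : ℝ}

/-- A derivative is a limit of linear combinations of values, and V is closed. -/
lemma derivWithin_mem_of_isClosed {E : Type*} [NormedAddCommGroup E] [NormedSpace ℝ E]
    {V : Submodule ℝ E} (hV : IsClosed (V : Set E)) {f : ℝ → E} {S : Set ℝ}
    (hf : ∀ t ∈ S, f t ∈ V) (t : ℝ) : derivWithin f S t ∈ V := by
  have h := range_derivWithin_subset_closure_span_image f (s := S) (t := S)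
    (by rw [Set.inter_self]; exact subset_closure) ⟨t, rfl⟩
  have hle : Submodule.span ℝ (f '' S) ≤ V := by
    rw [Submodule.span_le]
    rintro _ ⟨t, ht, rfl⟩
    exact hf t ht
  exact hV.closure_subset_iff.2 hle h

/-- The modified time derivative `∂_t u - ∂_t Ξ` of a solution solves the elliptic problem. -/
lemma IsSolution.isProjSol {F u : ℝ → L2 d N} {v : ℝ → L2 d m} {Ξ ξ : ℝ → L2 d N}
    (h : IsSolution T (p + 1) A₀ A L F u v Ξ ξ) (hA : SymCoeffs A₀ A) (hp : d < 2 * p)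
    (hΞ : ∀ t ∈ Set.Icc 0 T, L.Maps (Ξ t) 0) {t : ℝ} (ht : t ∈ Set.Icc 0 T) :
    IsProjSol L (fun x => A₀ (u t x)) (regRhs A (F t) (u t) + ξ t)
      (derivWithin u (Set.Icc 0 T) t - derivWithin Ξ (Set.Icc 0 T) t) where
  mem := L.ker.sub_mem (derivWithin_mem_of_isClosed L.isClosed_ker h.constraint t)
    (derivWithin_mem_of_isClosed L.isClosed_ker hΞ t)
  orth := fun φ hφ => by
    obtain ⟨ux, w, hux, hw, heq⟩ := h.equation t ht
    have hu : sobolevNorm (p + 1) (u t) < ⊤ := h.continuous_sobolev.1 t ht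
    have hup : sobolevNorm p (u t) < ⊤ := (sobolevNorm_mono p.le_succ _).trans_lt hu
    have hux' : ∀ i, ux i = wd i (u t) := fun i => (hux i).unique
      (isWeakDeriv_wd i ((sobolevNorm_mono (by lia) _).trans_lt hu))
    have hb₀ := bddField_comp hp hA.smooth₀ hup
    have hb := fun i => bddField_comp hp (hA.smooth i) hup
    set y := derivWithin u (Set.Icc 0 T) t
    set y' := derivWithin Ξ (Set.Icc 0 T) t
    -- Moving A₀(u)∂_t Ξ to the left leaves exactly w = L^*v on the right, which is orthogonal to
    -- ker L.
    have e : mulOp (fun x => A₀ (u t x)) (y - y') - (regRhs A (F t) (u t) + ξ t) = w := by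
      have hsum : mulOp (fun x => A₀ (u t x)) y + ∑ i, mulOp (fun x => A i (u t x)) (ux i) =
          F t + w + mulOp (fun x => A₀ (u t x)) y' + ξ t := by
        ext1
        have hs : ∀ᵐ x ∂(torusMeasure d),
            (∑ i, mulOp (fun x => A i (u t x)) (ux i) : L2 d N) x =
              ∑ i, mulOp (fun x => A i (u t x)) (ux i) x := by
          filter_upwards [Lp.coeFn_finsetSum Finset.univ
            (fun i => mulOp (fun x => A i (u t x)) (ux i))] with x hx
          rw [hx, Finset.sum_apply]
        filter_upwards [heq, hs, mulOp_ae hb₀ y, mulOp_ae hb₀ y',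
          ae_all_iff.2 fun i => mulOp_ae (hb i) (ux i),
          Lp.coeFn_add (mulOp (fun x => A₀ (u t x)) y)
            (∑ i, mulOp (fun x => A i (u t x)) (ux i)),
          Lp.coeFn_add (F t + w + mulOp (fun x => A₀ (u t x)) y') (ξ t),
          Lp.coeFn_add (F t + w) (mulOp (fun x => A₀ (u t x)) y'),
          Lp.coeFn_add (F t) w] with x h1 h2 h3 h4 h5 h6 h7 h8 h9
        rw [h6, h7, Pi.add_apply, Pi.add_apply, h8, Pi.add_apply, h9, Pi.add_apply, h2]
        apply WithLp.ofLp_injective 2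
        simp only [WithLp.ofLp_add, WithLp.ofLp_sum, h3, h4, h5]
        exact h1
      rw [map_sub, regRhs]
      simp only [← hux']
      rw [eq_sub_of_add_eq hsum]
      abel
    rw [e]
    exact FirstOrderOp.inner_adjoint hw hφ

/-- Continuous dependence of the solution of the elliptic problem in `L²`. -/
lemma SymCoeffs.exists_norm_sub_le (hA : SymCoeffs A₀ A) (hp : d < 2 * p) (hK : 0 ≤ K)
    (hK' : 0 ≤ K') (L : FirstOrderOp d N m) :
    ∃ C : ℝ, 0 ≤ C ∧ ∀ (F F' u u' y y' : L2 d N) (b : ℝ), SobLE (p + 1) u K →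
      SobLE (p + 1) u' K → SobLE p y' K' →
      IsProjSol L (fun x => A₀ (u x)) (regRhs A F u) y →
      IsProjSol L (fun x => A₀ (u' x)) (regRhs A F' u') y' → 0 ≤ b →
      SobLE 0 (F - F') b → SobLE (p + 1) (u - u') b → ‖y - y'‖ ≤ C * b := by
  obtain ⟨B, hB, hBu⟩ := hA.exists_fieldLE hp hK
  obtain ⟨lam, hl, hco⟩ := hA.exists_coercive hp hK
  obtain ⟨D, hD, hDs⟩ := hA.exists_fieldLE_sub hp hK le_rfl
  obtain ⟨C₁, hC₁, h₁⟩ := hA.exists_regRhs_sub_le hp hK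
  obtain ⟨C₂, hC₂, h₂⟩ := exists_elliptic_bound hp hl hB L 0 (by lia)
  have hP := prodR_nonneg d p
  refine ⟨C₂ * (C₁ + prodR d p * D * K'), by positivity, ?_⟩
  intro F F' u u' y y' b hu hu' hy' hsol hsol' hb hF hub
  have hbd := bddField_comp hp hA.smooth₀ (hu.mono_exp p.le_succ).lt_top
  have hbd' := bddField_comp hp hA.smooth₀ (hu'.mono_exp p.le_succ).lt_top
  have hsub : IsProjSol L (fun x => A₀ (u x)) (regRhs A F u - regRhs A F' u' -
      mulOp (fun x => A₀ (u x) - A₀ (u' x)) y') (y - y') :=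
    { mem := L.ker.sub_mem hsol.mem hsol'.mem
      orth := fun φ hφ => by
        have h1 := hsol.orth φ hφ
        have h2 := hsol'.orth φ hφ
        have e : mulOp (fun x => A₀ (u x)) (y - y') - (regRhs A F u - regRhs A F' u' -
            mulOp (fun x => A₀ (u x) - A₀ (u' x)) y') =
            (mulOp (fun x => A₀ (u x)) y - regRhs A F u) -
              (mulOp (fun x => A₀ (u' x)) y' - regRhs A F' u') := by
          rw [mulOp_sub hbd hbd', map_sub]
          abel
        rw [e, inner_sub_left, h1, h2, sub_zero] }
  have h3 : SobLE 0 (mulOp (fun x => A₀ (u x) - A₀ (u' x)) y') (prodR d p * (D * b) * K') :=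
    ((hDs u u' b hu hu' (hub.mono_exp p.le_succ)).1.mulOp (hy'.mono_exp (Nat.zero_le _)) hp
      (Nat.zero_le _) (hbd.sub hbd') (by positivity))
  have h4 := (h₁ F F' u u' b hu hu' hb hF hub).sub h3 (by positivity) (by positivity)
  have h5 : SobLE 0 (y - y') _ := h₂ _ hbd (hBu u hu).1 (hco u (hu.mono_exp p.le_succ)) _ _ hsub _
    (by positivity) h4
  exact (h5.norm_le (by positivity)).trans (le_of_eq (by ring))

/-- Solutions of the elliptic problem along a path that is continuous in `H^{p+1}` are continuous in
`L²`. -/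
lemma SymCoeffs.continuousOn_isProjSol (hA : SymCoeffs A₀ A) (hp : d < 2 * p) (hK : 0 ≤ K)
    (hK' : 0 ≤ K') {F u y : ℝ → L2 d N} (hF : ContInSobolev T p F)
    (hu : ContInSobolev T (p + 1) u) (huK : ∀ t ∈ Set.Icc 0 T, SobLE (p + 1) (u t) K)
    (hy : ∀ t ∈ Set.Icc 0 T, SobLE p (y t) K')
    (hsol : ∀ t ∈ Set.Icc 0 T, IsProjSol L (fun x => A₀ (u t x)) (regRhs A (F t) (u t)) (y t)) :
    ContinuousOn y (Set.Icc 0 T) := by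
  obtain ⟨C, hC, h⟩ := hA.exists_norm_sub_le hp hK hK' L
  intro t ht
  set b : ℝ → ℝ := fun t' => (sobolevNorm p (F t' - F t)).toReal +
    (sobolevNorm (p + 1) (u t' - u t)).toReal with hbdef
  have hb : Tendsto (fun t' => C * b t') (𝓝[Set.Icc 0 T] t) (𝓝 0) := by
    have h1 := (ENNReal.tendsto_toReal ENNReal.zero_ne_top).comp (hF.2 t ht)
    have h2 := (ENNReal.tendsto_toReal ENNReal.zero_ne_top).comp (hu.2 t ht)
    simpa using (h1.add h2).const_mul C
  refine tendsto_iff_norm_sub_tendsto_zero.2 (squeeze_zero' (.of_forall fun _ => norm_nonneg _)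
    ?_ hb)
  filter_upwards [self_mem_nhdsWithin] with t' ht'
  refine h (F t') (F t) _ _ _ _ (b t') (huK t' ht') (huK t ht) (hy t ht) (hsol t' ht')
    (hsol t ht) (by positivity) ?_ ?_
  · have hfin : sobolevNorm p (F t' - F t) < ⊤ := (sobolevNorm_sub_le _ _ _).trans_lt
      (ENNReal.add_lt_top.2 ⟨hF.1 t' ht', hF.1 t ht⟩)
    refine SobLE.mono (SobLE.mono_exp (s := p) ?_ (Nat.zero_le _))
      (le_add_of_nonneg_right ENNReal.toReal_nonneg)
    exact (ENNReal.ofReal_toReal hfin.ne).ge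
  · have hfin : sobolevNorm (p + 1) (u t' - u t) < ⊤ := (sobolevNorm_sub_le _ _ _).trans_lt
      (ENNReal.add_lt_top.2 ⟨hu.1 t' ht', hu.1 t ht⟩)
    exact SobLE.mono (ENNReal.ofReal_toReal hfin.ne).ge
      (le_add_of_nonneg_left ENNReal.toReal_nonneg)

/-- Primitives of functions that are continuous on an interval. -/
lemma exists_primitive {E : Type*} [NormedAddCommGroup E] [NormedSpace ℝ E] [CompleteSpace E]
    (hT : 0 ≤ T) {y : ℝ → E} (hy : ContinuousOn y (Set.Icc 0 T)) (a : E) :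
    ∃ Y : ℝ → E, Y 0 = a ∧ ∀ t ∈ Set.Icc 0 T, HasDerivWithinAt Y (y t) (Set.Icc 0 T) t := by
  have hc : Continuous (Set.IccExtend hT (Set.domRestrict (Set.Icc 0 T) y)) :=
    (continuousOn_iff_continuous_domRestrict.1 hy).Icc_extend'
  refine ⟨fun t => a + ∫ τ in (0 : ℝ)..t, Set.IccExtend hT (Set.domRestrict (Set.Icc 0 T) y) τ,
    by simp, fun t ht => ?_⟩
  have h := ((hc.integral_hasStrictDerivAt 0 t).hasDerivAt.const_add a).hasDerivWithinAt
    (s := Set.Icc 0 T)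
  rwa [Set.IccExtend_of_mem hT _ ht] at h

/-- Lipschitz dependence of the operator `A₀(f)` on `L²` on `f ∈ H^p`. -/
lemma SymCoeffs.exists_norm_mulOp_sub_mulOp_le (hA : SymCoeffs A₀ A) (hp : d < 2 * p)
    (hK : 0 ≤ K) :
    ∃ C : ℝ, 0 ≤ C ∧ ∀ (f f' h : L2 d N) (b : ℝ), SobLE p f K → SobLE p f' K → 0 ≤ b →
      SobLE p (f - f') b →
      ‖mulOp (fun x => A₀ (f x)) h - mulOp (fun x => A₀ (f' x)) h‖ ≤ C * b * ‖h‖ := by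
  obtain ⟨Λ, hΛ, hlip⟩ := exists_matrix_lipschitz hA.smooth₀ (supBd d N p K)
  refine ⟨Λ * supBd d N p 1, by unfold supBd; positivity, fun f f' h b hf hf' hb hff => ?_⟩
  have hbd := bddField_comp hp hA.smooth₀ hf.lt_top
  have hbd' := bddField_comp hp hA.smooth₀ hf'.lt_top
  rw [← mulOp_sub hbd hbd']
  refine norm_mulOp_le (hbd.sub hbd') ?_ h
  filter_upwards [norm_le_supBd hp hK hf, norm_le_supBd hp hK hf', norm_le_supBd hp hb hff,
    Lp.coeFn_sub f f'] with x h1 h2 h3 h4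
  refine (hlip _ _ h1 h2).trans ?_
  rw [h4] at h3
  calc Λ * ‖f x - f' x‖ ≤ Λ * supBd d N p b := by gcongr; exact h3
    _ = Λ * supBd d N p 1 * b := by unfold supBd; ring

/-- Growth of the energy `⟨Q(t) f(t), f(t)⟩` when `Q` is Lipschitz in time. -/
lemma energy_le_of_deriv_le {E : Type*} [NormedAddCommGroup E] [InnerProductSpace ℝ E]
    {Q : ℝ → E →L[ℝ] E} {f f' : ℝ → E} {Λ κ D : ℝ} (hκ : 0 < κ)
    (hQ : ∀ t ∈ Set.Icc 0 T, ∀ x y, inner ℝ (Q t x) y = inner ℝ x (Q t y))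
    (hΛ : ∀ t ∈ Set.Icc 0 T, ∀ t' ∈ Set.Icc 0 T, ∀ x, ‖Q t' x - Q t x‖ ≤ Λ * |t' - t| * ‖x‖)
    (hf : ∀ t ∈ Set.Icc 0 T, HasDerivWithinAt f (f' t) (Set.Icc 0 T) t)
    (hD : ∀ t ∈ Set.Icc 0 T,
      Λ * ‖f t‖ ^ 2 + 2 * inner ℝ (Q t (f' t)) (f t) ≤ D * Real.exp (κ * t))
    (hD0 : 0 ≤ D) {t : ℝ} (ht : t ∈ Set.Icc 0 T) :
    inner ℝ (Q t (f t)) (f t) ≤ inner ℝ (Q 0 (f 0)) (f 0) + D * Real.exp (κ * t) / κ := by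
  -- Symmetry of Q(t) separates the change of Q from the change of f, so Lipschitz continuity of Q
  -- in time replaces differentiability.
  have hsplit : ∀ t ∈ Set.Icc 0 T, ∀ t', inner ℝ (Q t' (f t')) (f t') - inner ℝ (Q t (f t)) (f t) =
      inner ℝ (Q t' (f t') - Q t (f t')) (f t') + inner ℝ (Q t (f t' - f t)) (f t' + f t) := by
    intro t ht t'
    have := hQ t ht (f t) (f t')
    rw [real_inner_comm (Q t (f t')) (f t)] at this
    simp only [map_sub, inner_sub_left, inner_add_right]
    linarith
  have hfc : ∀ t ∈ Set.Icc 0 T, ContinuousWithinAt f (Set.Icc 0 T) t := fun t ht =>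
    (hf t ht).continuousWithinAt
  have hb1 : ∀ t ∈ Set.Icc 0 T, ∀ t' ∈ Set.Icc 0 T,
      |inner ℝ (Q t' (f t') - Q t (f t')) (f t')| ≤ Λ * |t' - t| * ‖f t'‖ ^ 2 := by
    intro t ht t' ht'
    refine (abs_real_inner_le_norm _ _).trans ?_
    rw [pow_two, ← mul_assoc]
    exact mul_le_mul_of_nonneg_right (hΛ t ht t' ht' _) (norm_nonneg _)
  set e : ℝ → ℝ := fun t => inner ℝ (Q t (f t)) (f t) with he
  have hcont : ContinuousOn e (Set.Icc 0 T) := by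
    intro t ht
    have h1 : Tendsto (fun t' => Λ * |t' - t| * ‖f t'‖ ^ 2) (𝓝[Set.Icc 0 T] t) (𝓝 0) := by
      have : ContinuousWithinAt (fun t' => Λ * |t' - t| * ‖f t'‖ ^ 2) (Set.Icc 0 T) t := by
        have := hfc t ht
        fun_prop
      simpa [ContinuousWithinAt] using this
    have h2 : Tendsto (fun t' => inner ℝ (Q t (f t' - f t)) (f t' + f t)) (𝓝[Set.Icc 0 T] t)
        (𝓝 0) := by
      have : ContinuousWithinAt (fun t' => inner ℝ (Q t (f t' - f t)) (f t' + f t))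
          (Set.Icc 0 T) t :=
        ((Q t).continuous.continuousAt.comp_continuousWithinAt
          ((hfc t ht).sub continuousWithinAt_const)).inner (𝕜 := ℝ)
          ((hfc t ht).add continuousWithinAt_const)
      simpa [ContinuousWithinAt] using this
    have h3 : Tendsto (fun t' => inner ℝ (Q t' (f t') - Q t (f t')) (f t')) (𝓝[Set.Icc 0 T] t)
        (𝓝 0) :=
      squeeze_zero_norm' (by filter_upwards [self_mem_nhdsWithin] with t' ht' using hb1 t ht t' ht')
        h1
    have h4 : Tendsto (fun t' => e t' - e t) (𝓝[Set.Icc 0 T] t) (𝓝 0) := by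
      simpa only [add_zero, ← hsplit t ht] using h3.add h2
    exact tendsto_sub_nhds_zero_iff.1 h4
  set b : ℝ → ℝ := fun t => e 0 + D * Real.exp (κ * t) / κ with hb
  have hbd : ∀ t, HasDerivAt b (D * Real.exp (κ * t)) t := by
    intro t
    have h1 : HasDerivAt (fun t => Real.exp (κ * t)) (Real.exp (κ * t) * κ) t := by
      simpa using ((hasDerivAt_id t).const_mul κ).exp
    have h2 := ((h1.const_mul D).div_const κ).const_add (e 0)
    rwa [← mul_assoc, mul_div_cancel_right₀ _ hκ.ne'] at h2
  -- The energy need not be differentiable; bounding its right difference quotients by the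
  -- derivative of the barrier b is enough.
  refine image_le_of_liminf_slope_right_le_deriv_boundary (f := e) (B := b)
    (B' := fun t => D * Real.exp (κ * t)) hcont ?_ (fun t _ => (hbd t).continuousAt.continuousWithinAt)
    (fun t _ => (hbd t).hasDerivWithinAt) ?_ ht
  · simp only [hb]
    exact le_add_of_nonneg_right (by positivity)
  · intro t ht r hr
    have htI : t ∈ Set.Icc 0 T := ⟨ht.1, ht.2.le⟩
    have hnhds : Set.Icc 0 T ∈ 𝓝[>] t :=
      mem_of_superset (Ioo_mem_nhdsGT ht.2) fun x hx => ⟨ht.1.trans hx.1.le, hx.2.le⟩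
    have hle : 𝓝[>] t ≤ 𝓝[Set.Icc 0 T] t :=
      le_inf nhdsWithin_le_nhds (le_principal_iff.2 hnhds)
    have hfr : Tendsto f (𝓝[>] t) (𝓝 (f t)) := (hfc t htI).mono_left hle
    have hsl : Tendsto (slope f t) (𝓝[>] t) (𝓝 (f' t)) := by
      have := hasDerivWithinAt_iff_tendsto_slope.1 (hf t htI)
      refine this.mono_left (le_inf nhdsWithin_le_nhds (le_principal_iff.2 ?_))
      filter_upwards [hnhds, self_mem_nhdsWithin] with x h1 h2
      exact ⟨h1, ne_of_gt h2⟩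
    have hlim : Tendsto (fun t' => Λ * ‖f t'‖ ^ 2 + inner ℝ (Q t (slope f t t')) (f t' + f t))
        (𝓝[>] t) (𝓝 (Λ * ‖f t‖ ^ 2 + 2 * inner ℝ (Q t (f' t)) (f t))) := by
      have h1 := (hfr.norm.pow 2).const_mul Λ
      have h2 := (((Q t).continuous.tendsto _).comp hsl).inner (𝕜 := ℝ) (hfr.add_const (f t))
      have h3 := h1.add h2
      rw [← two_smul ℝ (f t), inner_smul_right] at h3
      exact h3
    have hev := hlim.eventually (gt_mem_nhds ((hD t htI).trans_lt hr))
    refine Eventually.frequently ?_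
    filter_upwards [hev, hnhds, self_mem_nhdsWithin] with t' h1 h2 h3
    have hpos : 0 < t' - t := sub_pos.2 h3
    refine lt_of_le_of_lt ?_ h1
    rw [slope_def_field, div_le_iff₀ hpos, he]
    simp only
    rw [hsplit t htI t', add_mul]
    refine add_le_add ?_ (le_of_eq ?_)
    · refine (le_abs_self _).trans ((hb1 t htI t' h2).trans (le_of_eq ?_))
      rw [abs_of_pos hpos]
      ring
    · rw [slope_def_module, map_smul, real_inner_smul_left]
      field_simp

/-- Closing a bootstrap estimate. -/
lemma le_of_improve {α : Type*} {S : Set α} {f : α → ℝ} {a X₀ : ℝ} (h0 : ∀ t ∈ S, f t ≤ X₀)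
    (h : ∀ X, (∀ t ∈ S, f t ≤ X) → ∀ t ∈ S, f t ≤ a + X / 2) {t : α} (ht : t ∈ S) :
    f t ≤ 2 * a := by
  -- The a priori bound X₀ only makes the supremum finite; it does not enter the conclusion.
  have hb : BddAbove (f '' S) := ⟨X₀, by rintro _ ⟨t, ht, rfl⟩; exact h0 t ht⟩
  have hle : ∀ t ∈ S, f t ≤ sSup (f '' S) := fun t ht => le_csSup hb ⟨t, ht, rfl⟩
  have h1 : sSup (f '' S) ≤ a + sSup (f '' S) / 2 := by
    refine csSup_le ⟨_, t, ht, rfl⟩ ?_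
    rintro _ ⟨t, ht, rfl⟩
    exact h _ hle t ht
  linarith [hle t ht]

end Evolution

/-! ### The error estimate -/

section ErrorEstimate

variable {d N m : ℕ} {A₀ : EuclideanSpace ℝ (Fin N) → Matrix (Fin N) (Fin N) ℝ}
  {A : Fin d → EuclideanSpace ℝ (Fin N) → Matrix (Fin N) (Fin N) ℝ}
  {L : FirstOrderOp d N m} {p s : ℕ} {K T : ℝ}

/-- Two solutions with the same initial value and the bounds on the data and the errors. -/
structure ErrorData (A₀ : EuclideanSpace ℝ (Fin N) → Matrix (Fin N) (Fin N) ℝ)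
    (A : Fin d → EuclideanSpace ℝ (Fin N) → Matrix (Fin N) (Fin N) ℝ)
    (L : FirstOrderOp d N m) (p s : ℕ) (K T ε : ℝ) (F u U : ℝ → L2 d N) (v V : ℝ → L2 d m)
    (Ξu ΞU ξu ξU : ℝ → L2 d N) : Prop where
  ε_nonneg : 0 ≤ ε
  contF : ContInSobolev T p F
  solu : IsSolution T (p + 1) A₀ A L F u v Ξu ξu
  solU : IsSolution T (p + 1) A₀ A L F U V ΞU ξU
  init : u 0 = U 0
  F_le : ∀ t ∈ Set.Icc 0 T, SobLE p (F t) K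
  u_le : ∀ t ∈ Set.Icc 0 T, SobLE (p + 1) (u t) K
  U_le : ∀ t ∈ Set.Icc 0 T, SobLE (p + 1) (U t) K
  Ξu_le : ∀ t ∈ Set.Icc 0 T, SobLE (s + 1) (Ξu t) ε
  ΞU_le : ∀ t ∈ Set.Icc 0 T, SobLE (s + 1) (ΞU t) ε
  ξu_le : ∀ t ∈ Set.Icc 0 T, SobLE s (ξu t) ε
  ξU_le : ∀ t ∈ Set.Icc 0 T, SobLE s (ξU t) ε
  mapsu : ∀ t ∈ Set.Icc 0 T, L.Maps (Ξu t) 0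
  mapsU : ∀ t ∈ Set.Icc 0 T, L.Maps (ΞU t) 0

/-- The path `Ũ` is Lipschitz in `H^p` and close to `U` in `H^s`, and the data at each time satisfy
the assumptions of the energy estimate. -/
lemma SymCoeffs.exists_sliceData (hA : SymCoeffs A₀ A) (hp : d < 2 * p) (hK : 0 ≤ K)
    (hs : s ≤ p) (hT : 0 ≤ T) (L : FirstOrderOp d N m) :
    ∃ M K' : ℝ, 2 ≤ M ∧ 0 ≤ K' ∧ ∀ (ε : ℝ) (F u U : ℝ → L2 d N) (v V : ℝ → L2 d m)
      (Ξu ΞU ξu ξU : ℝ → L2 d N), ErrorData A₀ A L p s K T ε F u U v V Ξu ΞU ξu ξU →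
      ∃ Ũ : ℝ → L2 d N, (∀ t ∈ Set.Icc 0 T, SobLE p (Ũ t) K') ∧
        (∀ t ∈ Set.Icc 0 T, ∀ t' ∈ Set.Icc 0 T, SobLE p (Ũ t' - Ũ t) (M * |t' - t|)) ∧
        ∀ t ∈ Set.Icc 0 T, ∃ y₁u y₁U, ∀ ν, 0 ≤ ν → SobLE s (u t - U t - (Ξu t - ΞU t)) ν →
          SliceData A₀ A L p s K K' M ε ν (F t) (u t) (U t) (Ũ t) (ξu t) (ξU t) (Ξu t - ΞU t)
            (derivWithin u (Set.Icc 0 T) t - derivWithin Ξu (Set.Icc 0 T) t)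
            (derivWithin U (Set.Icc 0 T) t - derivWithin ΞU (Set.Icc 0 T) t) y₁u y₁U := by
  obtain ⟨C, hC, hsplit⟩ := hA.exists_split_le hp hK hs L
  obtain ⟨lam, hl, hco⟩ := hA.exists_coercive hp hK
  -- Ũ starts from a field of norm at most K and moves in H^p with speed at most C, whence K' = K +
  -- CT. In M the 2 pays for two error fields Ξ, C for the splitting, and CT for the drift between U
  -- and Ũ.
  refine ⟨2 + C + C * T, K + C * T, by nlinarith [mul_nonneg hC hT], by positivity, ?_⟩
  intro ε F u U v V Ξu ΞU ξu ξU h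
  have hε := h.ε_nonneg
  have hCT := mul_nonneg hC hT
  have hex : ∀ (w : ℝ → L2 d N), (∀ t ∈ Set.Icc 0 T, SobLE (p + 1) (w t) K) →
      ∀ t, ∃ y, t ∈ Set.Icc 0 T →
        IsProjSol L (fun x => A₀ (w t x)) (regRhs A (F t) (w t)) y := by
    intro w hw t
    by_cases ht : t ∈ Set.Icc 0 T
    · obtain ⟨y, hy⟩ := exists_isProjSol L _ hl (hco (w t) ((hw t ht).mono_exp p.le_succ))
        (regRhs A (F t) (w t))
      exact ⟨y, fun _ => hy⟩
    · exact ⟨0, fun h => absurd h ht⟩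
  choose y₁u hy₁u using hex u h.u_le
  choose y₁U hy₁U using hex U h.U_le
  have hu := fun t (ht : t ∈ Set.Icc 0 T) => hsplit (F t) (u t) (ξu t) _ _ ε (h.F_le t ht)
    (h.u_le t ht) hε (h.ξu_le t ht) (h.solu.isProjSol hA hp h.mapsu ht) (hy₁u t ht)
  have hU := fun t (ht : t ∈ Set.Icc 0 T) => hsplit (F t) (U t) (ξU t) _ _ ε (h.F_le t ht)
    (h.U_le t ht) hε (h.ξU_le t ht) (h.solU.isProjSol hA hp h.mapsU ht) (hy₁U t ht)
  have hcont : ContinuousOn y₁U (Set.Icc 0 T) := hA.continuousOn_isProjSol hp hK hC h.contF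
    h.solU.continuous_sobolev h.U_le (fun t ht => (hU t ht).1) hy₁U
  -- The primitive is taken in L², where y₁ is continuous in time; its Lipschitz bound in H^p comes
  -- from the mean value inequality.
  obtain ⟨Ũ, hŨ0, hŨ⟩ := exists_primitive hT hcont (U 0)
  have h0 : (0 : ℝ) ∈ Set.Icc 0 T := ⟨le_rfl, hT⟩
  have hlip : ∀ t ∈ Set.Icc 0 T, ∀ t' ∈ Set.Icc 0 T, SobLE p (Ũ t' - Ũ t) (C * |t' - t|) :=
    fun t ht t' ht' => sobolevNorm_sub_le_of_deriv hC hŨ (fun t ht => (hU t ht).1) ht ht'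
  have habs : ∀ t ∈ Set.Icc 0 T, |t - 0| ≤ T := fun t ht => by
    rw [sub_zero, abs_of_nonneg ht.1]; exact ht.2
  have hŨK : ∀ t ∈ Set.Icc 0 T, SobLE p (Ũ t) (K + C * T) := by
    intro t ht
    have := ((h.U_le 0 h0).mono_exp p.le_succ).add (hlip 0 h0 t ht) hK (by positivity)
    rw [hŨ0, add_sub_cancel] at this
    refine this.mono ?_
    gcongr
    exact habs t ht
  refine ⟨Ũ, hŨK, fun t ht t' ht' => (hlip t ht t' ht').mono ?_, fun t ht => ?_⟩
  · gcongr
    linarith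
  -- The derivative of U - Ũ - Ξ_U is y_U - y₁ = O(ε) in H^s. Integrating it and restoring Ξ_U at
  -- times 0 and t gives the bound.
  have hsub : SobLE s (U t - Ũ t) ((2 + C + C * T) * ε) := by
    have hder : ∀ t ∈ Set.Icc 0 T, HasDerivWithinAt (fun t => U t - Ũ t - ΞU t)
        (derivWithin U (Set.Icc 0 T) t - derivWithin ΞU (Set.Icc 0 T) t - y₁U t)
        (Set.Icc 0 T) t := by
      intro t ht
      exact ((((h.solU.differentiable t ht).hasDerivWithinAt).sub (hŨ t ht)).sub
        (h.solU.differentiable_err t ht).hasDerivWithinAt).congr_deriv (sub_right_comm _ _ _)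
    have h1 : SobLE s _ _ := sobolevNorm_sub_le_of_deriv (by positivity) hder
      (fun t ht => (hU t ht).2) h0 ht
    have h2 := (h1.sub ((h.ΞU_le 0 h0).mono_exp s.le_succ) (by positivity) hε).add
      ((h.ΞU_le t ht).mono_exp s.le_succ) (by positivity) hε
    have e : U t - Ũ t - ΞU t - (U 0 - Ũ 0 - ΞU 0) - ΞU 0 + ΞU t = U t - Ũ t := by
      rw [hŨ0]; abel
    rw [e] at h2
    refine h2.mono ?_
    have : C * ε * |t - 0| ≤ C * ε * T := by gcongr; exact habs t ht
    nlinarith [mul_nonneg hC hε]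
  have h1M : ε ≤ (2 + C + C * T) * ε := by nlinarith [mul_nonneg hC hε, mul_nonneg hCT hε]
  have hCM : C * ε ≤ (2 + C + C * T) * ε := by gcongr; linarith
  refine ⟨y₁u t, y₁U t, fun ν hν hz => ?_⟩
  exact
    { δ_nonneg := hε
      ν_nonneg := hν
      u_le := h.u_le t ht
      U_le := h.U_le t ht
      Ũ_le := hŨK t ht
      sub_Ũ_le := hsub
      ξu_le := (h.ξu_le t ht).mono h1M
      ξU_le := (h.ξU_le t ht).mono h1M
      Θ_le := ((h.Ξu_le t ht).sub (h.ΞU_le t ht) hε hε).mono (by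
        nlinarith [mul_nonneg hC hε, mul_nonneg hCT hε])
      y₁u_le := (hu t ht).1.mono (by linarith)
      y₁U_le := (hU t ht).1.mono (by linarith)
      sub_y₁u_le := (hu t ht).2.mono hCM
      sub_y₁U_le := (hU t ht).2.mono hCM
      solu := h.solu.isProjSol hA hp h.mapsu ht
      solU := h.solU.isProjSol hA hp h.mapsU ht
      mem := L.ker.sub_mem (L.ker.sub_mem (h.solu.constraint t ht) (h.solU.constraint t ht))
        (L.ker.sub_mem (h.mapsu t ht) (h.mapsU t ht))
      z_le := hz }

/-- The error estimate. -/
theorem SymCoeffs.exists_error_le (hA : SymCoeffs A₀ A) (hp : d < 2 * p) (hK : 0 ≤ K)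
    (hs : s ≤ p) (hT : 0 ≤ T) (L : FirstOrderOp d N m) :
    ∃ C : ℝ, 0 ≤ C ∧ ∀ (ε : ℝ) (F u U : ℝ → L2 d N) (v V : ℝ → L2 d m)
      (Ξu ΞU ξu ξU : ℝ → L2 d N), ErrorData A₀ A L p s K T ε F u U v V Ξu ΞU ξu ξU →
      ∀ t ∈ Set.Icc 0 T, SobLE s (u t - U t) (C * ε) := by
  obtain ⟨M, K', hM, hK', hslice⟩ := hA.exists_sliceData hp hK hs hT L
  have hM0 : 0 ≤ M := by linarith
  obtain ⟨Ce, hCe, hen⟩ := hA.exists_energy_le hp hK hK' hM0 hs L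
  obtain ⟨lam, hl, hco⟩ := hA.exists_coercive hp hK'
  obtain ⟨Λ, hΛ, hlip⟩ := hA.exists_norm_mulOp_sub_mulOp_le hp hK'
  -- Growth rate of the energy: ΛM from the motion of the weight A₀(Ũ), 2Ce from the estimate at
  -- fixed time.
  set D := Λ * M + 2 * Ce with hD
  have hD0 : 0 ≤ D := by positivity
  -- Chosen so that 2D/(lam κ) ≤ 1/2, which makes the absorption possible.
  set κ := 4 * D / lam + 1 with hκ
  have hκ0 : 0 < κ := by positivity
  -- Uniform bound for multiplication by A₀(Ũ(0)), by comparison with the fixed field A₀(0).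
  set CA := Λ * K' + ‖mulOp (fun x => A₀ ((0 : L2 d N) x))‖ with hCA
  have hCA0 : 0 ≤ CA := by positivity
  -- The initial energy is at most CA(2ε)²; the factors 2 come from (ν + ε)² ≤ 2ν² + 2ε².
  set a := 2 * (CA * 4) / lam + 2 with ha
  have ha0 : 0 ≤ a := by positivity
  -- The bootstrap yields (ν + ε)² ≤ (G - 1)ε² ≤ (Gε)². The final constant G + 2 restores the fields
  -- Ξ, of total size 2ε.
  set G := 2 * a * Real.exp (κ * T) + 1 with hG
  have hG1 : 1 ≤ G := le_add_of_nonneg_left (by positivity)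
  refine ⟨G + 2, by positivity, ?_⟩
  intro ε F u U v V Ξu ΞU ξu ξU h
  have hε := h.ε_nonneg
  obtain ⟨Ũ, hŨ, hŨlip, hsl⟩ := hslice ε F u U v V Ξu ΞU ξu ξU h
  have h0 : (0 : ℝ) ∈ Set.Icc 0 T := ⟨le_rfl, hT⟩
  set z : ℝ → L2 d N := fun t => u t - U t - (Ξu t - ΞU t) with hz
  have hΘ : ∀ t ∈ Set.Icc 0 T, SobLE s (Ξu t - ΞU t) (ε + ε) := fun t ht =>
    ((h.Ξu_le t ht).sub (h.ΞU_le t ht) hε hε).mono_exp s.le_succ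
  have hz0 : SobLE s (z 0) (ε + ε) := by
    have e : z 0 = ΞU 0 - Ξu 0 := by simp only [hz]; rw [h.init]; abel
    rw [e]
    exact ((h.ΞU_le 0 h0).sub (h.Ξu_le 0 h0) hε hε).mono_exp s.le_succ
  have hzle : ∀ t ∈ Set.Icc 0 T, SobLE s (z t) (K + K + (ε + ε)) := fun t ht =>
    (((h.u_le t ht).sub (h.U_le t ht) hK hK).mono_exp (by lia)).sub (hΘ t ht) (by positivity)
      (by positivity)
  set ν : ℝ → ℝ := fun t => (sobolevNorm s (z t)).toReal with hν
  have hν0 : ∀ t, 0 ≤ ν t := fun t => ENNReal.toReal_nonneg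
  have hzν : ∀ t ∈ Set.Icc 0 T, SobLE s (z t) (ν t) := fun t ht =>
    (ENNReal.ofReal_toReal (hzle t ht).lt_top.ne).ge
  have hνle : ∀ t, ∀ b, 0 ≤ b → SobLE s (z t) b → ν t ≤ b := fun t b hb hzb =>
    ENNReal.toReal_le_of_le_ofReal hb hzb
  -- For each R the energy controls J_R z, but its growth is bounded by ν = ‖z‖_s, which involves
  -- all R. Under the weight e^{-κt} the time integral of this growth carries a factor 1/κ and can
  -- be absorbed.
  set f : ℝ → ℝ := fun t => Real.exp (-(κ * t)) * (ν t + ε) ^ 2 with hf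
  have hexp : ∀ t, Real.exp (κ * t) * Real.exp (-(κ * t)) = 1 := fun t => by
    rw [← Real.exp_add, add_neg_cancel, Real.exp_zero]
  have hder : ∀ t ∈ Set.Icc 0 T, HasDerivWithinAt z
      ((derivWithin u (Set.Icc 0 T) t - derivWithin Ξu (Set.Icc 0 T) t) -
        (derivWithin U (Set.Icc 0 T) t - derivWithin ΞU (Set.Icc 0 T) t)) (Set.Icc 0 T) t := by
    intro t ht
    exact ((((h.solu.differentiable t ht).hasDerivWithinAt).sub
      (h.solU.differentiable t ht).hasDerivWithinAt).sub
      (((h.solu.differentiable_err t ht).hasDerivWithinAt).sub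
      (h.solU.differentiable_err t ht).hasDerivWithinAt)).congr_deriv (sub_sub_sub_comm _ _ _ _)
  have hbd : ∀ t ∈ Set.Icc 0 T, BddField fun x => A₀ (Ũ t x) := fun t ht =>
    bddField_comp hp hA.smooth₀ (hŨ t ht).lt_top
  have hop : ∀ g : L2 d N, ‖mulOp (fun x => A₀ (Ũ 0 x)) g‖ ≤ CA * ‖g‖ := by
    intro g
    have h1 := hlip (Ũ 0) 0 g K' (hŨ 0 h0) ((sobolevNorm_le_ofReal_iff hK').2 fun R => by simpa using hK') hK'
      (by rw [sub_zero]; exact hŨ 0 h0)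
    have h2 := (mulOp (fun x => A₀ ((0 : L2 d N) x))).le_opNorm g
    have h3 := norm_le_norm_sub_add (mulOp (fun x => A₀ (Ũ 0 x)) g)
      (mulOp (fun x => A₀ ((0 : L2 d N) x)) g)
    rw [hCA, add_mul]
    linarith
  have hstep : ∀ X, (∀ t ∈ Set.Icc 0 T, f t ≤ X) → ∀ t ∈ Set.Icc 0 T,
      f t ≤ a * ε ^ 2 + X / 2 := by
    intro X hX t ht
    have hX0 : 0 ≤ X := le_trans (by positivity) (hX 0 h0)
    have hXt : ∀ t ∈ Set.Icc 0 T, (ν t + ε) ^ 2 ≤ X * Real.exp (κ * t) := fun t ht => by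
      calc (ν t + ε) ^ 2 = f t * Real.exp (κ * t) := by
            rw [hf]; simp only; linear_combination -(ν t + ε) ^ 2 * hexp t
        _ ≤ _ := by gcongr; exact hX t ht
    set W := CA * 4 * ε ^ 2 + D * X * Real.exp (κ * t) / κ with hW
    have hW0 : 0 ≤ W := by positivity
    have hJ : ∀ R, lam * ‖jop s R (z t)‖ ^ 2 ≤ W := by
      intro R
      refine (hco (Ũ t) (hŨ t ht) _).trans ?_
      refine (energy_le_of_deriv_le (Q := fun t => mulOp (fun x => A₀ (Ũ t x)))
        (f := fun t => jop s R (z t)) (Λ := Λ * M) (D := D * X) hκ0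
        (fun t ht => inner_mulOp_comm (hbd t ht) fun x => hA.symm₀ _) ?_
        (fun t ht => (jop s R).hasFDerivAt.comp_hasDerivWithinAt t (hder t ht)) ?_ (by positivity)
        ht).trans ?_
      · intro t ht t' ht' g
        exact (hlip _ _ g _ (hŨ t' ht') (hŨ t ht) (by positivity) (hŨlip t ht t' ht')).trans
          (le_of_eq (by ring))
      · intro t ht
        obtain ⟨y₁u, y₁U, hd⟩ := hsl t ht
        have h1 := hen (hd (ν t) (hν0 t) (hzν t ht)) R
        have h2 : ‖jop s R (z t)‖ ≤ ν t := (hzν t ht).norm_jop_le (hν0 t) R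
        have h3 : ‖jop s R (z t)‖ ^ 2 ≤ (ν t + ε) ^ 2 := by
          gcongr
          linarith
        calc _ ≤ Λ * M * (ν t + ε) ^ 2 + 2 * (Ce * (ν t + ε) ^ 2) := by gcongr
          _ = D * (ν t + ε) ^ 2 := by rw [hD]; ring
          _ ≤ D * (X * Real.exp (κ * t)) := by gcongr; exact hXt t ht
          _ = _ := by ring
      · rw [hW]
        gcongr
        have h1 : ‖jop s R (z 0)‖ ≤ ε + ε := hz0.norm_jop_le (by positivity) R
        refine (real_inner_le_norm _ _).trans ?_
        calc _ ≤ CA * ‖jop s R (z 0)‖ * ‖jop s R (z 0)‖ := by gcongr; exact hop _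
          _ ≤ CA * (ε + ε) * (ε + ε) := by gcongr
          _ = _ := by ring
    -- W does not depend on R, so the bound passes to the supremum over R.
    have hνW : ν t ^ 2 ≤ W / lam := by
      have h1 : SobLE s (z t) (Real.sqrt (W / lam)) := by
        refine (sobolevNorm_le_ofReal_iff (Real.sqrt_nonneg _)).2 fun R => ?_
        refine Real.le_sqrt_of_sq_le ?_
        rw [le_div_iff₀ hl, mul_comm]
        exact hJ R
      have h2 := hνle t _ (Real.sqrt_nonneg _) h1
      calc ν t ^ 2 ≤ Real.sqrt (W / lam) ^ 2 := by gcongr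
        _ = _ := Real.sq_sqrt (by positivity)
    have he1 : Real.exp (-(κ * t)) ≤ 1 := Real.exp_le_one_iff.2 (by
      have := mul_nonneg hκ0.le ht.1
      linarith)
    have hDκ : 2 * D / lam / κ ≤ 1 / 2 := by
      rw [div_le_iff₀ hκ0, hκ]
      have : 4 * D / lam = 2 * (2 * D / lam) := by ring
      rw [this]
      linarith
    calc f t ≤ Real.exp (-(κ * t)) * (2 * (W / lam) + 2 * ε ^ 2) := by
          rw [hf]
          simp only
          gcongr
          nlinarith [sq_nonneg (ν t - ε)]
      _ = Real.exp (-(κ * t)) * (a * ε ^ 2) +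
          2 * D / lam / κ * X * (Real.exp (κ * t) * Real.exp (-(κ * t))) := by
          rw [hW, ha]
          field_simp
          ring
      _ ≤ 1 * (a * ε ^ 2) + 1 / 2 * X * 1 := by
          rw [hexp]
          gcongr
      _ = _ := by ring
  intro t ht
  have hfin : ∀ t ∈ Set.Icc 0 T, f t ≤ (K + K + (ε + ε) + ε) ^ 2 := fun t ht => by
    have h1 : ν t ≤ K + K + (ε + ε) := hνle t _ (by positivity) (hzle t ht)
    have h2 := hν0 t
    have he1 : Real.exp (-(κ * t)) ≤ 1 := Real.exp_le_one_iff.2 (by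
      have := mul_nonneg hκ0.le ht.1
      linarith)
    calc f t ≤ 1 * (K + K + (ε + ε) + ε) ^ 2 := by rw [hf]; simp only; gcongr
      _ = _ := one_mul _
  have hmain := le_of_improve hfin hstep ht
  have hsq : (ν t + ε) ^ 2 ≤ (G * ε) ^ 2 := by
    calc (ν t + ε) ^ 2 = f t * Real.exp (κ * t) := by
          rw [hf]; simp only; linear_combination -(ν t + ε) ^ 2 * hexp t
      _ ≤ 2 * (a * ε ^ 2) * Real.exp (κ * T) := by
          gcongr
          exact ht.2
      _ = (G - 1) * ε ^ 2 := by rw [hG]; ring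
      _ ≤ G ^ 2 * ε ^ 2 := by
          gcongr
          nlinarith
      _ = _ := by ring
  have hνG : ν t ≤ G * ε := by
    have := le_of_sq_le_sq hsq (by positivity)
    linarith
  have := ((hzν t ht).mono hνG).add (hΘ t ht) (by positivity) (by positivity)
  rw [hz, sub_add_cancel] at this
  exact this.mono (le_of_eq (by ring))

end ErrorEstimate

end SymHyp

end

/-! ### Reduction of the theorem to the error estimate. -/

theorem mainTheorem12 (d N m k r : ℕ) (T : ℝ)
    (A₀ : EuclideanSpace ℝ (Fin N) → Matrix (Fin N) (Fin N) ℝ)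
    (A : Fin d → EuclideanSpace ℝ (Fin N) → Matrix (Fin N) (Fin N) ℝ)
    (L : SymHyp.FirstOrderOp d N m) (K c₁ c₂ : ℝ)
    (hT : 0 < T) (hk : d / 2 + 2 ≤ k) (hr : r ≤ k - 1)
    (hA₀smooth : ∀ a b, ContDiff ℝ ∞ (fun y => A₀ y a b))
    (hAsmooth : ∀ i a b, ContDiff ℝ ∞ (fun y => A i y a b))
    (hA₀symm : ∀ y, (A₀ y).IsSymm)
    (hAsymm : ∀ i y, (A i y).IsSymm)
    (hA₀pos : ∀ y, (A₀ y).PosDef) :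
    ∃ c : ℝ, 0 < c ∧
      ∀ (δ : ℝ), 0 < δ →
      ∀ (F : ℝ → SymHyp.L2 d N) (u₀ : SymHyp.L2 d N)
        (u U : ℝ → SymHyp.L2 d N) (v V : ℝ → SymHyp.L2 d m)
        (Ξu ΞU ξu ξU : ℝ → SymHyp.L2 d N),
        SymHyp.ContInSobolev T (k - 1) F →
        SymHyp.IsSolution T k A₀ A L F u v Ξu ξu →
        SymHyp.IsSolution T k A₀ A L F U V ΞU ξU →
        u 0 = u₀ → U 0 = u₀ →
        (∀ t ∈ Set.Icc 0 T,
          SymHyp.sobolevNorm (k - 1) (F t) ≤ ENNReal.ofReal K ∧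
          SymHyp.sobolevNorm k (u t) ≤ ENNReal.ofReal K ∧
          SymHyp.sobolevNorm k (U t) ≤ ENNReal.ofReal K) →
        (∀ t ∈ Set.Icc 0 T,
          SymHyp.sobolevNorm (k - r) (Ξu t) + SymHyp.sobolevNorm (k - r) (ΞU t) +
            SymHyp.sobolevNorm (k - r - 1) (ξu t) + SymHyp.sobolevNorm (k - r - 1) (ξU t) ≤
            ENNReal.ofReal (c₁ * δ)) →
        (∀ t ∈ Set.Icc 0 T, L.Maps (Ξu t) 0 ∧ L.Maps (ΞU t) 0) →
        (∀ t ∈ Set.Icc 0 T,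
          SymHyp.sobolevNorm (k - r - 1) (derivWithin ΞU (Set.Icc 0 T) t) ≤
            ENNReal.ofReal c₂) →
        ∀ t ∈ Set.Icc 0 T,
          SymHyp.sobolevNorm (k - r - 1) (u t - U t) ≤ ENNReal.ofReal (c * δ) := by
  obtain ⟨p, rfl⟩ : ∃ p, k = p + 1 := ⟨k - 1, by lia⟩
  rw [Nat.add_sub_cancel] at hr ⊢
  obtain ⟨s, hs⟩ : ∃ s, p = s + r := ⟨p - r, by lia⟩
  have e1 : p + 1 - r = s + 1 := by lia
  have hA : SymHyp.SymCoeffs A₀ A := ⟨hA₀smooth, hAsmooth, hA₀symm, hAsymm, hA₀pos⟩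
  -- The hypothesis on k gives d < 2p for p = k - 1, since ⌊d/2⌋ + 1 ≤ p. The constant K may be
  -- negative, hence max K 0, which has the same `ENNReal.ofReal`.
  obtain ⟨C, hC, h⟩ := hA.exists_error_le (p := p) (s := s) (by lia) (le_max_right K 0) (by lia)
    hT.le L
  have hmax : ∀ x : ℝ, ENNReal.ofReal x = ENNReal.ofReal (max x 0) := fun x => by
    rcases le_total x 0 with hx | hx
    · rw [max_eq_right hx, ENNReal.ofReal_of_nonpos hx, ENNReal.ofReal_zero]
    · rw [max_eq_left hx]
  -- The error size is ε = |c₁|δ, as c₁ may be negative; the summand 1 makes c strictly positive.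
  refine ⟨C * |c₁| + 1, by positivity, ?_⟩
  intro δ hδ F u₀ u U v V Ξu ΞU ξu ξU hF hu hU hu0 hU0 hK herr hL _ t ht
  simp only [e1, Nat.add_sub_cancel] at herr ⊢
  have hle : ∀ t ∈ Set.Icc 0 T, _ := fun t ht =>
    (herr t ht).trans (ENNReal.ofReal_le_ofReal (mul_le_mul_of_nonneg_right (le_abs_self c₁) hδ.le))
  refine SymHyp.SobLE.mono (h (|c₁| * δ) F u U v V Ξu ΞU ξu ξU
    { ε_nonneg := by positivity
      contF := hF
      solu := hu
      solU := hU
      init := hu0.trans hU0.symm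
      F_le := fun t ht => (hK t ht).1.trans (hmax K).le
      u_le := fun t ht => (hK t ht).2.1.trans (hmax K).le
      U_le := fun t ht => (hK t ht).2.2.trans (hmax K).le
      Ξu_le := fun t ht => le_trans (by rw [add_assoc, add_assoc]; exact le_self_add) (hle t ht)
      ΞU_le := fun t ht => le_trans (by
        rw [add_assoc, add_assoc]; exact le_add_of_le_right le_self_add) (hle t ht)
      ξu_le := fun t ht => le_trans (by rw [add_assoc]; exact le_add_of_le_right le_self_add)
        (hle t ht)
      ξU_le := fun t ht => le_trans le_add_self (hle t ht)
      mapsu := fun t ht => (hL t ht).1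
      mapsU := fun t ht => (hL t ht).2 } t ht) ?_
  nlinarith
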